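/- **Setting.** Let $B$ be a quaternion algebra over $\mathbb{Q}$ with reduced discriminant $d_B$ (the product of the primes at which $B$ ramifies), reduced trace $\operatorname{tr}$ and reduced norm $\det$. Put $B_\infty = B\otimes\mathbb{R}$, $B_p = B\otimes\mathbb{Q}_p$ and $G(\mathbb{R}) = B_\infty^\times/\mathbb{R}^\times$. Let $R\subset B$ be an Eichler order (an intersection of two maximal orders) of squarefree level $N$; that is, $N\ge 1$ is coprime to $d_B$ and for every prime $p\nmid d_B$ there is an isomorphism $B_p\cong M_2(\mathbb{Q}_p)$ mapping $R_p = R\otimes\mathbb{Z}_p$ onto $\begin{pmatrix}\mathbb{Z}_p&\mathbb{Z}_p\\N\mathbb{Z}_p&\mathbb{Z}_p\end{pmatrix}$. For $\ell\mid d_BN$, let $R(\ell)$ be the lattice in $B$ whose local component at $p$ is $R_p$ if $p\nmid\ell$ and the dual lattice $R_p^\vee=\{x\in B_p:\operatorname{tr}(x\bar y)\in\mathbb{Z}_p\text{ for all }y\in R_p\}$ if $p\mid\ell$, and let $R(\ell)^0$ be the set of its elements of reduced trace $0$. Let $\mathbf{i},\mathbf{j}\in B_\infty$ satisfy $\mathbf{i}^2=-1$,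 $\mathbf{j}^2=\pm1$ ($+1$ if $B$ is indefinite, $-1$ if $B$ is definite) and $\mathbf{i}\mathbf{j}=-\mathbf{j}\mathbf{i}$. For $T>0$ and $0<\delta\le 1$, let $\Omega(\delta,T)$ be the set of all $a\mathbf{i}+b\mathbf{j}+c\,\mathbf{i}\mathbf{j}+d\in B_\infty$ ($a,b,c,d\in\mathbb{R}$) with $$a^2+b^2+c^2+d^2\le T^2,\qquad b^2+c^2\le\delta T^2 .$$ If $B$ is split, take $B=M_2(\mathbb{Q})$, $R=\begin{pmatrix}\mathbb{Z}&\mathbb{Z}\\N\mathbb{Z}&\mathbb{Z}\end{pmatrix}$ and $\mathbf{i}=\begin{pmatrix}0&1\\-1&0\end{pmatrix}$, let $A_0(N)$ be the group generated by $\Gamma_0(N)$ and all Atkin–Lehner operators, and for $g\in G(\mathbb{R})=\mathrm{PGL}_2(\mathbb{R})$ put $$H(g)=\max_{\gamma\in A_0(N)}\operatorname{Im}(\gamma z),$$ where $z$ is $g\cdot\sqrt{-1}$ if $\det g>0$, and its complex conjugate if $\det g<0$. **Theorem (Type II estimates).** For every $\varepsilon>0$ there is a constant $C_\varepsilon>0$,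 depending only on $\varepsilon$, such that for all $B,R,N,\ell,\mathbf{i},\mathbf{j},\delta,T$ as above, every $g\in G(\mathbb{R})$ and every $n\in\frac1\ell\mathbb{Z}$, the set $g^{-1}R(\ell)^0g\cap\Omega(\delta,T)\cap\det^{-1}(\{n\})$ is finite, and $$\left|g^{-1}R(\ell)^0g\cap\Omega(\delta,T)\cap\det{}^{-1}(\{n\})\right|\le C_\varepsilon\,\bigl(d_BN(1+T)\bigr)^{\varepsilon}\left(1+\ell\,\delta^{1/2}H(g)\,T+\frac{\ell^2}{d_BN}\,\delta T^2\right),$$ where the term involving $H(g)$ is omitted if $B$ is not split. -/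

import Mathlib

open scoped Quaternion Matrix MatrixGroups

noncomputable section

namespace TypeII

/-! ### Quaternion algebras over the rationals and their completions -/

/-- The scalar extension `B ⊗ K` of the quaternion algebra `B = ℍ[ℚ,a,b]`
(basis `1, i, j, k = ij = -ji` with `i² = a`, `j² = b`) to a field `K` of characteristic zero. -/
abbrev QuatExt (a b : ℚ) (K : Type) [Field K] : Type := ℍ[K,(a : K),(b : K)]

/-- The canonical map `B → B ⊗ K`. -/
def toExt {a b : ℚ} (K : Type) [Field K] (x : ℍ[ℚ,a,b]) : QuatExt a b K :=
  ⟨(x.re : K), (x.imI : K), (x.imJ : K), (x.imK : K)⟩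

/-- The reduced trace `x + x̄`, as a scalar. -/
def redTrace {K : Type} [Field K] {a b : K} (x : ℍ[K,a,b]) : K := (x + star x).re

/-- The reduced norm `x x̄`, as a scalar. -/
def redNorm {K : Type} [Field K] {a b : K} (x : ℍ[K,a,b]) : K := (x * star x).re

/-- `B = ℍ[ℚ,a,b]` is split if it is isomorphic to the algebra of `2 × 2` matrices. -/
def IsSplit (a b : ℚ) : Prop := Nonempty (ℍ[ℚ,a,b] ≃ₐ[ℚ] Matrix (Fin 2) (Fin 2) ℚ)

/-- `B` ramifies at `p` if `B ⊗ ℚ_p` is a division algebra. -/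
def RamifiedAt (a b : ℚ) (p : ℕ) [Fact p.Prime] : Prop :=
  ∀ x : QuatExt a b ℚ_[p], x ≠ 0 → IsUnit x

/-- A prime number, seen as an instance. -/
instance factPrimes (p : Nat.Primes) : Fact (p : ℕ).Prime := ⟨p.2⟩

/-- The reduced discriminant `d_B`: the product of the (finitely many) primes at which the
quaternion algebra `B = ℍ[ℚ,a,b]`, `a, b ≠ 0`, ramifies. -/
def redDisc (a b : ℚ) : ℕ := ∏ᶠ (p : Nat.Primes) (_ : RamifiedAt a b p), (p : ℕ)

/-! ### Orders -/

/-- An order of a finite-dimensional `ℚ`-algebra: a subring that is a full lattice. -/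
def IsZOrder {B : Type} [Ring B] [Algebra ℚ B] (O : Subring B) : Prop :=
  O.toAddSubgroup.FG ∧ Submodule.span ℚ (O : Set B) = ⊤

/-- A maximal order. -/
def IsMaxOrder {B : Type} [Ring B] [Algebra ℚ B] (O : Subring B) : Prop :=
  IsZOrder O ∧ ∀ O' : Subring B, IsZOrder O' → O ≤ O' → O' = O

/-- An Eichler order: an intersection of two maximal orders. -/
def IsEichler {B : Type} [Ring B] [Algebra ℚ B] (R : Subring B) : Prop :=
  ∃ O₁ O₂ : Subring B, IsMaxOrder O₁ ∧ IsMaxOrder O₂ ∧ R = O₁ ⊓ O₂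

/-- The completion `R_p = R ⊗ ℤ_p`, i.e. the `ℤ_p`-span of `R` in `B_p`. -/
def localOrder {a b : ℚ} (R : Subring ℍ[ℚ,a,b]) (p : ℕ) [Fact p.Prime] :
    Submodule ℤ_[p] (QuatExt a b ℚ_[p]) :=
  Submodule.span ℤ_[p] (toExt ℚ_[p] '' (R : Set ℍ[ℚ,a,b]))

/-- The lattice `R_p^∨` dual to `R_p` for the trace form `⟨x, y⟩ = tr (x ȳ)`. -/
def localDual {a b : ℚ} (R : Subring ℍ[ℚ,a,b]) (p : ℕ) [Fact p.Prime] :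
    Set (QuatExt a b ℚ_[p]) :=
  {x | ∀ y ∈ localOrder R p, ‖redTrace (x * star y)‖ ≤ 1}

/-- `R` has level `N`: the natural number `N ≥ 1` is coprime to `d_B`, and for every prime
`p ∤ d_B` there is an isomorphism from `B_p` to the `2 × 2` matrices over `ℚ_p` that maps `R_p`
onto the matrices with entries in `ℤ_p` whose lower left entry lies in `N ℤ_p`. -/
def HasLevel {a b : ℚ} (R : Subring ℍ[ℚ,a,b]) (N : ℕ) : Prop :=
  0 < N ∧ N.Coprime (redDisc a b) ∧
    ∀ p : Nat.Primes, ¬ (p : ℕ) ∣ redDisc a b →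
      ∃ φ : QuatExt a b ℚ_[p] ≃ₐ[ℚ_[p]] Matrix (Fin 2) (Fin 2) ℚ_[p],
        ∀ x, x ∈ localOrder R p ↔
          ‖φ x 0 0‖ ≤ 1 ∧ ‖φ x 0 1‖ ≤ 1 ∧ ‖φ x 1 0‖ ≤ ‖(N : ℚ_[p])‖ ∧ ‖φ x 1 1‖ ≤ 1

/-- The lattice `R(ℓ)` of `B` whose local component is `R_p^∨` for `p ∣ ℓ` and `R_p` for
`p ∤ ℓ`. -/
def partialDual {a b : ℚ} (R : Subring ℍ[ℚ,a,b]) (ℓ : ℕ) : Set ℍ[ℚ,a,b] :=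
  {x | ∀ p : Nat.Primes,
    ((p : ℕ) ∣ ℓ → toExt ℚ_[p] x ∈ localDual R p) ∧
    (¬ (p : ℕ) ∣ ℓ → toExt ℚ_[p] x ∈ localOrder R p)}

/-! ### Archimedean regions -/

/-- Coordinates of `B_∞` adapted to the compact torus `K_∞ = {exp (θ i)}`: `i² = -1`,
`j² = ±1` and `ij = -ji`, so that `1, i, j, ij` is a basis of `B_∞` and `i, j, ij` have trace `0`.
The sign of `j²` is forced: `+1` if `B` is indefinite and `-1` if `B` is definite. -/
structure IsFrame {a b : ℚ} (i j : QuatExt a b ℝ) : Prop where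
  i_sq : i * i = -1
  j_sq : j * j = 1 ∨ j * j = -1
  anticomm : i * j = -(j * i)

/-- The region `Ω(δ,T)` of all `t i + u j + v ij + d` with `t² + u² + v² + d² ≤ T²` and
`u² + v² ≤ δ T²`. It does not depend on the choice of `j`. -/
def Omega {a b : ℚ} (i j : QuatExt a b ℝ) (δ T : ℝ) : Set (QuatExt a b ℝ) :=
  {x | ∃ t u v d : ℝ, x = t • i + u • j + v • (i * j) + d • 1 ∧
    t ^ 2 + u ^ 2 + v ^ 2 + d ^ 2 ≤ T ^ 2 ∧ u ^ 2 + v ^ 2 ≤ δ * T ^ 2}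

/-- The set `g⁻¹ R(ℓ)⁰ g ∩ Ω(δ,T) ∩ det⁻¹({n})` in `B_∞`. -/
def typeIISet {a b : ℚ} (R : Subring ℍ[ℚ,a,b]) (ℓ : ℕ) (i j : QuatExt a b ℝ)
    (g : (QuatExt a b ℝ)ˣ) (δ T : ℝ) (n : ℚ) : Set (QuatExt a b ℝ) :=
  {x | (∃ γ ∈ partialDual R ℓ, redTrace γ = 0 ∧
      x = (↑g⁻¹ : QuatExt a b ℝ) * toExt ℝ γ * (g : QuatExt a b ℝ)) ∧
    x ∈ Omega i j δ T ∧ redNorm x = (n : ℝ)}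

/-! ### The split case -/

/-- The standard order of level `N`: integral matrices with lower left entry divisible by `N`. -/
def standardOrder (N : ℕ) : Set (Matrix (Fin 2) (Fin 2) ℚ) :=
  {M | ∃ x y z w : ℤ, M = !![(x : ℚ), (y : ℚ); (N : ℚ) * (z : ℚ), (w : ℚ)]}

/-- The extension of scalars `B_∞ → M₂(ℝ)` of an isomorphism `e : B ≃ M₂(ℚ)`: it is the
`ℝ`-algebra homomorphism that agrees with `e` on the generators `i` and `j` of `B`. -/
def realExt {a b : ℚ} (e : ℍ[ℚ,a,b] ≃ₐ[ℚ] Matrix (Fin 2) (Fin 2) ℚ) :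
    QuatExt a b ℝ →ₐ[ℝ] Matrix (Fin 2) (Fin 2) ℝ :=
  QuaternionAlgebra.lift
    { i := (e ⟨0, 1, 0, 0⟩).map (Rat.castHom ℝ)
      j := (e ⟨0, 0, 1, 0⟩).map (Rat.castHom ℝ)
      k := (e ⟨0, 0, 0, 1⟩).map (Rat.castHom ℝ)
      i_mul_i := by
        rw [← Matrix.map_mul, ← map_mul, show ((⟨0, 1, 0, 0⟩ : ℍ[ℚ,a,b]) * ⟨0, 1, 0, 0⟩) = a • 1 by
          ext <;> simp, map_smul, map_one]
        ext r s
        simp [Matrix.one_apply]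
        split_ifs <;> simp
      j_mul_j := by
        rw [← Matrix.map_mul, ← map_mul, show ((⟨0, 0, 1, 0⟩ : ℍ[ℚ,a,b]) * ⟨0, 0, 1, 0⟩) = b • 1 by
          ext <;> simp, map_smul, map_one]
        ext r s
        simp [Matrix.one_apply]
        split_ifs <;> simp
      i_mul_j := by
        rw [← Matrix.map_mul, ← map_mul]
        congr 2
        ext <;> simp
      j_mul_i := by
        rw [← Matrix.map_mul, ← map_mul, show ((⟨0, 0, 1, 0⟩ : ℍ[ℚ,a,b]) * ⟨0, 1, 0, 0⟩) =
          -⟨0, 0, 0, 1⟩ by ext <;> simp, map_neg]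
        ext r s
        simp }

/-- The extension of scalars agrees with `e` on `B`. -/
theorem realExt_toExt {a b : ℚ} (e : ℍ[ℚ,a,b] ≃ₐ[ℚ] Matrix (Fin 2) (Fin 2) ℚ)
    (x : ℍ[ℚ,a,b]) : realExt e (toExt ℝ x) = (e x).map (Rat.castHom ℝ) := by
  have hx : x = x.re • 1 + x.imI • ⟨0, 1, 0, 0⟩ + x.imJ • ⟨0, 0, 1, 0⟩ +
      x.imK • ⟨0, 0, 0, 1⟩ := by
    ext <;> simp
  conv_rhs => rw [hx]
  simp only [map_add, map_smul, map_one]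
  ext r s
  simp [realExt, toExt, QuaternionAlgebra.Basis.lift, Matrix.algebraMap_matrix_apply,
    Matrix.one_apply]
  split_ifs <;> simp

/-- `γ` is an Atkin--Lehner operator for `Γ₀(N)`: a matrix `(Qx, y; Nz, Qw)` of determinant `Q`
with `x, y, z, w` integers, for some positive divisor `Q` of `N` coprime to `N / Q`. -/
def IsAtkinLehner (N : ℕ) (γ : GL (Fin 2) ℝ) : Prop :=
  ∃ Q M : ℕ, 0 < Q ∧ N = Q * M ∧ Q.Coprime M ∧ ∃ x y z w : ℤ,
    (γ : Matrix (Fin 2) (Fin 2) ℝ) =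
      !![(Q : ℝ) * (x : ℝ), (y : ℝ); (N : ℝ) * (z : ℝ), (Q : ℝ) * (w : ℝ)] ∧
    (γ : Matrix (Fin 2) (Fin 2) ℝ).det = (Q : ℝ)

/-- The group `A₀(N)` generated by `Γ₀(N)` and all Atkin--Lehner operators. -/
def atkinLehnerGroup (N : ℕ) : Subgroup (GL (Fin 2) ℝ) :=
  Subgroup.closure
    (((CongruenceSubgroup.Gamma0 N).map (Matrix.SpecialLinearGroup.mapGL ℝ) :
      Set (GL (Fin 2) ℝ)) ∪ {γ | IsAtkinLehner N γ})

/-- The height `H(z)`, the maximum of `Im (γ z)` over `γ ∈ A₀(N)`. -/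
def height (N : ℕ) (z : UpperHalfPlane) : ℝ :=
  ⨆ γ : atkinLehnerGroup N, ((γ : GL (Fin 2) ℝ) • z).im

/-- The height `H(g)` of `g ∈ G(ℝ)`, where `G(ℝ)` is identified with `PGL₂(ℝ)` through `e`, is the
height of the point `g • i` of the upper half-plane. If `det g < 0`, then `g • i` is the complex
conjugate of the usual Möbius transform; the point of `Γ₀(N) \ ℍ` represented by `g` is then that
of `-conj (g • i)`, which has the same height since `diag(-1, 1)` normalizes `A₀(N)`. -/
def heightOf {a b : ℚ} (e : ℍ[ℚ,a,b] ≃ₐ[ℚ] Matrix (Fin 2) (Fin 2) ℚ) (N : ℕ)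
    (g : (QuatExt a b ℝ)ˣ) : ℝ :=
  height N ((Units.map (realExt e).toMonoidHom g : GL (Fin 2) ℝ) • UpperHalfPlane.I)

end TypeII

end

/-!
The elements counted are the trace zero elements `y` of a lattice of `B`, with `y` of fixed norm
`n` and `g⁻¹ y g` in a thin neighbourhood of the torus. Write `⟨x, y⟩ = tr (x ȳ)` and `D = d_B N`.
Let `n ≠ 0`, fix one such element `x` and sort the others by `⟨x, y⟩`.

* Geometry. Up to sign, `y` is close to `x`, so that `⟨x, y⟩ ∓ 2 n = O(δ T²)` for one choice of
  the sign (`IsFrame.bil_bounds`).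
* Arithmetic. `4 ℓ ⟨x, y⟩` is an integer, and the Gram determinant `4 n² - ⟨x, y⟩²` is divisible
  by the odd primes of `D / ℓ`, because the ternary form of trace zero elements has rank one modulo
  such a prime (`bil_int_of_partialDual`, `dvd_bil_sub_mul_add`). As `D` is squarefree, this
  confines `⟨x, y⟩` to a divisor function many residue classes, each of which contributes
  `O(1 + ℓ² δ T² / D)` values (`ncard_dvd_sub_mul_add_le`).
* Fibres. If `⟨x, y⟩ = m` with `m² ≠ 4 n²`, then a second element `y₀` of the same fibre turns
  `⟨y₀, y⟩` and `tr (x y₀ y)`, which determine `y`, into a solution of a Pell equation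
  `r² + c s² = K`, with `O(X^ε)` solutions of size `X` (`exists_ncard_pellSet_le`,
  `exists_ncard_plane_le`). These steps give `exists_ncard_nondegenerate_le`.

There remain the `y` with `⟨x, y⟩ = ± 2 n`, i.e. with `y ∓ x` of norm zero. In a division algebra
these are `± x`; likewise, there is at most one element if `n = 0`. In `M₂(ℚ)` with `n ≠ 0`,
`y ∓ x` is a nilpotent matrix orthogonal to `x`, of size `O(δ^{1/2} T)`, and such matrices lie on
two lines. A nonzero nilpotent matrix in the lattice corresponds to a cusp `p / q`, and an
Atkin–Lehner operator that sends `p / q` to `∞` bounds its size from below by a multiple of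
`1 / (ℓ H)` (`one_le_height_mul`); hence there are `O(1 + ℓ H δ^{1/2} T)` points on every line. This
uses that the supremum defining `H` is finite, because `A₀(N)` normalizes the standard order
(`bddAbove_height`). If `n = 0`, all elements are nilpotent: those of content `k` with distinct
slopes `α / κ` have slopes that are separated by a multiple of `k √N / ℓ`, since the inner product
of two of them is in `k² N ℓ⁻² ℤ`, and a sum over `k` counts them (`ncard_nilpotents_le`).
-/

namespace TypeII

/-! ### Divisors, counting lemmas -/

theorem one_add_le_const_mul_rpow {ε : ℝ} (hε : 0 < ε) :
    ∃ C : ℝ, 1 ≤ C ∧ ∀ (x : ℝ), 2 ≤ x → ∀ k : ℕ, (k + 1 : ℝ) ≤ C * (x ^ k) ^ ε := by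
  have h2 : 1 < (2 : ℝ) ^ ε := Real.one_lt_rpow (by norm_num) hε
  set t := (2 : ℝ) ^ ε - 1 with ht
  have ht0 : 0 < t := by rw [ht]; linarith
  refine ⟨1 + 1 / t, by have : 0 < 1 / t := by positivity
                        linarith, fun x hx k => ?_⟩
  have h1 : ((2 : ℝ) ^ ε) ^ k ≤ (x ^ k) ^ ε := by
    have : ((2 : ℝ) ^ ε) ^ k = ((2 : ℝ) ^ k) ^ ε := by
      rw [← Real.rpow_natCast, ← Real.rpow_mul (by norm_num), ← Real.rpow_natCast,
        ← Real.rpow_mul (by norm_num), mul_comm]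
    rw [this]
    gcongr
  have hb : 1 + (k : ℝ) * t ≤ ((2 : ℝ) ^ ε) ^ k := by
    have := one_add_mul_le_pow (a := t) (by linarith) k
    rwa [show 1 + t = (2 : ℝ) ^ ε by rw [ht]; ring] at this
  calc (k + 1 : ℝ) ≤ (1 + 1 / t) * (1 + k * t) := by
        have : (1 + 1 / t) * (1 + k * t) = 1 + k * t + 1 / t + k := by field_simp; ring
        rw [this]
        have : 0 ≤ (k : ℝ) * t := by positivity
        have : 0 < 1 / t := by positivity
        linarith
    _ ≤ _ := by gcongr; linarith

/-- The divisor bound `d(n) ≪ n ^ ε`. Only the primes `p < 2 ^ (1 / ε)` contribute to the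
constant: for the others `k + 1 ≤ 2 ^ k ≤ (p ^ k) ^ ε`. -/
theorem exists_card_divisors_le {ε : ℝ} (hε : 0 < ε) :
    ∃ C : ℝ, 1 ≤ C ∧ ∀ n : ℕ, n ≠ 0 → (n.divisors.card : ℝ) ≤ C * (n : ℝ) ^ ε := by
  obtain ⟨C, hC1, hC⟩ := one_add_le_const_mul_rpow hε
  set P : ℕ := ⌈(2 : ℝ) ^ (1 / ε)⌉₊ with hP
  have hC0 : 0 < C := by linarith
  refine ⟨C ^ P, one_le_pow₀ hC1, fun n hn => ?_⟩
  have key : ∀ p : ℕ, p.Prime → ∀ k : ℕ,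
      (k + 1 : ℝ) ≤ (if p < P then C else 1) * ((p : ℝ) ^ k) ^ ε := by
    intro p hp k
    have hp2 : (2 : ℝ) ≤ p := by exact_mod_cast hp.two_le
    split_ifs with h
    · exact hC p hp2 k
    · have h1 : (2 : ℝ) ^ (1 / ε) ≤ p := (Nat.le_ceil _).trans (by exact_mod_cast not_lt.1 h)
      have h2 : (2 : ℝ) ≤ (p : ℝ) ^ ε := by
        have := Real.rpow_le_rpow (by positivity) h1 hε.le
        rwa [← Real.rpow_mul (by norm_num), one_div_mul_cancel hε.ne', Real.rpow_one] at this
      have h3 : ((p : ℝ) ^ k) ^ ε = ((p : ℝ) ^ ε) ^ k := by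
        rw [← Real.rpow_natCast, ← Real.rpow_mul (by positivity), ← Real.rpow_natCast,
          ← Real.rpow_mul (by positivity), mul_comm]
      rw [h3, one_mul]
      calc (k + 1 : ℝ) ≤ 2 ^ k := by exact_mod_cast Nat.lt_two_pow_self (n := k)
        _ ≤ _ := by gcongr
  rw [Nat.card_divisors hn]
  push_cast
  calc ∏ p ∈ n.primeFactors, ((n.factorization p : ℝ) + 1)
      ≤ ∏ p ∈ n.primeFactors, ((if p < P then C else 1) *
          ((p : ℝ) ^ n.factorization p) ^ ε) :=
        Finset.prod_le_prod (fun _ _ => by positivity)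
          (fun p hp => key p (Nat.prime_of_mem_primeFactors hp) _)
    _ = (∏ p ∈ n.primeFactors, (if p < P then C else 1)) * (n : ℝ) ^ ε := by
        rw [Finset.prod_mul_distrib]
        congr 1
        rw [Real.finsetProd_rpow _ _ (fun _ _ => by positivity)]
        congr 1
        have := Nat.prod_factorization_pow_eq_self hn
        conv_rhs => rw [← this]
        rw [Finsupp.prod, Nat.support_factorization]
        push_cast
        rfl
    _ ≤ _ := by
        gcongr
        rw [Finset.prod_ite, Finset.prod_const_one, mul_one, Finset.prod_const]
        apply pow_le_pow_right₀ hC1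
        calc _ ≤ (Finset.range P).card := Finset.card_le_card (by
              intro p hp
              simpa using (Finset.mem_filter.1 hp).2)
          _ = P := Finset.card_range P

/-- A set of real numbers of absolute value at most `L`, any two of which are at least `s` apart,
has at most `2 L / s + 1` elements. -/
theorem ncard_le_of_separated {α : Type*} (S : Set α) (f : α → ℝ) {L s : ℝ} (hL : 0 ≤ L)
    (hs : 0 < s) (hf : ∀ x ∈ S, |f x| ≤ L)
    (hsep : ∀ x ∈ S, ∀ y ∈ S, x ≠ y → s ≤ |f x - f y|) :
    S.Finite ∧ (S.ncard : ℝ) ≤ 2 * L / s + 1 := by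
  set F : α → ℤ := fun x => ⌊(f x + L) / s⌋ with hF
  have hinj : Set.InjOn F S := by
    intro x hx y hy hxy
    by_contra hne
    have h1 := hsep x hx y hy hne
    have h2 := Int.abs_sub_lt_one_of_floor_eq_floor hxy
    rw [← sub_div, abs_div, abs_of_pos hs, div_lt_one hs] at h2
    have : f x + L - (f y + L) = f x - f y := by ring
    rw [this] at h2
    linarith
  have hmaps : Set.MapsTo F S (Finset.Icc 0 ⌊2 * L / s⌋ : Finset ℤ) := by
    intro x hx
    have := abs_le.1 (hf x hx)
    simp only [Finset.coe_Icc, Set.mem_Icc, hF]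
    constructor
    · exact Int.floor_nonneg.2 (div_nonneg (by linarith) hs.le)
    · apply Int.floor_le_floor
      gcongr
      linarith
  have hfin : S.Finite := Set.Finite.of_injOn hmaps hinj (Finset.finite_toSet _)
  refine ⟨hfin, ?_⟩
  have hc := Set.ncard_le_ncard_of_injOn F hmaps hinj (Finset.finite_toSet _)
  rw [Set.ncard_coe_finset, Int.card_Icc] at hc
  have h0 : 0 ≤ ⌊2 * L / s⌋ := Int.floor_nonneg.2 (by positivity)
  calc (S.ncard : ℝ) ≤ ((⌊2 * L / s⌋ + 1 - 0).toNat : ℝ) := by exact_mod_cast hc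
    _ = (⌊2 * L / s⌋ : ℝ) + 1 := by
        have : ((⌊2 * L / s⌋ + 1 - 0).toNat : ℤ) = ⌊2 * L / s⌋ + 1 := by
          rw [Int.toNat_of_nonneg] <;> omega
        exact_mod_cast this
    _ ≤ _ := by gcongr; exact Int.floor_le _

theorem ncard_le_sum_fibers {α β : Type*} [DecidableEq β] (S : Set α) (f : α → β) (t : Finset β)
    (hf : ∀ x ∈ S, f x ∈ t) (c : β → ℝ)
    (hc : ∀ b ∈ t, {x ∈ S | f x = b}.Finite ∧ ({x ∈ S | f x = b}.ncard : ℝ) ≤ c b) :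
    S.Finite ∧ (S.ncard : ℝ) ≤ ∑ b ∈ t, c b := by
  have hS : S = ⋃ b ∈ t, {x ∈ S | f x = b} := by
    ext x
    simp only [Set.mem_iUnion, Set.mem_ofPred_eq, exists_prop]
    exact ⟨fun h => ⟨f x, hf x h, h, rfl⟩, fun ⟨_, _, h, _⟩ => h⟩
  have hfin : S.Finite := by
    rw [hS]
    exact Set.Finite.biUnion t.finite_toSet (fun b hb => (hc b hb).1)
  refine ⟨hfin, ?_⟩
  classical
  rw [Set.ncard_eq_toFinset_card S hfin,
    Finset.card_eq_sum_card_fiberwise (f := f) (t := t) (fun x hx => hf x (by simpa using hx))]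
  push_cast
  refine Finset.sum_le_sum fun b hb => le_trans (le_of_eq ?_) (hc b hb).2
  rw [Set.ncard_eq_toFinset_card _ (hc b hb).1]
  congr 2
  ext x
  simp

theorem ncard_le_card_mul {α β : Type*} [DecidableEq β] (S : Set α) (f : α → β) (t : Finset β)
    (hf : ∀ x ∈ S, f x ∈ t) {c : ℝ}
    (hc : ∀ b ∈ t, {x ∈ S | f x = b}.Finite ∧ ({x ∈ S | f x = b}.ncard : ℝ) ≤ c) :
    S.Finite ∧ (S.ncard : ℝ) ≤ t.card * c := by
  have := ncard_le_sum_fibers S f t hf (fun _ => c) hc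
  simpa using this

/-- The two-class congruence `D ∣ k (k + B)`, `D` squarefree: `k` is determined modulo `D` by
`gcd (k, D)`. -/
theorem ncard_dvd_mul_add_le {D : ℕ} (hD : Squarefree D) (B : ℤ) {L : ℝ} (hL : 0 ≤ L) :
    {k : ℤ | |(k : ℝ)| ≤ L ∧ (D : ℤ) ∣ k * (k + B)}.Finite ∧
    ({k : ℤ | |(k : ℝ)| ≤ L ∧ (D : ℤ) ∣ k * (k + B)}.ncard : ℝ) ≤
      D.divisors.card * (2 * L / D + 1) := by
  have hD0 : D ≠ 0 := hD.ne_zero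
  refine ncard_le_card_mul _ (fun k => Int.gcd k D) D.divisors ?_ ?_
  · intro k _
    rw [Nat.mem_divisors]
    exact ⟨by exact_mod_cast Int.gcd_dvd_right k (D : ℤ), hD0⟩
  · intro e he
    have heD := Nat.dvd_of_mem_divisors he
    obtain ⟨f, hf⟩ := heD
    refine ncard_le_of_separated _ (fun k : ℤ => (k : ℝ)) hL (by positivity) ?_ ?_
    · rintro k ⟨⟨hk, _⟩, _⟩
      exact hk
    · have hcop : Nat.Coprime e f := by
        rw [hf] at hD
        exact Nat.coprime_of_squarefree_mul hD
      have hfk : ∀ k : ℤ, (D : ℤ) ∣ k * (k + B) → Int.gcd k D = e →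
          (e : ℤ) ∣ k ∧ (f : ℤ) ∣ k + B := by
        intro k hk hg
        refine ⟨hg ▸ Int.gcd_dvd_left k D, ?_⟩
        have h1 : IsCoprime (f : ℤ) k := by
          rw [Int.isCoprime_iff_gcd_eq_one]
          have h2 : Int.gcd f k ∣ e := by
            rw [← hg]
            apply Int.dvd_gcd
            · exact Int.gcd_dvd_right _ _
            · exact (Int.gcd_dvd_left _ _).trans (by rw [hf]; push_cast; exact Dvd.intro_left _ rfl)
          have h3 : Int.gcd f k ∣ f := by exact_mod_cast Int.gcd_dvd_left (f : ℤ) k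
          exact Nat.eq_one_of_dvd_coprimes hcop h2 h3
        refine h1.dvd_of_dvd_mul_left (dvd_trans ?_ hk)
        rw [hf]; push_cast; exact Dvd.intro_left _ rfl
      rintro k ⟨⟨_, hk⟩, hkg⟩ l ⟨⟨_, hl⟩, hlg⟩ hne
      obtain ⟨h1, h2⟩ := hfk k hk hkg
      obtain ⟨h3, h4⟩ := hfk l hl hlg
      have h5 : (D : ℤ) ∣ k - l := by
        rw [hf]; push_cast
        refine IsCoprime.mul_dvd (Nat.isCoprime_iff_coprime.2 hcop) (dvd_sub h1 h3) ?_
        have := dvd_sub h2 h4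
        rwa [add_sub_add_right_eq_sub] at this
      have h6 := Int.le_of_dvd (abs_pos.2 (sub_ne_zero.2 hne)) ((dvd_abs _ _).2 h5)
      exact_mod_cast h6

/-! ### Representations by the forms `r² + c s²` -/

/-- Let `K ∣ A B` up to the square of a unit, where `A = s₀ r - r₀ s` and `B = s₀ r + r₀ s` are
attached to two primitive solutions. At a prime power `p ^ k ∣ K` with `p ∤ c`, one of the factors
takes everything, up to the common factor `2`. -/
theorem prime_pow_dvd_cross {c K r₀ s₀ r s : ℤ} {p k : ℕ} (hp : p.Prime) (hk : k ≠ 0)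
    (hpK : (p : ℤ) ^ k ∣ K) (hpc : ¬ (p : ℤ) ∣ c)
    (h₀ : r₀ ^ 2 + c * s₀ ^ 2 = K) (hc₀ : IsCoprime r₀ s₀)
    (h : r ^ 2 + c * s ^ 2 = K) (hc : IsCoprime r s) :
    (p : ℤ) ^ k ∣ 2 * (s₀ * r - r₀ * s) ∨ (p : ℤ) ^ k ∣ 2 * (s₀ * r + r₀ * s) := by
  have hp' : Prime (p : ℤ) := Nat.prime_iff_prime_int.1 hp
  have hpK1 : (p : ℤ) ∣ K := (dvd_pow_self _ hk).trans hpK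
  have hAB : (p : ℤ) ^ k ∣ (s₀ * r - r₀ * s) * (s₀ * r + r₀ * s) := by
    refine hpK.trans ⟨s₀ ^ 2 - s ^ 2, ?_⟩
    linear_combination s₀ ^ 2 * h - s ^ 2 * h₀
  -- `p` divides neither coordinate of a primitive solution
  have hndvd : ∀ {r s : ℤ}, r ^ 2 + c * s ^ 2 = K → IsCoprime r s →
      ¬ (p : ℤ) ∣ r ∧ ¬ (p : ℤ) ∣ s := by
    intro r s h hc
    have h1 : (p : ℤ) ∣ r → (p : ℤ) ∣ s := by
      intro hr
      have : (p : ℤ) ∣ c * s ^ 2 := by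
        rw [show c * s ^ 2 = K - r ^ 2 by rw [← h]; ring]
        exact dvd_sub hpK1 (dvd_pow hr two_ne_zero)
      exact hp'.dvd_of_dvd_pow ((hp'.dvd_or_dvd this).resolve_left hpc)
    have h2 : (p : ℤ) ∣ s → (p : ℤ) ∣ r := by
      intro hs
      have : (p : ℤ) ∣ r ^ 2 := by
        rw [show r ^ 2 = K - c * s ^ 2 by rw [← h]; ring]
        exact dvd_sub hpK1 (Dvd.dvd.mul_left (dvd_pow hs two_ne_zero) _)
      exact hp'.dvd_of_dvd_pow this
    exact ⟨fun hr => hp'.not_isUnit (hc.isUnit_of_dvd' hr (h1 hr)),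
      fun hs => hp'.not_isUnit (hc.isUnit_of_dvd' (h2 hs) hs)⟩
  have hs₀ := (hndvd h₀ hc₀).2
  have hr := (hndvd h hc).1
  have hsr : ¬ (p : ℤ) ∣ s₀ * r := hp'.not_dvd_mul hs₀ hr
  have hcop : ∀ {z : ℤ}, ¬ (p : ℤ) ∣ z → IsCoprime ((p : ℤ) ^ k) z := fun hz =>
    IsCoprime.pow_left ((Prime.coprime_iff_not_dvd hp').2 hz)
  rcases eq_or_ne p 2 with rfl | hp2
  · -- `A + B = 2 s₀ r` is not divisible by `4`
    have h4 : ∀ z w : ℤ, z + w = 2 * (s₀ * r) → ¬ (2 : ℤ) ∣ w / 2 ∨ ¬ (2 : ℤ) ∣ z / 2 ∨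
        ¬ (2 : ℤ) ∣ w ∨ ¬ (2 : ℤ) ∣ z := by
      intro z w hzw
      have : ¬ (2 : ℤ) ∣ s₀ * r := by exact_mod_cast hsr
      omega
    have hone : ∀ z w : ℤ, ((2 : ℕ) : ℤ) ^ k ∣ z * w → (¬ (2 : ℤ) ∣ w ∨ ¬ (2 : ℤ) ∣ w / 2) →
        ((2 : ℕ) : ℤ) ^ k ∣ 2 * z := by
      intro z w hzw hw
      by_cases h2w : (2 : ℤ) ∣ w
      · obtain ⟨v, rfl⟩ := h2w
        have hv : ¬ (2 : ℤ) ∣ v := by omega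
        refine (hcop (z := v) (by exact_mod_cast hv)).dvd_of_dvd_mul_right ?_
        rwa [show 2 * z * v = z * (2 * v) by ring]
      · exact ((hcop (by exact_mod_cast h2w)).dvd_of_dvd_mul_right hzw).mul_left _
    rcases h4 (s₀ * r - r₀ * s) (s₀ * r + r₀ * s) (by ring) with h | h | h | h
    · exact Or.inl (hone _ _ hAB (Or.inr h))
    · exact Or.inr (hone _ _ (by rwa [mul_comm]) (Or.inr h))
    · exact Or.inl (hone _ _ hAB (Or.inl h))
    · exact Or.inr (hone _ _ (by rwa [mul_comm]) (Or.inl h))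
  · have h2 : ¬ (p : ℤ) ∣ 2 := by
      intro h
      have : p ∣ 2 := by exact_mod_cast h
      exact hp2 ((Nat.prime_dvd_prime_iff_eq hp Nat.prime_two).1 this)
    by_cases hB : (p : ℤ) ∣ s₀ * r + r₀ * s
    · have hA : ¬ (p : ℤ) ∣ s₀ * r - r₀ * s := by
        intro hA
        have := dvd_add hA hB
        rw [show s₀ * r - r₀ * s + (s₀ * r + r₀ * s) = 2 * (s₀ * r) by ring] at this
        exact hp'.not_dvd_mul h2 hsr this
      exact Or.inr (((hcop hA).dvd_of_dvd_mul_left hAB).mul_left _)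
    · exact Or.inl (((hcop hB).dvd_of_dvd_mul_right hAB).mul_left _)

/-- Two primitive solutions with the same greatest common divisor `(2 (s₀ r - r₀ s), K)`, relative
to a reference solution `(r₀, s₀)`, define the same ideal up to the factor `2`. -/
theorem dvd_cross_of_gcd_eq {c K r₀ s₀ r₁ s₁ r₂ s₂ : ℤ}
    (hno : ∀ p : ℕ, p.Prime → ¬ ((p : ℤ) ^ 2 ∣ c ∧ (p : ℤ) ^ 2 ∣ K))
    (h₀ : r₀ ^ 2 + c * s₀ ^ 2 = K) (hc₀ : IsCoprime r₀ s₀)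
    (h₁ : r₁ ^ 2 + c * s₁ ^ 2 = K) (hc₁ : IsCoprime r₁ s₁)
    (h₂ : r₂ ^ 2 + c * s₂ ^ 2 = K) (hc₂ : IsCoprime r₂ s₂)
    (hg : Int.gcd (2 * (s₀ * r₁ - r₀ * s₁)) K = Int.gcd (2 * (s₀ * r₂ - r₀ * s₂)) K) :
    K ∣ 2 * (s₁ * r₂ - r₁ * s₂) := by
  rw [← Int.natAbs_dvd_natAbs, Nat.dvd_iff_prime_pow_dvd_dvd]
  intro p k hp hpK
  rcases eq_or_ne k 0 with rfl | hk
  · simp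
  have hp' : Prime (p : ℤ) := Nat.prime_iff_prime_int.1 hp
  rw [← Int.natCast_dvd] at hpK ⊢
  push_cast at hpK ⊢
  have hpK1 : (p : ℤ) ∣ K := (dvd_pow_self _ hk).trans hpK
  by_cases hpc : (p : ℤ) ∣ c
  · have hr : ∀ {r s : ℤ}, r ^ 2 + c * s ^ 2 = K → (p : ℤ) ∣ r := by
      intro r s h
      refine hp'.dvd_of_dvd_pow (n := 2) ?_
      rw [show r ^ 2 = K - c * s ^ 2 by rw [← h]; ring]
      exact dvd_sub hpK1 (Dvd.dvd.mul_right hpc _)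
    have hk1 : k = 1 := by
      by_contra hk1
      have hpK2 : (p : ℤ) ^ 2 ∣ K := (pow_dvd_pow _ (by omega)).trans hpK
      have h3 : (p : ℤ) ^ 2 ∣ c * s₀ ^ 2 := by
        rw [show c * s₀ ^ 2 = K - r₀ ^ 2 by rw [← h₀]; ring]
        exact dvd_sub hpK2 (pow_dvd_pow_of_dvd (hr h₀) 2)
      have h4 : ¬ (p : ℤ) ∣ s₀ := fun h =>
        hp'.not_isUnit (hc₀.isUnit_of_dvd' (hr h₀) h)
      have h5 : IsCoprime ((p : ℤ) ^ 2) (s₀ ^ 2) :=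
        IsCoprime.pow ((Prime.coprime_iff_not_dvd hp').2 h4)
      exact hno p hp ⟨h5.dvd_of_dvd_mul_right h3, hpK2⟩
    rw [hk1, pow_one]
    exact (dvd_sub ((hr h₂).mul_left _) ((hr h₁).mul_right _)).mul_left _
  · have hs₀ : ¬ (p : ℤ) ∣ s₀ := by
      intro hs
      have : (p : ℤ) ∣ r₀ ^ 2 := by
        rw [show r₀ ^ 2 = K - c * s₀ ^ 2 by rw [← h₀]; ring]
        exact dvd_sub hpK1 (Dvd.dvd.mul_left (dvd_pow hs two_ne_zero) _)
      exact hp'.not_isUnit (hc₀.isUnit_of_dvd' (hp'.dvd_of_dvd_pow this) hs)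
    have hcop : IsCoprime ((p : ℤ) ^ k) s₀ :=
      IsCoprime.pow_left ((Prime.coprime_iff_not_dvd hp').2 hs₀)
    have hiff : (p : ℤ) ^ k ∣ 2 * (s₀ * r₁ - r₀ * s₁) ↔ (p : ℤ) ^ k ∣ 2 * (s₀ * r₂ - r₀ * s₂) := by
      have h1 : ∀ z : ℤ, (p : ℤ) ^ k ∣ z ↔ (p : ℤ) ^ k ∣ (Int.gcd z K : ℤ) := fun z =>
        ⟨fun h => Int.dvd_coe_gcd h hpK, fun h => h.trans (Int.gcd_dvd_left _ _)⟩
      rw [h1, h1 (2 * (s₀ * r₂ - r₀ * s₂)), hg]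
    refine hcop.dvd_of_dvd_mul_left ?_
    by_cases hA : (p : ℤ) ^ k ∣ 2 * (s₀ * r₁ - r₀ * s₁)
    · have := dvd_sub ((hiff.1 hA).mul_left s₁) (hA.mul_left s₂)
      convert this using 1
      ring
    · have hB₁ := (prime_pow_dvd_cross hp hk hpK hpc h₀ hc₀ h₁ hc₁).resolve_left hA
      have hB₂ := (prime_pow_dvd_cross hp hk hpK hpc h₀ hc₀ h₂ hc₂).resolve_left
        (fun h => hA (hiff.2 h))
      have := dvd_sub (hB₂.mul_left s₁) (hB₁.mul_left s₂)
      convert this using 1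
      ring

/-- The quotient of two solutions in the same class is `(u ∓ v √-c) / 2` with
`u² + c v² = 4`. -/
theorem exists_unit_of_dvd_cross {c K r₁ s₁ r₂ s₂ : ℤ} (hK : K ≠ 0)
    (h₁ : r₁ ^ 2 + c * s₁ ^ 2 = K) (h₂ : r₂ ^ 2 + c * s₂ ^ 2 = K)
    (hd : K ∣ 2 * (s₁ * r₂ - r₁ * s₂)) :
    ∃ u v : ℤ, 2 * (r₁ * r₂ + c * (s₁ * s₂)) = K * u ∧ 2 * (s₁ * r₂ - r₁ * s₂) = K * v ∧
      u ^ 2 + c * v ^ 2 = 4 := by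
  obtain ⟨v, hv⟩ := hd
  have h : (2 * (r₁ * r₂ + c * (s₁ * s₂))) ^ 2 = K ^ 2 * (4 - c * v ^ 2) := by
    have : (2 * (r₁ * r₂ + c * (s₁ * s₂))) ^ 2 + c * (2 * (s₁ * r₂ - r₁ * s₂)) ^ 2 =
        4 * (r₁ ^ 2 + c * s₁ ^ 2) * (r₂ ^ 2 + c * s₂ ^ 2) := by ring
    rw [h₁, h₂, hv] at this
    linear_combination this
  have h2 : K ∣ 2 * (r₁ * r₂ + c * (s₁ * s₂)) :=
    (Int.pow_dvd_pow_iff two_ne_zero).1 (h ▸ Dvd.intro _ rfl)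
  obtain ⟨u, hu⟩ := h2
  refine ⟨u, v, hu, hv, ?_⟩
  rw [hu] at h
  have : K ^ 2 * (u ^ 2 + c * v ^ 2) = K ^ 2 * 4 := by linear_combination h
  exact mul_left_cancel₀ (pow_ne_zero 2 hK) this

/-- For `c > 0` there are at most `25` solutions in a class: `|u|, |v| ≤ 2`. -/
theorem ncard_class_le_of_pos {c K : ℤ} (hc : 0 < c) (hK : K ≠ 0) (S : Set (ℤ × ℤ))
    (hS : ∀ v ∈ S, v.1 ^ 2 + c * v.2 ^ 2 = K)
    (hd : ∀ v ∈ S, ∀ w ∈ S, K ∣ 2 * (v.2 * w.1 - v.1 * w.2)) :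
    S.Finite ∧ S.ncard ≤ 25 := by
  rcases S.eq_empty_or_nonempty with rfl | ⟨v₀, hv₀⟩
  · simp
  choose! u v hu hv huv using fun w (hw : w ∈ S) =>
    exists_unit_of_dvd_cross hK (hS v₀ hv₀) (hS w hw) (hd v₀ hv₀ w hw)
  set t : Finset (ℤ × ℤ) := Finset.Icc (-2) 2 ×ˢ Finset.Icc (-2) 2
  have hmaps : Set.MapsTo (fun w => (u w, v w)) S t := by
    intro w hw
    have h1 := huv w hw
    have h2 : u w ^ 2 ≤ 2 ^ 2 := by nlinarith [mul_nonneg hc.le (sq_nonneg (v w))]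
    have h3 : v w ^ 2 ≤ 2 ^ 2 := by nlinarith [sq_nonneg (u w), sq_nonneg (v w)]
    have h4 := abs_le.1 (abs_le_of_sq_le_sq h2 (by norm_num))
    have h5 := abs_le.1 (abs_le_of_sq_le_sq h3 (by norm_num))
    simp only [t, Finset.coe_product, Finset.coe_Icc, Set.mem_prod, Set.mem_Icc]
    exact ⟨h4, h5⟩
  have hinj : Set.InjOn (fun w => (u w, v w)) S := by
    intro w hw z hz hwz
    obtain ⟨e1, e2⟩ := Prod.mk.inj hwz
    have a1 : v₀.1 * w.1 + c * (v₀.2 * w.2) = v₀.1 * z.1 + c * (v₀.2 * z.2) := by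
      have := (hu w hw).trans (e1 ▸ (hu z hz).symm)
      linarith
    have a2 : v₀.2 * w.1 - v₀.1 * w.2 = v₀.2 * z.1 - v₀.1 * z.2 := by
      have := (hv w hw).trans (e2 ▸ (hv z hz).symm)
      linarith
    have hK0 := hS v₀ hv₀
    have b1 : K * w.1 = K * z.1 := by
      rw [← hK0]; linear_combination v₀.1 * a1 + c * v₀.2 * a2
    have b2 : K * w.2 = K * z.2 := by
      rw [← hK0]; linear_combination v₀.2 * a1 - v₀.1 * a2
    exact Prod.ext (mul_left_cancel₀ hK b1) (mul_left_cancel₀ hK b2)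
  refine ⟨Set.Finite.of_injOn hmaps hinj t.finite_toSet, ?_⟩
  have := Set.ncard_le_ncard_of_injOn _ hmaps hinj t.finite_toSet
  rw [Set.ncard_coe_finset] at this
  refine this.trans (le_of_eq ?_)
  simp [t]

/-- A unit `β = (u - v √d) / 2` of norm one lies outside of `(1/2, 2)` unless it is `1`. -/
theorem unit_gap {u v d : ℤ} (hd : 0 < d) (huv : u ^ 2 - d * v ^ 2 = 4) {β : ℝ} (hβ : 0 < β)
    (hβ' : 2 * β = u - v * √d) : β = 1 ∨ 2 ≤ β ∨ β ≤ 1 / 2 := by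
  have hsq : √(d : ℝ) ^ 2 = d := Real.sq_sqrt (by exact_mod_cast hd.le)
  have huv' : (u : ℝ) ^ 2 - d * v ^ 2 = 4 := by exact_mod_cast huv
  set γ : ℝ := (u + v * √d) / 2 with hγ
  have h1 : β * γ = 1 := by
    have hb : β = (u - v * √d) / 2 := by linarith
    rw [hb, hγ]
    linear_combination huv' / 4 - v ^ 2 / 4 * hsq
  have h2 : β + γ = u := by rw [hγ]; linarith
  have hγ0 : 0 < γ := by
    by_contra hn
    have : β * γ ≤ 0 := mul_nonpos_of_nonneg_of_nonpos hβ.le (not_lt.1 hn)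
    linarith
  by_contra hcon
  push Not at hcon
  obtain ⟨hne, hlt, hgt⟩ := hcon
  have hu2 : (2 : ℝ) < u := by
    rw [← h2]
    have : 0 < (β - 1) ^ 2 := pow_two_pos_of_ne_zero (sub_ne_zero.2 hne)
    nlinarith
  have hu3 : (3 : ℝ) ≤ u := by exact_mod_cast (show (3 : ℤ) ≤ u from by
    have : (2 : ℤ) < u := by exact_mod_cast hu2
    omega)
  have : (β - 2) * (β - 1 / 2) < 0 := mul_neg_of_neg_of_pos (by linarith) (by linarith)
  nlinarith

/-- For `c < 0` the solutions of one class and one sign, embedded into the real numbers, are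
separated by a factor `2`. -/
theorem ncard_class_le_of_neg {c K : ℤ} (hc : c < 0) (hK : K ≠ 0) {X : ℝ} (hX : 1 ≤ X)
    (hcX : |(c : ℝ)| ≤ X) (S : Set (ℤ × ℤ))
    (hS : ∀ v ∈ S, v.1 ^ 2 + c * v.2 ^ 2 = K ∧ |(v.1 : ℝ)| ≤ X ∧ |(v.2 : ℝ)| ≤ X)
    (hd : ∀ v ∈ S, ∀ w ∈ S, K ∣ 2 * (v.2 * w.1 - v.1 * w.2)) :
    S.Finite ∧ (S.ncard : ℝ) ≤ 2 * (2 * Real.log (2 * X ^ 2) / Real.log 2 + 1) := by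
  obtain ⟨d, rfl⟩ : ∃ d : ℤ, c = -d := ⟨-c, by ring⟩
  have hd0 : 0 < d := by omega
  have hsq : √(d : ℝ) ^ 2 = d := Real.sq_sqrt (by exact_mod_cast hd0.le)
  have hdX : √(d : ℝ) ≤ X := by
    have h1 : (d : ℝ) ≤ X := by
      have := (abs_le.1 hcX).1
      push_cast at this
      linarith
    exact Real.sqrt_le_iff.2 ⟨by linarith, by nlinarith⟩
  have hs0 : 0 < √(d : ℝ) := Real.sqrt_pos.2 (by exact_mod_cast hd0)
  set α : ℤ × ℤ → ℝ := fun v => v.1 + v.2 * √d with hα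
  set α' : ℤ × ℤ → ℝ := fun v => v.1 - v.2 * √d with hα'
  have hnorm : ∀ v ∈ S, α v * α' v = K := by
    intro v hv
    have h := (hS v hv).1
    have h' : (v.1 : ℝ) ^ 2 - d * v.2 ^ 2 = K := by
      rw [← h]; push_cast; ring
    simp only [hα, hα']
    linear_combination h' - (v.2 : ℝ) ^ 2 * hsq
  have hK' : (K : ℝ) ≠ 0 := by exact_mod_cast hK
  have hne : ∀ v ∈ S, α v ≠ 0 := fun v hv h => hK' (by rw [← hnorm v hv, h, zero_mul])
  have hb : ∀ v ∈ S, |α v| ≤ 2 * X ^ 2 ∧ |α' v| ≤ 2 * X ^ 2 := by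
    intro v hv
    obtain ⟨-, h1, h2⟩ := hS v hv
    have h3 : |(v.2 : ℝ) * √d| ≤ X * X := by
      rw [abs_mul, abs_of_pos hs0]
      exact mul_le_mul h2 hdX hs0.le (by linarith)
    have h4 : X ≤ X * X := by nlinarith
    constructor
    · calc |α v| ≤ |(v.1 : ℝ)| + |(v.2 : ℝ) * √d| := abs_add_le _ _
        _ ≤ _ := by nlinarith
    · calc |α' v| ≤ |(v.1 : ℝ)| + |(v.2 : ℝ) * √d| := abs_sub _ _
        _ ≤ _ := by nlinarith
  have hX2 : 1 ≤ 2 * X ^ 2 := by nlinarith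
  have hlog : ∀ v ∈ S, |Real.log (|α v|)| ≤ Real.log (2 * X ^ 2) := by
    intro v hv
    obtain ⟨h1, h2⟩ := hb v hv
    have hpos : 0 < |α v| := abs_pos.2 (hne v hv)
    rw [abs_le]
    constructor
    · rw [neg_le, ← Real.log_inv]
      apply Real.log_le_log (by positivity)
      have h3 : 1 ≤ |α v| * |α' v| := by
        rw [← abs_mul, hnorm v hv]
        exact_mod_cast Int.one_le_abs hK
      rw [inv_le_iff_one_le_mul₀ hpos]
      calc 1 ≤ |α v| * |α' v| := h3
        _ ≤ _ := by rw [mul_comm]; gcongr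
    · exact Real.log_le_log hpos h1
  have hcard : ((Finset.univ : Finset Bool).card : ℝ) = 2 := by simp
  rw [← hcard]
  refine ncard_le_card_mul S (fun v => decide (0 < α v)) Finset.univ (fun _ _ => Finset.mem_univ _)
    (fun b _ => ncard_le_of_separated _ (fun v => Real.log (|α v|)) (Real.log_nonneg hX2)
      (Real.log_pos (by norm_num)) (fun v hv => hlog v hv.1) ?_)
  rintro v ⟨hv, hvb⟩ w ⟨hw, hwb⟩ hvw
  obtain ⟨m, n, hm, hn, hmn⟩ := exists_unit_of_dvd_cross hK (hS v hv).1 (hS w hw).1 (hd v hv w hw)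
  have hrel : α v * (2 * (α w / α v)) = α v * (m - n * √d) := by
    have h1 : (K : ℝ) * (2 * α w) = K * (α v * (m - n * √d)) := by
      have hm' : (2 : ℝ) * (v.1 * w.1 - d * (v.2 * w.2)) = K * m := by
        have := congrArg (Int.cast : ℤ → ℝ) hm
        push_cast at this
        linarith
      have hn' : (2 : ℝ) * (v.2 * w.1 - v.1 * w.2) = K * n := by exact_mod_cast hn
      have h2 : (2 : ℝ) * (α' v * α w) = K * m - K * n * √d := by
        rw [← hm', ← hn']
        simp only [hα, hα']
        linear_combination (-2) * (v.2 * w.2 : ℝ) * hsq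
      rw [← hnorm v hv]
      rw [← hnorm v hv] at h2
      linear_combination α v * h2
    have := mul_left_cancel₀ hK' h1
    rw [← this]
    field_simp [hne v hv]
  have hβ' := mul_left_cancel₀ (hne v hv) hrel
  have hβ : 0 < α w / α v := by
    have h1 := hne v hv
    have h2 := hne w hw
    have h3 : (0 < α v) ↔ (0 < α w) := by
      have : decide (0 < α v) = decide (0 < α w) := hvb.trans hwb.symm
      simpa using this
    rcases lt_or_gt_of_ne h1 with h | h
    · have : α w < 0 := lt_of_le_of_ne (not_lt.1 (fun h' => by linarith [h3.2 h'])) h2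
      exact div_pos_of_neg_of_neg this h
    · exact div_pos (h3.1 h) h
  have hdiff : Real.log (|α v|) - Real.log (|α w|) = -Real.log (α w / α v) := by
    rw [Real.log_abs, Real.log_abs, Real.log_div (hne w hw) (hne v hv)]
    ring
  rw [hdiff, abs_neg]
  rcases unit_gap hd0 (by linear_combination hmn) hβ hβ' with h | h | h
  · exfalso
    have e1 : α w = α v := by rwa [div_eq_one_iff_eq (hne v hv)] at h
    have e2 : α' w = α' v := by
      have h5 := hnorm v hv
      have h6 := hnorm w hw
      rw [e1] at h6
      exact mul_left_cancel₀ (hne v hv) (h6.trans h5.symm)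
    apply hvw
    have e3 : (w.1 : ℝ) = v.1 := by
      simp only [hα, hα'] at e1 e2; linarith
    have e4 : (w.2 : ℝ) = v.2 := by
      simp only [hα] at e1
      rw [e3] at e1
      exact mul_right_cancel₀ hs0.ne' (by linarith)
    exact Prod.ext (by exact_mod_cast e3.symm) (by exact_mod_cast e4.symm)
  · exact (Real.log_le_log (by norm_num) h).trans (le_abs_self _)
  · rw [← abs_neg, ← Real.log_inv]
    refine (Real.log_le_log (by norm_num) ?_).trans (le_abs_self _)
    rw [le_inv_comm₀ (by norm_num) hβ]
    simpa using h

/-- The bound for the number of solutions in one class. -/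
noncomputable def classBound (X : ℝ) : ℝ := 25 + 2 * (2 * Real.log (2 * X ^ 2) / Real.log 2 + 1)

theorem classBound_nonneg {X : ℝ} (hX : 1 ≤ X) : 0 ≤ classBound X := by
  have : 0 ≤ Real.log (2 * X ^ 2) := Real.log_nonneg (by nlinarith)
  have h2 : 0 ≤ Real.log 2 := Real.log_nonneg (by norm_num)
  unfold classBound
  positivity

theorem ncard_class_le {c K : ℤ} (hc : c ≠ 0) (hK : K ≠ 0) {X : ℝ} (hX : 1 ≤ X)
    (hcX : |(c : ℝ)| ≤ X) (S : Set (ℤ × ℤ))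
    (hS : ∀ v ∈ S, v.1 ^ 2 + c * v.2 ^ 2 = K ∧ |(v.1 : ℝ)| ≤ X ∧ |(v.2 : ℝ)| ≤ X)
    (hd : ∀ v ∈ S, ∀ w ∈ S, K ∣ 2 * (v.2 * w.1 - v.1 * w.2)) :
    S.Finite ∧ (S.ncard : ℝ) ≤ classBound X := by
  have : 0 ≤ Real.log (2 * X ^ 2) := Real.log_nonneg (by nlinarith)
  have h2 : 0 ≤ Real.log 2 := Real.log_nonneg (by norm_num)
  rcases lt_or_gt_of_ne hc with h | h
  · obtain ⟨h1, h2⟩ := ncard_class_le_of_neg h hK hX hcX S hS hd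
    exact ⟨h1, h2.trans (by unfold classBound; linarith)⟩
  · obtain ⟨h1, h2⟩ := ncard_class_le_of_pos h hK S (fun v hv => (hS v hv).1) hd
    refine ⟨h1, ?_⟩
    have : (S.ncard : ℝ) ≤ 25 := by exact_mod_cast h2
    refine this.trans ?_
    unfold classBound
    have : 0 ≤ 2 * (2 * Real.log (2 * X ^ 2) / Real.log 2 + 1) := by positivity
    linarith

/-- The solutions of `r² + c s² = K` in a box. -/
def pellSet (c K : ℤ) (X : ℝ) : Set (ℤ × ℤ) :=
  {v | v.1 ^ 2 + c * v.2 ^ 2 = K ∧ |(v.1 : ℝ)| ≤ X ∧ |(v.2 : ℝ)| ≤ X}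

theorem ncard_primitive_pellSet_le {c K : ℤ} (hc : c ≠ 0) (hK : K ≠ 0) {X : ℝ} (hX : 1 ≤ X)
    (hcX : |(c : ℝ)| ≤ X) (hno : ∀ p : ℕ, p.Prime → ¬ ((p : ℤ) ^ 2 ∣ c ∧ (p : ℤ) ^ 2 ∣ K)) :
    {v ∈ pellSet c K X | IsCoprime v.1 v.2}.Finite ∧
    ({v ∈ pellSet c K X | IsCoprime v.1 v.2}.ncard : ℝ) ≤
      K.natAbs.divisors.card * classBound X := by
  have hB := classBound_nonneg hX
  rcases {v ∈ pellSet c K X | IsCoprime v.1 v.2}.eq_empty_or_nonempty with h | ⟨v₀, hv₀, hc₀⟩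
  · rw [h]
    simp only [Set.finite_empty, Set.ncard_empty, Nat.cast_zero, true_and]
    positivity
  refine ncard_le_card_mul _ (fun v => Int.gcd (2 * (v₀.2 * v.1 - v₀.1 * v.2)) K) _ ?_ ?_
  · intro v _
    rw [Nat.mem_divisors]
    exact ⟨Int.gcd_dvd_natAbs_right _ _, Int.natAbs_ne_zero.2 hK⟩
  · intro e _
    refine ncard_class_le hc hK hX hcX _ (fun v hv => hv.1.1) ?_
    rintro v ⟨⟨hv, hcv⟩, hve⟩ w ⟨⟨hw, hcw⟩, hwe⟩
    exact dvd_cross_of_gcd_eq hno hv₀.1 hc₀ hv.1 hcv hw.1 hcw (hve.trans hwe.symm)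

/-- Sorting the solutions by `g = gcd (r, s)` reduces to primitive ones. -/
theorem ncard_pellSet_le_of_no_common_square {c K : ℤ} (hc : c ≠ 0) (hK : K ≠ 0) {X : ℝ}
    (hX : 1 ≤ X)
    (hcX : |(c : ℝ)| ≤ X) (hno : ∀ p : ℕ, p.Prime → ¬ ((p : ℤ) ^ 2 ∣ c ∧ (p : ℤ) ^ 2 ∣ K)) :
    (pellSet c K X).Finite ∧
    ((pellSet c K X).ncard : ℝ) ≤
      K.natAbs.divisors.card * (K.natAbs.divisors.card * classBound X) := by
  have hB := classBound_nonneg hX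
  have hgK : ∀ v ∈ pellSet c K X, ((Int.gcd v.1 v.2 : ℤ)) ^ 2 ∣ K := by
    intro v hv
    rw [← hv.1]
    exact dvd_add (pow_dvd_pow_of_dvd (Int.gcd_dvd_left _ _) 2)
      ((pow_dvd_pow_of_dvd (Int.gcd_dvd_right _ _) 2).mul_left _)
  refine ncard_le_card_mul _ (fun v => Int.gcd v.1 v.2) _ ?_ ?_
  · intro v hv
    rw [Nat.mem_divisors, ← Int.natCast_dvd]
    exact ⟨(dvd_pow_self _ two_ne_zero).trans (hgK v hv), Int.natAbs_ne_zero.2 hK⟩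
  · intro g hg
    have hg0 : g ≠ 0 := by
      rintro rfl
      have := (Nat.mem_divisors.1 hg)
      exact this.2 (zero_dvd_iff.1 this.1)
    have hg0' : (g : ℤ) ≠ 0 := by exact_mod_cast hg0
    have hg1 : (1 : ℝ) ≤ g := by exact_mod_cast Nat.one_le_iff_ne_zero.2 hg0
    rcases {v ∈ pellSet c K X | Int.gcd v.1 v.2 = g}.eq_empty_or_nonempty with h | ⟨v₀, hv₀, hvg⟩
    · rw [h]
      simp only [Set.finite_empty, Set.ncard_empty, Nat.cast_zero, true_and]
      positivity
    obtain ⟨K', hK'⟩ : (g : ℤ) ^ 2 ∣ K := hvg ▸ hgK v₀ hv₀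
    have hK'0 : K' ≠ 0 := by rintro rfl; simp at hK'; exact hK hK'
    obtain ⟨hfin, hcard⟩ := ncard_primitive_pellSet_le (K := K') hc hK'0 hX hcX
      (fun p hp h => hno p hp ⟨h.1, hK' ▸ h.2.mul_left _⟩)
    have himg : {v ∈ pellSet c K X | Int.gcd v.1 v.2 = g} ⊆
        (fun v : ℤ × ℤ => ((g : ℤ) * v.1, (g : ℤ) * v.2)) ''
          {v ∈ pellSet c K' X | IsCoprime v.1 v.2} := by
      rintro ⟨r, s⟩ ⟨⟨h1, h2, h3⟩, h4⟩
      simp only at h1 h2 h3 h4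
      obtain ⟨r', hr⟩ : (g : ℤ) ∣ r := h4 ▸ Int.gcd_dvd_left _ _
      obtain ⟨s', hs⟩ : (g : ℤ) ∣ s := h4 ▸ Int.gcd_dvd_right _ _
      subst hr hs
      have habs : ∀ z : ℤ, |((g * z : ℤ) : ℝ)| ≤ X → |(z : ℝ)| ≤ X := by
        intro z hz
        push_cast at hz
        rw [abs_mul, Nat.abs_cast] at hz
        nlinarith [abs_nonneg (z : ℝ)]
      refine ⟨(r', s'), ⟨⟨?_, habs _ h2, habs _ h3⟩, ?_⟩, rfl⟩
      · apply mul_left_cancel₀ (pow_ne_zero 2 hg0')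
        rw [← hK', ← h1]
        ring
      · rw [Int.isCoprime_iff_gcd_eq_one]
        rw [Int.gcd_mul_left, Int.natAbs_natCast] at h4
        exact Nat.eq_of_mul_eq_mul_left (Nat.pos_of_ne_zero hg0) (by rw [h4, mul_one])
    refine ⟨(hfin.image _).subset himg, ?_⟩
    have h1 : {v ∈ pellSet c K X | Int.gcd v.1 v.2 = g}.ncard ≤
        {v ∈ pellSet c K' X | IsCoprime v.1 v.2}.ncard :=
      (Set.ncard_le_ncard himg (hfin.image _)).trans (Set.ncard_image_le hfin)
    have h2 : K'.natAbs.divisors.card ≤ K.natAbs.divisors.card := by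
      apply Finset.card_le_card
      apply Nat.divisors_subset_of_dvd (Int.natAbs_ne_zero.2 hK)
      rw [Int.natAbs_dvd_natAbs, hK']
      exact Dvd.intro_left _ rfl
    calc _ ≤ ({v ∈ pellSet c K' X | IsCoprime v.1 v.2}.ncard : ℝ) := by exact_mod_cast h1
      _ ≤ _ := hcard
      _ ≤ _ := by gcongr

theorem ncard_pellSet_le_of_divisors {X M : ℝ} (hX : 1 ≤ X)
    (hM : ∀ n : ℕ, n ≠ 0 → (n : ℝ) ≤ X → (n.divisors.card : ℝ) ≤ M) :
    ∀ (k : ℕ) (c K : ℤ), K.natAbs = k → c ≠ 0 → K ≠ 0 → |(c : ℝ)| ≤ X → |(K : ℝ)| ≤ X →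
      (pellSet c K X).Finite ∧ ((pellSet c K X).ncard : ℝ) ≤ M * (M * classBound X) := by
  have hB := classBound_nonneg hX
  have hM0 : 0 ≤ M := by
    have := hM 1 one_ne_zero (by simpa using hX)
    simp at this
    linarith
  intro k
  induction k using Nat.strong_induction_on with
  | _ k ih =>
    intro c K hk hc hK hcX hKX
    by_cases hno : ∀ p : ℕ, p.Prime → ¬ ((p : ℤ) ^ 2 ∣ c ∧ (p : ℤ) ^ 2 ∣ K)
    · obtain ⟨h1, h2⟩ := ncard_pellSet_le_of_no_common_square hc hK hX hcX hno
      refine ⟨h1, h2.trans ?_⟩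
      have hd := hM K.natAbs (Int.natAbs_ne_zero.2 hK) (by
        rw [Nat.cast_natAbs, Int.cast_abs]; exact hKX)
      gcongr
    · push Not at hno
      obtain ⟨p, hp, ⟨c', hc'⟩, ⟨K', hK'⟩⟩ := hno
      have hp0 : (p : ℤ) ≠ 0 := by exact_mod_cast hp.ne_zero
      have hp1 : (1 : ℝ) ≤ p := by exact_mod_cast hp.one_le
      have hc'0 : c' ≠ 0 := by rintro rfl; simp at hc'; exact hc hc'
      have hK'0 : K' ≠ 0 := by rintro rfl; simp at hK'; exact hK hK'
      have hsm : ∀ z : ℤ, |(((p : ℤ) ^ 2 * z : ℤ) : ℝ)| ≤ X → |(z : ℝ)| ≤ X := by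
        intro z hz
        push_cast at hz
        rw [abs_mul, abs_of_nonneg (by positivity)] at hz
        nlinarith [abs_nonneg (z : ℝ), one_le_pow₀ hp1 (n := 2)]
      have hlt : K'.natAbs < k := by
        rw [← hk, hK', Int.natAbs_mul, Int.natAbs_pow, Int.natAbs_natCast]
        have h1 : 0 < K'.natAbs := Int.natAbs_pos.2 hK'0
        have h2 : 1 < p ^ 2 := Nat.one_lt_pow two_ne_zero hp.one_lt
        nlinarith
      obtain ⟨hfin, hcard⟩ := ih _ hlt c' K' rfl hc'0 hK'0 (hsm _ (hc' ▸ hcX)) (hsm _ (hK' ▸ hKX))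
      have himg : pellSet c K X ⊆ (fun v : ℤ × ℤ => ((p : ℤ) * v.1, v.2)) '' pellSet c' K' X := by
        rintro ⟨r, s⟩ ⟨h1, h2, h3⟩
        simp only at h1 h2 h3
        obtain ⟨r', rfl⟩ : (p : ℤ) ∣ r := by
          rw [← Int.pow_dvd_pow_iff two_ne_zero,
            show r ^ 2 = (p : ℤ) ^ 2 * (K' - c' * s ^ 2) by
              rw [eq_sub_of_add_eq h1, hK', hc']; ring]
          exact Dvd.intro _ rfl
        refine ⟨(r', s), ⟨?_, ?_, h3⟩, rfl⟩
        · apply mul_left_cancel₀ (pow_ne_zero 2 hp0)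
          rw [← hK', ← h1, hc']
          ring
        · push_cast at h2
          rw [abs_mul, Nat.abs_cast] at h2
          simp only
          nlinarith [abs_nonneg (r' : ℝ)]
      refine ⟨(hfin.image _).subset himg, le_trans ?_ hcard⟩
      exact_mod_cast (Set.ncard_le_ncard himg (hfin.image _)).trans (Set.ncard_image_le hfin)

/-- The form `r² + c s²` represents an integer `K ≠ 0` at most `≪ X ^ ε` times in the box
`|r|, |s| ≤ X`, uniformly in `0 < |c|, |K| ≤ X`. -/
theorem exists_ncard_pellSet_le {ε : ℝ} (hε : 0 < ε) :
    ∃ C : ℝ, 1 ≤ C ∧ ∀ (X : ℝ) (c K : ℤ), 1 ≤ X → c ≠ 0 → K ≠ 0 → |(c : ℝ)| ≤ X →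
      |(K : ℝ)| ≤ X →
      (pellSet c K X).Finite ∧ ((pellSet c K X).ncard : ℝ) ≤ C * X ^ ε := by
  have hε3 : 0 < ε / 3 := by positivity
  obtain ⟨C, hC1, hC⟩ := exists_card_divisors_le hε3
  set A : ℝ := 31 + 4 * (2 / (ε / 3)) / Real.log 2 with hA
  have hl2 : 0 < Real.log 2 := Real.log_pos (by norm_num)
  have hA1 : 1 ≤ A := by
    have : 0 ≤ 4 * (2 / (ε / 3)) / Real.log 2 := by positivity
    rw [hA]; linarith
  refine ⟨C * (C * A), ?_, fun X c K hX hc hK hcX hKX => ?_⟩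
  · nlinarith [mul_le_mul hC1 hA1 zero_le_one (by linarith)]
  have hX0 : 0 < X := by linarith
  obtain ⟨h1, h2⟩ := ncard_pellSet_le_of_divisors (M := C * X ^ (ε / 3)) hX
    (fun n hn hnX => (hC n hn).trans (by gcongr)) _ c K rfl hc hK hcX hKX
  refine ⟨h1, h2.trans ?_⟩
  have hXe : 1 ≤ X ^ (ε / 3) := Real.one_le_rpow hX hε3.le
  have hlog : Real.log X ≤ X ^ (ε / 3) / (ε / 3) := Real.log_le_rpow_div hX0.le hε3
  have hcb : classBound X ≤ A * X ^ (ε / 3) := by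
    unfold classBound
    rw [Real.log_mul (by norm_num) (by positivity), Real.log_pow]
    have e1 : 25 + 2 * (2 * (Real.log 2 + (2 : ℕ) * Real.log X) / Real.log 2 + 1) =
        31 + 8 * (Real.log X / Real.log 2) := by
      push_cast; field_simp; ring
    rw [e1, hA]
    have e2 : Real.log X / Real.log 2 ≤ X ^ (ε / 3) / (ε / 3) / Real.log 2 := by gcongr
    have e3 : (31 + 4 * (2 / (ε / 3)) / Real.log 2) * X ^ (ε / 3) =
        31 * X ^ (ε / 3) + 8 * (X ^ (ε / 3) / (ε / 3) / Real.log 2) := by field_simp; ring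
    rw [e3]
    linarith
  calc C * X ^ (ε / 3) * (C * X ^ (ε / 3) * classBound X)
      ≤ C * X ^ (ε / 3) * (C * X ^ (ε / 3) * (A * X ^ (ε / 3))) := by gcongr
    _ = C * (C * A) * (X ^ (ε / 3) * X ^ (ε / 3) * X ^ (ε / 3)) := by ring
    _ = _ := by
        rw [← Real.rpow_add hX0, ← Real.rpow_add hX0]
        congr 2
        ring

/-! ### Reduced norm, reduced trace and the trace form -/

section Forms

variable {K : Type} [Field K] {a b : K}

/-- The bilinear form `tr (x ȳ)` attached to the reduced norm. -/
def bil (x y : ℍ[K,a,b]) : K := redTrace (x * star y)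

theorem redNorm_eq (x : ℍ[K,a,b]) :
    redNorm x = x.re ^ 2 - a * x.imI ^ 2 - b * x.imJ ^ 2 + a * b * x.imK ^ 2 := by
  simp [redNorm]; ring

theorem redTrace_eq (x : ℍ[K,a,b]) : redTrace x = 2 * x.re := by
  simp [redTrace]; ring

theorem bil_eq (x y : ℍ[K,a,b]) :
    bil x y = 2 * (x.re * y.re - a * (x.imI * y.imI) - b * (x.imJ * y.imJ) +
      a * b * (x.imK * y.imK)) := by
  simp [bil, redTrace]; ring

theorem redNorm_mul (x y : ℍ[K,a,b]) : redNorm (x * y) = redNorm x * redNorm y := by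
  simp only [redNorm_eq]; simp; ring

theorem redNorm_add (x y : ℍ[K,a,b]) : redNorm (x + y) = redNorm x + redNorm y + bil x y := by
  simp only [redNorm_eq, bil_eq]; simp; ring

theorem redNorm_sub (x y : ℍ[K,a,b]) : redNorm (x - y) = redNorm x + redNorm y - bil x y := by
  simp only [redNorm_eq, bil_eq]; simp; ring

theorem redNorm_neg (x : ℍ[K,a,b]) : redNorm (-x) = redNorm x := by
  simp [redNorm_eq]

theorem redNorm_one : redNorm (1 : ℍ[K,a,b]) = 1 := by simp [redNorm_eq]

theorem redNorm_zero : redNorm (0 : ℍ[K,a,b]) = 0 := by simp [redNorm_eq]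

theorem redNorm_smul (c : K) (x : ℍ[K,a,b]) : redNorm (c • x) = c ^ 2 * redNorm x := by
  simp only [redNorm_eq]; simp; ring

theorem redNorm_star (x : ℍ[K,a,b]) : redNorm (star x) = redNorm x := by
  simp only [redNorm_eq]; simp

theorem redTrace_add (x y : ℍ[K,a,b]) : redTrace (x + y) = redTrace x + redTrace y := by
  simp only [redTrace_eq]; simp; ring

theorem redTrace_sub (x y : ℍ[K,a,b]) : redTrace (x - y) = redTrace x - redTrace y := by
  simp only [redTrace_eq]; simp; ring

theorem redTrace_neg (x : ℍ[K,a,b]) : redTrace (-x) = -redTrace x := by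
  simp only [redTrace_eq]; simp

theorem redTrace_smul (c : K) (x : ℍ[K,a,b]) : redTrace (c • x) = c * redTrace x := by
  simp only [redTrace_eq]; simp; ring

theorem redTrace_mul_comm (x y : ℍ[K,a,b]) : redTrace (x * y) = redTrace (y * x) := by
  rw [redTrace_eq, redTrace_eq]
  congr 1
  simp; ring

theorem bil_comm (x y : ℍ[K,a,b]) : bil x y = bil y x := by
  simp only [bil_eq]; ring

theorem bil_self (x : ℍ[K,a,b]) : bil x x = 2 * redNorm x := by
  simp only [bil_eq, redNorm_eq]; ring

theorem bil_add_left (x y z : ℍ[K,a,b]) : bil (x + y) z = bil x z + bil y z := by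
  simp only [bil_eq]; simp; ring

theorem bil_add_right (x y z : ℍ[K,a,b]) : bil x (y + z) = bil x y + bil x z := by
  simp only [bil_eq]; simp; ring

theorem bil_sub_right (x y z : ℍ[K,a,b]) : bil x (y - z) = bil x y - bil x z := by
  simp only [bil_eq]; simp; ring

theorem bil_smul_left (c : K) (x y : ℍ[K,a,b]) : bil (c • x) y = c * bil x y := by
  simp only [bil_eq]; simp; ring

theorem bil_smul_right (c : K) (x y : ℍ[K,a,b]) : bil x (c • y) = c * bil x y := by
  simp only [bil_eq]; simp; ring

theorem mul_self_eq (x : ℍ[K,a,b]) : x * x = redTrace x • x - redNorm x • 1 := by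
  ext <;> simp [redTrace_eq, redNorm_eq] <;> ring

theorem mul_star_eq (x : ℍ[K,a,b]) : x * star x = redNorm x • 1 := by
  ext <;> simp [redNorm_eq] <;> ring

/-- Conjugation by a unit preserves the trace form. -/
theorem bil_conj (g : (ℍ[K,a,b])ˣ) (x y : ℍ[K,a,b]) :
    bil ((↑g⁻¹ : ℍ[K,a,b]) * x * (g : ℍ[K,a,b])) ((↑g⁻¹ : ℍ[K,a,b]) * y * (g : ℍ[K,a,b])) =
      bil x y := by
  have h1 : redNorm (g : ℍ[K,a,b]) * redNorm (↑g⁻¹ : ℍ[K,a,b]) = 1 := by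
    rw [← redNorm_mul, Units.mul_inv, redNorm_one]
  have h2 : ∀ z : ℍ[K,a,b], redNorm ((↑g⁻¹ : ℍ[K,a,b]) * z * (g : ℍ[K,a,b])) = redNorm z := by
    intro z
    rw [redNorm_mul, redNorm_mul]
    linear_combination redNorm z * h1
  have h3 := redNorm_add ((↑g⁻¹ : ℍ[K,a,b]) * x * (g : ℍ[K,a,b]))
    ((↑g⁻¹ : ℍ[K,a,b]) * y * (g : ℍ[K,a,b]))
  rw [← add_mul, ← mul_add, h2, h2, h2, redNorm_add] at h3
  linear_combination -h3

theorem redNorm_conj (g : (ℍ[K,a,b])ˣ) (x : ℍ[K,a,b]) :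
    redNorm ((↑g⁻¹ : ℍ[K,a,b]) * x * (g : ℍ[K,a,b])) = redNorm x := by
  have h1 : redNorm (g : ℍ[K,a,b]) * redNorm (↑g⁻¹ : ℍ[K,a,b]) = 1 := by
    rw [← redNorm_mul, Units.mul_inv, redNorm_one]
  rw [redNorm_mul, redNorm_mul]
  linear_combination redNorm x * h1

theorem redTrace_conj (g : (ℍ[K,a,b])ˣ) (x : ℍ[K,a,b]) :
    redTrace ((↑g⁻¹ : ℍ[K,a,b]) * x * (g : ℍ[K,a,b])) = redTrace x := by
  rw [redTrace_mul_comm, ← mul_assoc, Units.mul_inv, one_mul]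

variable [CharZero K]

theorem re_eq_zero {x : ℍ[K,a,b]} (hx : redTrace x = 0) : x.re = 0 := by
  rw [redTrace_eq] at hx
  simpa using hx

/-- The Gram determinant of three elements of trace zero is the square of their triple product. -/
theorem gram_det {x y z : ℍ[K,a,b]} (hx : redTrace x = 0) (hy : redTrace y = 0)
    (hz : redTrace z = 0) :
    redTrace (x * y * z) ^ 2 = 4 * redNorm x * redNorm y * redNorm z + bil x y * bil x z * bil y z -
      redNorm x * bil y z ^ 2 - redNorm y * bil x z ^ 2 - redNorm z * bil x y ^ 2 := by
  have h1 := re_eq_zero hx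
  have h2 := re_eq_zero hy
  have h3 := re_eq_zero hz
  simp only [redTrace_eq, redNorm_eq, bil_eq]
  simp [h1, h2, h3]
  ring

/-- The expansion of `z` in the basis `x, y, xy - yx` of the elements of trace zero. -/
theorem triple_expansion {x y z : ℍ[K,a,b]} (hx : redTrace x = 0) (hy : redTrace y = 0)
    (hz : redTrace z = 0) :
    (4 * redNorm x * redNorm y - bil x y ^ 2) • z =
      (2 * bil x z * redNorm y - bil y z * bil x y) • x +
      (2 * bil y z * redNorm x - bil x z * bil x y) • y -
      redTrace (x * y * z) • (x * y - y * x) := by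
  have h1 := re_eq_zero hx
  have h2 := re_eq_zero hy
  have h3 := re_eq_zero hz
  ext <;> simp [redTrace_eq, redNorm_eq, bil_eq, h1, h2, h3] <;>
    first | exact Or.inr (by ring) | ring

theorem eq_of_bil_eq {x y z w : ℍ[K,a,b]} (hx : redTrace x = 0) (hy : redTrace y = 0)
    (hz : redTrace z = 0) (hw : redTrace w = 0)
    (hne : 4 * redNorm x * redNorm y - bil x y ^ 2 ≠ 0)
    (h1 : bil x z = bil x w) (h2 : bil y z = bil y w)
    (h3 : redTrace (x * y * z) = redTrace (x * y * w)) : z = w := by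
  have e1 := triple_expansion hx hy hz
  have e2 := triple_expansion hx hy hw
  rw [h1, h2, h3, ← e2] at e1
  exact smul_right_injective _ hne e1

end Forms

section Ext

variable {a b : ℚ} {K : Type} [Field K]

variable [CharZero K]

theorem toExt_mul (x y : ℍ[ℚ,a,b]) : toExt K (x * y) = toExt K x * toExt K y := by
  ext <;> simp [toExt]

theorem toExt_add (x y : ℍ[ℚ,a,b]) : toExt K (x + y) = toExt K x + toExt K y := by
  ext <;> simp [toExt]

theorem toExt_sub (x y : ℍ[ℚ,a,b]) : toExt K (x - y) = toExt K x - toExt K y := by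
  ext <;> simp [toExt]

theorem toExt_smul (c : ℚ) (x : ℍ[ℚ,a,b]) : toExt K (c • x) = (c : K) • toExt K x := by
  ext <;> simp [toExt]

theorem redNorm_toExt (x : ℍ[ℚ,a,b]) : redNorm (toExt K x) = ((redNorm x : ℚ) : K) := by
  simp [redNorm_eq, toExt]

theorem redTrace_toExt (x : ℍ[ℚ,a,b]) : redTrace (toExt K x) = ((redTrace x : ℚ) : K) := by
  simp [redTrace_eq, toExt]

theorem bil_toExt (x y : ℍ[ℚ,a,b]) : bil (toExt K x) (toExt K y) = ((bil x y : ℚ) : K) := by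
  simp [bil_eq, toExt]

theorem toExt_injective : Function.Injective (toExt K : ℍ[ℚ,a,b] → _) := by
  intro x y h
  have h1 := congrArg QuaternionAlgebra.re h
  have h2 := congrArg QuaternionAlgebra.imI h
  have h3 := congrArg QuaternionAlgebra.imJ h
  have h4 := congrArg QuaternionAlgebra.imK h
  simp only [toExt, Rat.cast_inj] at h1 h2 h3 h4
  exact QuaternionAlgebra.ext h1 h2 h3 h4

end Ext

/-! ### Counting in a plane -/

theorem exists_intCast_eq_of_sq {q : ℚ} (h : ∃ k : ℤ, (k : ℚ) = q ^ 2) : ∃ k : ℤ, (k : ℚ) = q := by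
  obtain ⟨k, hk⟩ := h
  have : IsIntegral ℤ (q ^ 2) := hk ▸ isIntegral_algebraMap
  obtain ⟨y, hy⟩ := IsIntegrallyClosed.exists_algebraMap_eq_of_isIntegral_pow two_pos this
  exact ⟨y, by simpa using hy⟩

/-- Fix `x` of norm `n`. The elements `y` of norm `n` in the plane `tr (x ȳ) = m` are solutions of
a Pell type equation: if `y₀` is one of them, then with `p = tr (y₀ ȳ)` and `τ = tr (x y₀ y)`,
`(2 n p - m²)² + 4 n τ² = (4 n² - m²)²`, and `p` and `τ` determine `y`. -/
theorem exists_ncard_plane_le {ε : ℝ} (hε : 0 < ε) :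
    ∃ C : ℝ, 1 ≤ C ∧ ∀ (a b : ℚ) (S : Set ℍ[ℚ,a,b]) (x : ℍ[ℚ,a,b]) (n m : ℚ) (Q : ℕ) (W : ℝ),
      1 ≤ W → 0 < Q → (Q : ℝ) ≤ 16 * W → redTrace x = 0 → redNorm x = n →
      (∀ y ∈ S, redTrace y = 0 ∧ redNorm y = n ∧ bil x y = m) →
      (∃ k : ℤ, (k : ℚ) = Q * n) → (∃ k : ℤ, (k : ℚ) = Q * m) →
      (∀ y ∈ S, ∀ z ∈ S, ∃ k : ℤ, (k : ℚ) = Q * bil y z) →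
      |(n : ℝ)| ≤ W ^ 2 → |(m : ℝ)| ≤ 2 * W ^ 2 →
      (∀ y ∈ S, ∀ z ∈ S, |((bil y z : ℚ) : ℝ)| ≤ 2 * W ^ 2) →
      n ≠ 0 → 4 * n ^ 2 - m ^ 2 ≠ 0 →
      S.Finite ∧ (S.ncard : ℝ) ≤ C * W ^ ε := by
  obtain ⟨C, hC1, hC⟩ := exists_ncard_pellSet_le (ε := ε / 14) (by positivity)
  refine ⟨C * ((2 : ℝ) ^ 31) ^ (ε / 14), ?_, ?_⟩
  · have : (1 : ℝ) ≤ ((2 : ℝ) ^ 31) ^ (ε / 14) := Real.one_le_rpow (by norm_num) (by positivity)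
    nlinarith
  intro a b S x n m Q W hW hQ hQW hx hxn hS hn hm hint hnW hmW hbW hn0 hnm
  have hW0 : 0 < W := by linarith
  have hQ0 : (Q : ℚ) ≠ 0 := by exact_mod_cast hQ.ne'
  have hWe : (1 : ℝ) ≤ W ^ ε := Real.one_le_rpow hW hε.le
  rcases S.eq_empty_or_nonempty with rfl | ⟨y₀, hy₀⟩
  · simp only [Set.finite_empty, Set.ncard_empty, Nat.cast_zero, true_and]
    positivity
  obtain ⟨hy₀t, hy₀n, hy₀m⟩ := hS y₀ hy₀
  obtain ⟨n', hn'⟩ := hn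
  obtain ⟨m', hm'⟩ := hm
  -- the integers of the Pell equation
  set c : ℤ := Q * n' with hc
  set K : ℤ := Q ^ 2 * (4 * n' ^ 2 - m' ^ 2) ^ 2 with hK
  have hcq : (c : ℚ) = Q ^ 2 * n := by rw [hc]; push_cast; rw [hn']; ring
  have hKq : (K : ℚ) = Q ^ 6 * (4 * n ^ 2 - m ^ 2) ^ 2 := by
    rw [hK]; push_cast; rw [hn', hm']; ring
  have hc0 : c ≠ 0 := by
    have : (c : ℚ) ≠ 0 := by rw [hcq]; positivity
    exact_mod_cast this
  have hK0 : K ≠ 0 := by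
    have : (K : ℚ) ≠ 0 := by rw [hKq]; positivity
    exact_mod_cast this
  set r : ℍ[ℚ,a,b] → ℚ := fun y => Q ^ 3 * (2 * n * bil y₀ y - m ^ 2) with hr
  set s : ℍ[ℚ,a,b] → ℚ := fun y => 2 * Q ^ 2 * redTrace (x * y₀ * y) with hs
  have hgram : ∀ y ∈ S, redTrace (x * y₀ * y) ^ 2 =
      4 * n ^ 3 + m ^ 2 * bil y₀ y - n * bil y₀ y ^ 2 - 2 * n * m ^ 2 := by
    intro y hy
    obtain ⟨h1, h2, h3⟩ := hS y hy
    rw [gram_det hx hy₀t h1, hxn, hy₀n, h2, h3, hy₀m]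
    ring
  have hrs : ∀ y ∈ S, r y ^ 2 + c * s y ^ 2 = K := by
    intro y hy
    simp only [hr, hs]
    rw [hcq, hKq]
    linear_combination 4 * Q ^ 6 * n * hgram y hy
  have hrint : ∀ y ∈ S, ∃ k : ℤ, (k : ℚ) = r y := by
    intro y hy
    obtain ⟨p', hp'⟩ := hint y₀ hy₀ y hy
    refine ⟨Q * (2 * n' * p' - m' ^ 2), ?_⟩
    push_cast
    rw [hn', hm', hp']
    simp only [hr]
    ring
  have hsint : ∀ y ∈ S, ∃ k : ℤ, (k : ℚ) = s y := by
    intro y hy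
    obtain ⟨p', hp'⟩ := hint y₀ hy₀ y hy
    apply exists_intCast_eq_of_sq
    refine ⟨4 * Q * (4 * n' ^ 3 + m' ^ 2 * p' - n' * p' ^ 2 - 2 * n' * m' ^ 2), ?_⟩
    push_cast
    rw [hn', hm', hp']
    simp only [hs]
    linear_combination (-4) * Q ^ 4 * hgram y hy
  set X : ℝ := 2 ^ 31 * W ^ 14 with hX
  have hW7 : 1 ≤ W ^ 7 := one_le_pow₀ hW
  have hW714 : W ^ 7 ≤ W ^ 14 := pow_le_pow_right₀ hW (by norm_num)
  have hW414 : W ^ 4 ≤ W ^ 14 := pow_le_pow_right₀ hW (by norm_num)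
  have hX1 : 1 ≤ X := by rw [hX]; nlinarith
  have hQr : (0 : ℝ) ≤ Q := by positivity
  have hcX : |(c : ℝ)| ≤ X := by
    have : (c : ℝ) = Q ^ 2 * n := by exact_mod_cast congrArg (Rat.cast : ℚ → ℝ) hcq
    rw [this, abs_mul, abs_of_nonneg (by positivity)]
    calc (Q : ℝ) ^ 2 * |(n : ℝ)| ≤ (16 * W) ^ 2 * W ^ 2 := by gcongr
      _ = 256 * W ^ 4 := by ring
      _ ≤ X := by rw [hX]; nlinarith
  have hKabs : |(K : ℝ)| ≤ 2 ^ 30 * W ^ 14 := by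
    have : (K : ℝ) = Q ^ 6 * (4 * n ^ 2 - m ^ 2) ^ 2 := by
      exact_mod_cast congrArg (Rat.cast : ℚ → ℝ) hKq
    rw [this, abs_mul, abs_of_nonneg (by positivity), abs_pow]
    have h1 : |4 * (n : ℝ) ^ 2 - (m : ℝ) ^ 2| ≤ 8 * W ^ 4 := by
      calc |4 * (n : ℝ) ^ 2 - (m : ℝ) ^ 2| ≤ |4 * (n : ℝ) ^ 2| + |(m : ℝ) ^ 2| := abs_sub _ _
        _ = 4 * |(n : ℝ)| ^ 2 + |(m : ℝ)| ^ 2 := by simp [abs_mul]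
        _ ≤ 4 * (W ^ 2) ^ 2 + (2 * W ^ 2) ^ 2 := by gcongr
        _ = _ := by ring
    calc (Q : ℝ) ^ 6 * |4 * (n : ℝ) ^ 2 - (m : ℝ) ^ 2| ^ 2
        ≤ (16 * W) ^ 6 * (8 * W ^ 4) ^ 2 := by gcongr
      _ = _ := by ring
  have hKX : |(K : ℝ)| ≤ X := hKabs.trans (by rw [hX]; gcongr <;> norm_num)
  have hrabs : ∀ y ∈ S, |(r y : ℝ)| ≤ 2 ^ 15 * W ^ 7 := by
    intro y hy
    have : (r y : ℝ) = Q ^ 3 * (2 * n * (bil y₀ y : ℚ) - m ^ 2) := by simp only [hr]; push_cast; rfl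
    rw [this, abs_mul, abs_of_nonneg (by positivity)]
    have h1 : |2 * (n : ℝ) * ((bil y₀ y : ℚ) : ℝ) - (m : ℝ) ^ 2| ≤ 8 * W ^ 4 := by
      calc _ ≤ |2 * (n : ℝ) * ((bil y₀ y : ℚ) : ℝ)| + |(m : ℝ) ^ 2| := abs_sub _ _
        _ = 2 * |(n : ℝ)| * |((bil y₀ y : ℚ) : ℝ)| + |(m : ℝ)| ^ 2 := by simp [abs_mul]
        _ ≤ 2 * W ^ 2 * (2 * W ^ 2) + (2 * W ^ 2) ^ 2 := by
            have := hbW y₀ hy₀ y hy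
            gcongr
        _ = _ := by ring
    calc (Q : ℝ) ^ 3 * _ ≤ (16 * W) ^ 3 * (8 * W ^ 4) := by gcongr
      _ = _ := by ring
  have hsabs : ∀ y ∈ S, |(s y : ℝ)| ≤ 2 ^ 16 * W ^ 7 := by
    intro y hy
    have h1 : (r y : ℝ) ^ 2 + c * (s y : ℝ) ^ 2 = K := by exact_mod_cast hrs y hy
    have h2 : |(c : ℝ)| * (s y : ℝ) ^ 2 ≤ 2 ^ 31 * W ^ 14 := by
      have h3 : |(c : ℝ)| * (s y : ℝ) ^ 2 = |(K : ℝ) - (r y : ℝ) ^ 2| := by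
        rw [← h1, add_sub_cancel_left, abs_mul, abs_of_nonneg (sq_nonneg (s y : ℝ))]
      rw [h3]
      calc _ ≤ |(K : ℝ)| + |(r y : ℝ) ^ 2| := abs_sub _ _
        _ ≤ 2 ^ 30 * W ^ 14 + (2 ^ 15 * W ^ 7) ^ 2 := by
            rw [abs_pow]
            have := hrabs y hy
            gcongr
        _ = _ := by ring
    have h4 : (1 : ℝ) ≤ |(c : ℝ)| := by exact_mod_cast Int.one_le_abs hc0
    have h5 : (s y : ℝ) ^ 2 ≤ 2 ^ 31 * W ^ 14 := by nlinarith [sq_nonneg (s y : ℝ)]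
    refine abs_le_of_sq_le_sq (h5.trans ?_) (by positivity)
    calc (2 : ℝ) ^ 31 * W ^ 14 ≤ 2 ^ 32 * W ^ 14 := by gcongr <;> norm_num
      _ = _ := by ring
  obtain ⟨hfin, hcard⟩ := hC X c K hX1 hc0 hK0 hcX hKX
  have hfl : ∀ q : ℚ, (∃ k : ℤ, (k : ℚ) = q) → ((⌊q⌋ : ℤ) : ℚ) = q := by
    rintro q ⟨k, rfl⟩
    simp
  have hmaps : Set.MapsTo (fun y => (⌊r y⌋, ⌊s y⌋)) S (pellSet c K X) := by
    intro y hy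
    have e1 := hfl _ (hrint y hy)
    have e2 := hfl _ (hsint y hy)
    have e1' : ((⌊r y⌋ : ℤ) : ℝ) = r y := by exact_mod_cast congrArg (Rat.cast : ℚ → ℝ) e1
    have e2' : ((⌊s y⌋ : ℤ) : ℝ) = s y := by exact_mod_cast congrArg (Rat.cast : ℚ → ℝ) e2
    refine ⟨?_, ?_, ?_⟩
    · have : ((⌊r y⌋ : ℤ) : ℚ) ^ 2 + c * ((⌊s y⌋ : ℤ) : ℚ) ^ 2 = K := by
        rw [e1, e2, hrs y hy]
      exact_mod_cast this
    · simp only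
      rw [e1', hX]
      refine (hrabs y hy).trans ?_
      gcongr <;> norm_num
    · simp only
      rw [e2', hX]
      refine (hsabs y hy).trans ?_
      gcongr <;> norm_num
  have hinj : Set.InjOn (fun y => (⌊r y⌋, ⌊s y⌋)) S := by
    intro y hy z hz hyz
    obtain ⟨e1, e2⟩ := Prod.mk.inj hyz
    have f1 : r y = r z := by rw [← hfl _ (hrint y hy), ← hfl _ (hrint z hz), e1]
    have f2 : s y = s z := by rw [← hfl _ (hsint y hy), ← hfl _ (hsint z hz), e2]
    obtain ⟨h1, h2, h3⟩ := hS y hy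
    obtain ⟨g1, g2, g3⟩ := hS z hz
    refine eq_of_bil_eq hx hy₀t h1 g1 ?_ (h3.trans g3.symm) ?_ ?_
    · rw [hxn, hy₀n, hy₀m]
      convert hnm using 1
      ring
    · have e3 : (Q : ℚ) ^ 3 ≠ 0 := by positivity
      have := mul_left_cancel₀ e3 f1
      have e4 : (2 * n) ≠ 0 := by positivity
      exact mul_left_cancel₀ e4 (by linarith)
    · have e3 : 2 * (Q : ℚ) ^ 2 ≠ 0 := by positivity
      exact mul_left_cancel₀ e3 f2
  refine ⟨Set.Finite.of_injOn hmaps hinj hfin, ?_⟩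
  have h1 : (S.ncard : ℝ) ≤ (pellSet c K X).ncard := by
    exact_mod_cast Set.ncard_le_ncard_of_injOn _ hmaps hinj hfin
  refine h1.trans (hcard.trans (le_of_eq ?_))
  rw [hX, Real.mul_rpow (by positivity) (by positivity), ← mul_assoc]
  congr 1
  rw [← Real.rpow_natCast W 14, ← Real.rpow_mul hW0.le]
  congr 1
  push_cast
  ring

/-! ### Local division algebras -/

section Ramified

variable {a b : ℚ} {p : ℕ} [Fact p.Prime]

theorem RamifiedAt.mul_eq_zero (h : RamifiedAt a b p) {x y : QuatExt a b ℚ_[p]}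
    (hxy : x * y = 0) : x = 0 ∨ y = 0 := by
  by_contra hcon
  push Not at hcon
  obtain ⟨u, rfl⟩ := h x hcon.1
  exact hcon.2 ((Units.mul_right_eq_zero u).1 hxy)

/-- An element of a division algebra that satisfies `u² - (s + t) u + s t = 0` is a scalar. -/
theorem RamifiedAt.eq_smul_one (h : RamifiedAt a b p) {u : QuatExt a b ℚ_[p]} {s t : ℚ_[p]}
    (h1 : redTrace u = s + t) (h2 : redNorm u = s * t) : u = s • 1 ∨ u = t • 1 := by
  have h3 : (u - s • 1) * (u - t • 1) = 0 := by
    have := mul_self_eq u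
    rw [h1, h2] at this
    have e : (u - s • 1) * (u - t • 1) = u * u - (s + t) • u + (s * t) • 1 := by
      simp only [sub_mul, mul_sub, smul_mul_assoc, mul_smul_comm, one_mul, mul_one]
      module
    rw [e, this]
    abel
  rcases h.mul_eq_zero h3 with h4 | h4
  · exact Or.inl (sub_eq_zero.1 h4)
  · exact Or.inr (sub_eq_zero.1 h4)

/-- In a division algebra over `ℚ_p`, an element of integral norm has integral trace: otherwise
its characteristic polynomial splits, by Hensel's lemma. -/
theorem RamifiedAt.norm_redTrace_le_one (h : RamifiedAt a b p) {u : QuatExt a b ℚ_[p]}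
    (hu : ‖redNorm u‖ ≤ 1) : ‖redTrace u‖ ≤ 1 := by
  by_contra hcon
  rw [not_le] at hcon
  set t := redTrace u with ht
  have ht0 : t ≠ 0 := by rintro h0; rw [h0, norm_zero] at hcon; linarith
  have hc : ‖redNorm u / t ^ 2‖ < 1 := by
    rw [norm_div, norm_pow, div_lt_one (by positivity)]
    calc _ ≤ (1 : ℝ) := hu
      _ < _ := one_lt_pow₀ hcon two_ne_zero
  obtain ⟨c, hcdef⟩ : ∃ c : ℤ_[p], (c : ℚ_[p]) = redNorm u / t ^ 2 := ⟨⟨_, hc.le⟩, rfl⟩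
  rw [← hcdef, ← PadicInt.norm_def] at hc
  have hH := hensels_lemma (p := p) (R := ℤ_[p]) (a := 0)
    (F := Polynomial.X ^ 2 - Polynomial.X + Polynomial.C c) (by
      simp only [Polynomial.coe_aeval_eq_eval, Polynomial.eval_add, Polynomial.eval_sub,
        Polynomial.eval_pow, Polynomial.eval_X, Polynomial.eval_C, Polynomial.derivative_add,
        Polynomial.derivative_sub, Polynomial.derivative_X_pow, Polynomial.derivative_X,
        Polynomial.derivative_C]
      simpa using hc)
  obtain ⟨z, hz, -⟩ := hH
  have hz' : (z : ℚ_[p]) ^ 2 - z + redNorm u / t ^ 2 = 0 := by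
    have := congrArg (Subtype.val : ℤ_[p] → ℚ_[p]) hz
    rw [← hcdef]
    simpa [Polynomial.coe_aeval_eq_eval] using this
  have hn : redNorm u = (t * z) * (t * (1 - z)) := by
    have : redNorm u = t ^ 2 * (z - z ^ 2) := by
      field_simp at hz'
      linear_combination hz'
    rw [this]; ring
  have hscal : ∀ v : ℚ_[p], u = v • 1 → False := by
    intro v hv
    have h1 : redNorm u = v ^ 2 := by rw [hv, redNorm_smul, redNorm_one, mul_one]
    have h2 : t = 2 * v := by rw [ht, hv, redTrace_eq]; simp
    rw [h1, norm_pow] at hu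
    have hv1 : ‖v‖ ≤ 1 := by
      by_contra h'
      have := one_lt_pow₀ (not_le.1 h') two_ne_zero
      linarith
    rw [h2, norm_mul] at hcon
    have h3 : ‖(2 : ℚ_[p])‖ ≤ 1 := by exact_mod_cast Padic.norm_int_le_one (p := p) 2
    nlinarith [norm_nonneg v, norm_nonneg (2 : ℚ_[p])]
  rcases h.eq_smul_one (s := t * z) (t := t * (1 - z)) (by rw [← ht]; ring) hn with h4 | h4
  · exact hscal _ h4
  · exact hscal _ h4

theorem RamifiedAt.norm_bil_le_one (h : RamifiedAt a b p) {u v : QuatExt a b ℚ_[p]}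
    (hu : ‖redNorm u‖ ≤ 1) (hv : ‖redNorm v‖ ≤ 1) : ‖bil u v‖ ≤ 1 := by
  apply h.norm_redTrace_le_one
  rw [redNorm_mul, redNorm_star, norm_mul]
  exact mul_le_one₀ hu (norm_nonneg _) hv

theorem RamifiedAt.norm_redNorm_add_le_one (h : RamifiedAt a b p) {u v : QuatExt a b ℚ_[p]}
    (hu : ‖redNorm u‖ ≤ 1) (hv : ‖redNorm v‖ ≤ 1) : ‖redNorm (u + v)‖ ≤ 1 := by
  rw [redNorm_add]
  refine (Padic.nonarchimedean _ _).trans (max_le ((Padic.nonarchimedean _ _).trans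
    (max_le hu hv)) (h.norm_bil_le_one hu hv))

/-- A binary form `-(n α² + m α β + n β²)` over `𝔽_p`, `p` odd, of discriminant
`m² - 4 n² ≠ 0`, represents `1`. -/
theorem exists_binary_eq_one (hp : p ≠ 2) {n m : ZMod p} (h : m ^ 2 - 4 * n ^ 2 ≠ 0) :
    ∃ α β : ZMod p, -(n * α ^ 2 + m * α * β + n * β ^ 2) = 1 := by
  have hpp : p.Prime := Fact.out
  have h2 : (2 : ZMod p) ≠ 0 := by
    intro h0
    have : ((2 : ℕ) : ZMod p) = 0 := by exact_mod_cast h0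
    rw [ZMod.natCast_eq_zero_iff] at this
    exact hp ((Nat.prime_dvd_prime_iff_eq hpp Nat.prime_two).1 this)
  rcases eq_or_ne n 0 with rfl | hn
  · have hm : m ≠ 0 := by rintro rfl; simp at h
    refine ⟨-m⁻¹, 1, ?_⟩
    field_simp
    ring
  · have hk : n - m ^ 2 / (4 * n) ≠ 0 := by
      intro h0
      apply h
      have h4 : (4 : ZMod p) ≠ 0 := by
        rw [show (4 : ZMod p) = 2 * 2 by norm_num]; exact mul_ne_zero h2 h2
      field_simp at h0
      linear_combination -h0
    set k := n - m ^ 2 / (4 * n) with hkdef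
    obtain ⟨x, y, hxy⟩ := FiniteField.exists_root_sum_quadratic (R := ZMod p)
      (f := Polynomial.C (-n) * Polynomial.X ^ 2 + Polynomial.C 0 * Polynomial.X +
        Polynomial.C (-1))
      (g := Polynomial.C (-k) * Polynomial.X ^ 2 + Polynomial.C 0 * Polynomial.X +
        Polynomial.C 0)
      (Polynomial.degree_quadratic (neg_ne_zero.2 hn))
      (Polynomial.degree_quadratic (neg_ne_zero.2 hk))
      (by rw [ZMod.card]; exact Nat.odd_iff.1 (hpp.odd_of_ne_two hp))
    refine ⟨x - m * y / (2 * n), y, ?_⟩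
    simp at hxy
    have h4 : (4 : ZMod p) ≠ 0 := by
      rw [show (4 : ZMod p) = 2 * 2 by norm_num]; exact mul_ne_zero h2 h2
    have e : -(n * (x - m * y / (2 * n)) ^ 2 + m * (x - m * y / (2 * n)) * y + n * y ^ 2) =
        -(n * x ^ 2) - k * y ^ 2 := by
      rw [hkdef]
      field_simp
      ring
    rw [e]
    linear_combination hxy

theorem exists_sq_eq_of_toZMod_eq_one (hp : p ≠ 2) {w : ℤ_[p]} (hw : PadicInt.toZMod w = 1) :
    ∃ z : ℤ_[p], z ^ 2 = w := by
  have hpp : p.Prime := Fact.out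
  have h2 : ‖(2 : ℤ_[p])‖ = 1 := by
    rw [← PadicInt.isUnit_iff]
    have : IsUnit ((2 : ℕ) : ℤ_[p]) := by
      rw [PadicInt.isUnit_iff, PadicInt.norm_natCast_eq_one_iff]
      exact (Nat.coprime_primes hpp Nat.prime_two).2 hp
    exact_mod_cast this
  have h1 : ‖1 - w‖ < 1 := by
    rw [← PadicInt.mem_nonunits, ← IsLocalRing.mem_maximalIdeal, ← PadicInt.ker_toZMod,
      RingHom.mem_ker, map_sub, hw, map_one, sub_self]
  have hH := hensels_lemma (p := p) (R := ℤ_[p]) (a := 1)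
    (F := Polynomial.X ^ 2 - Polynomial.C w) (by
      simp only [Polynomial.coe_aeval_eq_eval, Polynomial.eval_sub,
        Polynomial.eval_pow, Polynomial.eval_X, Polynomial.eval_C,
        Polynomial.derivative_sub, Polynomial.derivative_X_pow,
        Polynomial.derivative_C]
      simpa [h2] using h1)
  obtain ⟨z, hz, -⟩ := hH
  refine ⟨z, ?_⟩
  simp [Polynomial.coe_aeval_eq_eval] at hz
  linear_combination hz

/-- The residue algebra of the maximal order of a local division algebra is commutative: two
integral elements of trace zero and norm `n` satisfy `tr (x ȳ)² ≡ 4 n²` modulo `p`. Otherwise the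
lattice they span would contain an element whose square is a unit square. -/
theorem RamifiedAt.norm_bil_sq_sub_lt_one (h : RamifiedAt a b p) (hp : p ≠ 2)
    {x y : QuatExt a b ℚ_[p]} {n : ℚ_[p]} (hx : redTrace x = 0) (hy : redTrace y = 0)
    (hxn : redNorm x = n) (hyn : redNorm y = n) (hn : ‖n‖ ≤ 1) (hm : ‖bil x y‖ ≤ 1) :
    ‖bil x y ^ 2 - 4 * n ^ 2‖ < 1 := by
  obtain ⟨n', hn'⟩ : ∃ n' : ℤ_[p], (n' : ℚ_[p]) = n := ⟨⟨n, hn⟩, rfl⟩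
  obtain ⟨m', hm'⟩ : ∃ m' : ℤ_[p], (m' : ℚ_[p]) = bil x y := ⟨⟨_, hm⟩, rfl⟩
  have hgoal : ‖bil x y ^ 2 - 4 * n ^ 2‖ = ‖m' ^ 2 - 4 * n' ^ 2‖ := by
    rw [PadicInt.norm_def, ← hn', ← hm']
    push_cast
    rfl
  rw [hgoal, ← PadicInt.mem_nonunits, ← IsLocalRing.mem_maximalIdeal, ← PadicInt.ker_toZMod,
    RingHom.mem_ker]
  by_contra hcon
  obtain ⟨α, β, hαβ⟩ := exists_binary_eq_one hp (n := PadicInt.toZMod n')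
    (m := PadicInt.toZMod m') (by
      rwa [map_sub, map_mul, map_pow, map_pow, map_ofNat] at hcon)
  obtain ⟨α, rfl⟩ := ZMod.ringHom_surjective (PadicInt.toZMod (p := p)) α
  obtain ⟨β, rfl⟩ := ZMod.ringHom_surjective (PadicInt.toZMod (p := p)) β
  set w : ℤ_[p] := -(n' * α ^ 2 + m' * α * β + n' * β ^ 2) with hw
  have hw1 : PadicInt.toZMod w = 1 := by rw [← hαβ, hw]; simp
  obtain ⟨s, hs⟩ := exists_sq_eq_of_toZMod_eq_one hp hw1
  set u : QuatExt a b ℚ_[p] := (α : ℚ_[p]) • x + (β : ℚ_[p]) • y with hu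
  have hut : redTrace u = 0 := by
    rw [hu, redTrace_add, redTrace_smul, redTrace_smul, hx, hy]; ring
  have hun : redNorm u = (s : ℚ_[p]) * (-s) := by
    have h1 : redNorm u = α ^ 2 * n + β ^ 2 * n + α * β * bil x y := by
      rw [hu, redNorm_add, redNorm_smul, redNorm_smul, hxn, hyn, bil_smul_left, bil_smul_right]
      ring
    have h2 : (s : ℚ_[p]) ^ 2 = -(n * α ^ 2 + bil x y * α * β + n * β ^ 2) := by
      have := congrArg (Subtype.val : ℤ_[p] → ℚ_[p]) hs
      rw [← hn', ← hm']
      simpa [hw] using this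
    rw [h1]
    linear_combination h2
  have hs0 : (s : ℚ_[p]) ≠ 0 := by
    intro h0
    have : s = 0 := PadicInt.ext h0
    rw [this] at hs
    rw [← hs] at hw1
    simp at hw1
  have key : ∀ v : ℚ_[p], v ≠ 0 → u = v • 1 → False := by
    intro v hv h1
    rw [h1, redTrace_smul, redTrace_eq] at hut
    simp at hut
    exact hv hut
  rcases h.eq_smul_one (s := (s : ℚ_[p])) (t := -s) (by rw [hut]; ring) hun with h4 | h4
  · exact key _ hs0 h4
  · exact key _ (neg_ne_zero.2 hs0) h4

end Ramified

/-! ### Orders -/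

theorem exists_intCast_of_padic {q : ℚ} (h : ∀ p : Nat.Primes, ‖(q : ℚ_[p])‖ ≤ 1) :
    ∃ k : ℤ, (k : ℚ) = q := by
  refine ⟨q.num, (Rat.den_eq_one_iff q).1 ?_⟩
  by_contra hne
  obtain ⟨p, hp, hpd⟩ := Nat.exists_prime_and_dvd hne
  have h0 := h ⟨p, hp⟩
  have : Fact p.Prime := ⟨hp⟩
  have h1 : ‖(q : ℚ_[p])‖ ≤ 1 := h0
  have hden : ‖((q.den : ℕ) : ℚ_[p])‖ < 1 := (Padic.norm_natCast_lt_one_iff).2 hpd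
  have hnum : ‖((q.num : ℤ) : ℚ_[p])‖ < 1 := by
    have e : ((q.num : ℤ) : ℚ_[p]) = (q : ℚ_[p]) * (q.den : ℕ) := by
      have := Rat.mul_den_eq_num q
      exact_mod_cast congrArg (Rat.cast : ℚ → ℚ_[p]) this.symm
    rw [e, norm_mul]
    exact mul_lt_one_of_nonneg_of_lt_one_right h1 (norm_nonneg _) hden
  have h2 : (p : ℤ) ∣ q.num := (Padic.norm_intCast_lt_one_iff).1 hnum
  have h3 : p ∣ q.num.natAbs := Int.natCast_dvd.1 h2
  exact hp.one_lt.ne' (Nat.eq_one_of_dvd_coprimes q.reduced h3 hpd)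

theorem norm_intCast_rat_le_one {p : ℕ} [Fact p.Prime] {q : ℚ} (h : ∃ k : ℤ, (k : ℚ) = q) :
    ‖(q : ℚ_[p])‖ ≤ 1 := by
  obtain ⟨k, rfl⟩ := h
  exact_mod_cast Padic.norm_int_le_one (p := p) k

/-- Elements whose four coordinates have denominators dividing `E`. -/
def HasDenom {a b : ℚ} (E : ℕ) (x : ℍ[ℚ,a,b]) : Prop :=
  (∃ k : ℤ, (k : ℚ) = E * x.re) ∧ (∃ k : ℤ, (k : ℚ) = E * x.imI) ∧
    (∃ k : ℤ, (k : ℚ) = E * x.imJ) ∧ (∃ k : ℤ, (k : ℚ) = E * x.imK)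

section

variable {a b : ℚ}

theorem exists_den_mul (q : ℚ) (E : ℕ) (h : q.den ∣ E) : ∃ k : ℤ, (k : ℚ) = E * q := by
  obtain ⟨c, rfl⟩ := h
  refine ⟨c * q.num, ?_⟩
  push_cast
  rw [← Rat.mul_den_eq_num q]
  ring

theorem HasDenom.add {E : ℕ} {x y : ℍ[ℚ,a,b]} (hx : HasDenom E x) (hy : HasDenom E y) :
    HasDenom E (x + y) := by
  obtain ⟨⟨k₁, h₁⟩, ⟨k₂, h₂⟩, ⟨k₃, h₃⟩, ⟨k₄, h₄⟩⟩ := hx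
  obtain ⟨⟨l₁, g₁⟩, ⟨l₂, g₂⟩, ⟨l₃, g₃⟩, ⟨l₄, g₄⟩⟩ := hy
  refine ⟨⟨k₁ + l₁, ?_⟩, ⟨k₂ + l₂, ?_⟩, ⟨k₃ + l₃, ?_⟩, ⟨k₄ + l₄, ?_⟩⟩ <;> push_cast <;> simp
  · rw [h₁, g₁]; ring
  · rw [h₂, g₂]; ring
  · rw [h₃, g₃]; ring
  · rw [h₄, g₄]; ring

theorem HasDenom.neg {E : ℕ} {x : ℍ[ℚ,a,b]} (hx : HasDenom E x) : HasDenom E (-x) := by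
  obtain ⟨⟨k₁, h₁⟩, ⟨k₂, h₂⟩, ⟨k₃, h₃⟩, ⟨k₄, h₄⟩⟩ := hx
  refine ⟨⟨-k₁, ?_⟩, ⟨-k₂, ?_⟩, ⟨-k₃, ?_⟩, ⟨-k₄, ?_⟩⟩ <;> push_cast <;> simp [*]

theorem hasDenom_zero (E : ℕ) : HasDenom E (0 : ℍ[ℚ,a,b]) := by
  refine ⟨⟨0, ?_⟩, ⟨0, ?_⟩, ⟨0, ?_⟩, ⟨0, ?_⟩⟩ <;> simp

theorem exists_hasDenom_of_fg {L : AddSubgroup ℍ[ℚ,a,b]} (h : L.FG) :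
    ∃ E : ℕ, E ≠ 0 ∧ ∀ x ∈ L, HasDenom E x := by
  obtain ⟨S, rfl⟩ := h
  refine ⟨∏ s ∈ S, (s.re.den * s.imI.den * s.imJ.den * s.imK.den), ?_, ?_⟩
  · rw [Finset.prod_ne_zero_iff]
    intro s _
    exact mul_ne_zero (mul_ne_zero (mul_ne_zero (Rat.den_ne_zero _) (Rat.den_ne_zero _))
      (Rat.den_ne_zero _)) (Rat.den_ne_zero _)
  · intro x hx
    induction hx using AddSubgroup.closure_induction with
    | mem x hx =>
      have hd := Finset.dvd_prod_of_mem
        (fun s : ℍ[ℚ,a,b] => s.re.den * s.imI.den * s.imJ.den * s.imK.den) hx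
      have h1 : x.re.den * x.imI.den * x.imJ.den * x.imK.den ∣
        ∏ s ∈ S, (s.re.den * s.imI.den * s.imJ.den * s.imK.den) := hd
      refine ⟨exists_den_mul _ _ (dvd_trans ?_ h1), exists_den_mul _ _ (dvd_trans ?_ h1),
        exists_den_mul _ _ (dvd_trans ?_ h1), exists_den_mul _ _ (dvd_trans ?_ h1)⟩
      · exact Dvd.intro (x.imI.den * x.imJ.den * x.imK.den) (by ring)
      · exact Dvd.intro (x.re.den * x.imJ.den * x.imK.den) (by ring)
      · exact Dvd.intro (x.re.den * x.imI.den * x.imK.den) (by ring)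
      · exact Dvd.intro_left _ rfl
    | zero => exact hasDenom_zero _
    | add x y _ _ hx hy => exact hx.add hy
    | neg x _ hx => exact hx.neg

/-- A subgroup of bounded denominators is finitely generated. -/
theorem fg_of_hasDenom {L : AddSubgroup ℍ[ℚ,a,b]} {E : ℕ} (hE : E ≠ 0)
    (h : ∀ x ∈ L, HasDenom E x) : L.FG := by
  set G : Set ℍ[ℚ,a,b] := {⟨1 / E, 0, 0, 0⟩, ⟨0, 1 / E, 0, 0⟩, ⟨0, 0, 1 / E, 0⟩, ⟨0, 0, 0, 1 / E⟩}
    with hG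
  have hE' : (E : ℚ) ≠ 0 := by exact_mod_cast hE
  have hnoeth : IsNoetherian ℤ (Submodule.span ℤ G) :=
    isNoetherian_span_of_finite ℤ (by rw [hG]; exact Set.toFinite _)
  have hle : AddSubgroup.toIntSubmodule L ≤ Submodule.span ℤ G := by
    intro x hx
    obtain ⟨⟨k₁, h₁⟩, ⟨k₂, h₂⟩, ⟨k₃, h₃⟩, ⟨k₄, h₄⟩⟩ := h x hx
    have : x = k₁ • (⟨1 / E, 0, 0, 0⟩ : ℍ[ℚ,a,b]) + k₂ • (⟨0, 1 / E, 0, 0⟩ : ℍ[ℚ,a,b]) +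
        k₃ • (⟨0, 0, 1 / E, 0⟩ : ℍ[ℚ,a,b]) + k₄ • (⟨0, 0, 0, 1 / E⟩ : ℍ[ℚ,a,b]) := by
      ext <;> simp [h₁, h₂, h₃, h₄] <;> field_simp
    rw [this]
    refine Submodule.add_mem _ (Submodule.add_mem _ (Submodule.add_mem _ ?_ ?_) ?_) ?_ <;>
      exact Submodule.smul_mem _ _ (Submodule.subset_span (by simp [hG]))
  have := isNoetherian_submodule.1 hnoeth _ hle
  rwa [Submodule.fg_iff_addSubgroup_fg, AddSubgroup.toIntSubmodule_toAddSubgroup] at this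

/-- A rational number whose powers have bounded denominators is an integer. -/
theorem exists_intCast_of_pow {q : ℚ} {F : ℕ} (hF : F ≠ 0)
    (h : ∀ k : ℕ, ∃ z : ℤ, (z : ℚ) = F * q ^ k) : ∃ z : ℤ, (z : ℚ) = q := by
  refine ⟨q.num, (Rat.den_eq_one_iff q).1 ?_⟩
  by_contra hne
  have h1 : 1 < q.den := by have := Rat.den_ne_zero q; omega
  obtain ⟨z, hz⟩ := h F
  have h2 : (q.den : ℚ) ^ F ≠ 0 := by positivity
  have h3 : (z * q.den ^ F : ℤ) = F * q.num ^ F := by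
    have : (z : ℚ) * (q.den : ℚ) ^ F = F * (q.num : ℚ) ^ F := by
      rw [hz, ← Rat.mul_den_eq_num q]; ring
    exact_mod_cast this
  have h4 : (q.den : ℤ) ^ F ∣ F * q.num ^ F := h3 ▸ Dvd.intro_left _ rfl
  have h5 : IsCoprime ((q.den : ℤ) ^ F) (q.num ^ F) := by
    apply IsCoprime.pow
    rw [Int.isCoprime_iff_gcd_eq_one, Int.gcd_comm]
    exact q.reduced
  have h6 : q.den ^ F ∣ F := by exact_mod_cast h5.dvd_of_dvd_mul_right h4
  have h7 := Nat.le_of_dvd (Nat.pos_of_ne_zero hF) h6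
  have h8 : F < q.den ^ F := Nat.lt_pow_self h1
  omega

theorem redNorm_int_of_isZOrder {O : Subring ℍ[ℚ,a,b]} (hO : IsZOrder O) {x : ℍ[ℚ,a,b]}
    (hx : x ∈ O) : ∃ k : ℤ, (k : ℚ) = redNorm x := by
  obtain ⟨E, hE, h⟩ := exists_hasDenom_of_fg hO.1
  have hp : ∀ k : ℕ, redNorm (x ^ k) = redNorm x ^ k := by
    intro k
    induction k with
    | zero => simp [redNorm_one]
    | succ k ih => rw [pow_succ, redNorm_mul, ih, pow_succ]
  apply exists_intCast_of_pow (F := E ^ 2 * (a.den * b.den)) (by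
    have := Rat.den_ne_zero a
    have := Rat.den_ne_zero b
    positivity)
  intro k
  obtain ⟨⟨k₁, h₁⟩, ⟨k₂, h₂⟩, ⟨k₃, h₃⟩, ⟨k₄, h₄⟩⟩ := h (x ^ k) (O.pow_mem hx k)
  refine ⟨a.den * b.den * k₁ ^ 2 - b.den * a.num * k₂ ^ 2 - a.den * b.num * k₃ ^ 2 +
    a.num * b.num * k₄ ^ 2, ?_⟩
  rw [← hp, redNorm_eq]
  push_cast
  rw [h₁, h₂, h₃, h₄, ← Rat.mul_den_eq_num a, ← Rat.mul_den_eq_num b]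
  ring

theorem redTrace_int_of_isZOrder {O : Subring ℍ[ℚ,a,b]} (hO : IsZOrder O) {x : ℍ[ℚ,a,b]}
    (hx : x ∈ O) : ∃ k : ℤ, (k : ℚ) = redTrace x := by
  obtain ⟨k, hk⟩ := redNorm_int_of_isZOrder hO hx
  obtain ⟨l, hl⟩ := redNorm_int_of_isZOrder hO (O.add_mem hx O.one_mem)
  refine ⟨l - k - 1, ?_⟩
  push_cast
  rw [hl, hk, redNorm_add, redNorm_one]
  have : bil x 1 = redTrace x := by simp [bil]
  rw [this]
  ring

theorem bil_int_of_isZOrder {O : Subring ℍ[ℚ,a,b]} (hO : IsZOrder O) {x y : ℍ[ℚ,a,b]}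
    (hx : x ∈ O) (hy : y ∈ O) : ∃ k : ℤ, (k : ℚ) = bil x y := by
  obtain ⟨k, hk⟩ := redNorm_int_of_isZOrder hO hx
  obtain ⟨l, hl⟩ := redNorm_int_of_isZOrder hO hy
  obtain ⟨m, hm⟩ := redNorm_int_of_isZOrder hO (O.add_mem hx hy)
  refine ⟨m - k - l, ?_⟩
  push_cast
  rw [hk, hl, hm, redNorm_add]
  ring

theorem exists_nsmul_mem {O : Subring ℍ[ℚ,a,b]} (hO : IsZOrder O) (x : ℍ[ℚ,a,b]) :
    ∃ E : ℕ, E ≠ 0 ∧ (E : ℚ) • x ∈ O := by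
  have hx : x ∈ Submodule.span ℚ (O : Set ℍ[ℚ,a,b]) := by rw [hO.2]; trivial
  induction hx using Submodule.span_induction with
  | mem x hx => exact ⟨1, one_ne_zero, by simpa using hx⟩
  | zero => exact ⟨1, one_ne_zero, by simp [O.zero_mem]⟩
  | add x y _ _ hx hy =>
    obtain ⟨E, hE, hx⟩ := hx
    obtain ⟨F, hF, hy⟩ := hy
    refine ⟨E * F, mul_ne_zero hE hF, ?_⟩
    have e : ((E * F : ℕ) : ℚ) • (x + y) = F • ((E : ℚ) • x) + E • ((F : ℚ) • y) := by
      push_cast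
      module
    rw [e]
    exact O.add_mem (O.nsmul_mem hx _) (O.nsmul_mem hy _)
  | smul q x _ hx =>
    obtain ⟨E, hE, hx⟩ := hx
    refine ⟨q.den * E, mul_ne_zero (Rat.den_ne_zero q) hE, ?_⟩
    have e : ((q.den * E : ℕ) : ℚ) • (q • x) = q.num • ((E : ℚ) • x) := by
      rw [← Int.cast_smul_eq_zsmul ℚ, smul_smul, smul_smul, ← Rat.mul_den_eq_num q]
      congr 1
      push_cast
      ring
    rw [e]
    exact O.zsmul_mem hx _

/-- At a ramified prime, the elements of integral norm that are `p`-power fractions of elements of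
an order `O` form a ring: the valuation ring of the local division algebra. -/
def ramifiedEnlargement {p : ℕ} [Fact p.Prime] (h : RamifiedAt a b p) (O : Subring ℍ[ℚ,a,b]) :
    Subring ℍ[ℚ,a,b] where
  carrier := {w | ‖((redNorm w : ℚ) : ℚ_[p])‖ ≤ 1 ∧ ∃ j : ℕ, ((p : ℚ) ^ j) • w ∈ O}
  mul_mem' := by
    rintro x y ⟨hx, j, hj⟩ ⟨hy, k, hk⟩
    refine ⟨?_, j + k, ?_⟩
    · rw [redNorm_mul]
      push_cast
      rw [norm_mul]
      exact mul_le_one₀ hx (norm_nonneg _) hy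
    · rw [pow_add, mul_smul, ← mul_smul_comm, ← smul_mul_assoc]
      exact O.mul_mem hj hk
  one_mem' := ⟨by simp [redNorm_one], 0, by simp [O.one_mem]⟩
  add_mem' := by
    rintro x y ⟨hx, j, hj⟩ ⟨hy, k, hk⟩
    refine ⟨?_, j + k, ?_⟩
    · rw [← redNorm_toExt] at hx hy ⊢
      rw [toExt_add]
      exact h.norm_redNorm_add_le_one hx hy
    · have e : ((p : ℚ) ^ (j + k)) • (x + y) =
          (p ^ k) • (((p : ℚ) ^ j) • x) + (p ^ j) • (((p : ℚ) ^ k) • y) := by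
        rw [← Nat.cast_smul_eq_nsmul ℚ, ← Nat.cast_smul_eq_nsmul ℚ]
        push_cast
        module
      rw [e]
      exact O.add_mem (O.nsmul_mem hj _) (O.nsmul_mem hk _)
  zero_mem' := ⟨by simp [redNorm_zero], 0, by simp [O.zero_mem]⟩
  neg_mem' := by
    rintro x ⟨hx, j, hj⟩
    refine ⟨by rwa [redNorm_neg], j, ?_⟩
    rw [smul_neg]
    exact O.neg_mem hj

theorem le_ramifiedEnlargement {p : ℕ} [Fact p.Prime] (h : RamifiedAt a b p)
    {O : Subring ℍ[ℚ,a,b]} (hO : IsZOrder O) : O ≤ ramifiedEnlargement h O := fun x hx =>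
  ⟨norm_intCast_rat_le_one (redNorm_int_of_isZOrder hO hx), 0, by simpa using hx⟩

theorem redTrace_int_of_mem_ramifiedEnlargement {p : ℕ} [hp : Fact p.Prime]
    (h : RamifiedAt a b p)
    {O : Subring ℍ[ℚ,a,b]} (hO : IsZOrder O) {x : ℍ[ℚ,a,b]} (hx : x ∈ ramifiedEnlargement h O) :
    ∃ k : ℤ, (k : ℚ) = redTrace x := by
  obtain ⟨hx, j, hj⟩ := hx
  apply exists_intCast_of_padic
  intro q
  by_cases hqp : (q : ℕ) = p
  · subst hqp
    rw [← redTrace_toExt]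
    apply h.norm_redTrace_le_one
    rwa [redNorm_toExt]
  · have h1 := norm_intCast_rat_le_one (p := (q : ℕ))
      (redTrace_int_of_isZOrder hO hj)
    rw [redTrace_smul] at h1
    push_cast at h1
    rw [norm_mul, norm_pow] at h1
    have h2 : ‖((p : ℕ) : ℚ_[(q : ℕ)])‖ = 1 :=
      Padic.norm_natCast_eq_one_iff.2 ((Nat.coprime_primes q.2 hp.out).2 hqp)
    rwa [h2, one_pow, one_mul] at h1

theorem natCast_natAbs_num (q : ℚ) :
    ((q.num.natAbs : ℕ) : ℚ) = (q.num.sign : ℚ) * (q * q.den) := by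
  rw [Rat.mul_den_eq_num, ← Int.cast_natCast, Int.natCast_natAbs, ← Int.sign_mul_self_eq_abs,
    Int.cast_mul]

theorem isZOrder_ramifiedEnlargement {p : ℕ} [Fact p.Prime] (ha : a ≠ 0) (hb : b ≠ 0)
    (h : RamifiedAt a b p) {O : Subring ℍ[ℚ,a,b]} (hO : IsZOrder O) :
    IsZOrder (ramifiedEnlargement h O) := by
  have hle := le_ramifiedEnlargement h hO
  refine ⟨?_, top_le_iff.1 (hO.2 ▸ Submodule.span_mono hle)⟩
  -- the traces against multiples of the standard basis bound the denominators
  obtain ⟨E₁, hE₁, hI⟩ := exists_nsmul_mem hO ⟨0, 1, 0, 0⟩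
  obtain ⟨E₂, hE₂, hJ⟩ := exists_nsmul_mem hO ⟨0, 0, 1, 0⟩
  obtain ⟨E₃, hE₃, hK⟩ := exists_nsmul_mem hO ⟨0, 0, 0, 1⟩
  have hna : a.num ≠ 0 := Rat.num_ne_zero.2 ha
  have hnb : b.num ≠ 0 := Rat.num_ne_zero.2 hb
  refine fg_of_hasDenom (E := 2 * E₁ * E₂ * E₃ * a.num.natAbs * b.num.natAbs) (by
    have := Int.natAbs_ne_zero.2 hna
    have := Int.natAbs_ne_zero.2 hnb
    positivity) ?_
  intro x hx
  have hx' : x ∈ ramifiedEnlargement h O := hx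
  obtain ⟨t₀, h₀⟩ := redTrace_int_of_mem_ramifiedEnlargement h hO hx'
  obtain ⟨t₁, h₁⟩ := redTrace_int_of_mem_ramifiedEnlargement h hO
    ((ramifiedEnlargement h O).mul_mem hx' (hle hI))
  obtain ⟨t₂, h₂⟩ := redTrace_int_of_mem_ramifiedEnlargement h hO
    ((ramifiedEnlargement h O).mul_mem hx' (hle hJ))
  obtain ⟨t₃, h₃⟩ := redTrace_int_of_mem_ramifiedEnlargement h hO
    ((ramifiedEnlargement h O).mul_mem hx' (hle hK))
  rw [redTrace_eq] at h₀ h₁ h₂ h₃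
  simp at h₁ h₂ h₃
  obtain ⟨sa, hsa⟩ : ∃ s : ℤ, ((a.num.natAbs : ℕ) : ℚ) = s * (a * a.den) :=
    ⟨a.num.sign, natCast_natAbs_num a⟩
  obtain ⟨sb, hsb⟩ : ∃ s : ℤ, ((b.num.natAbs : ℕ) : ℚ) = s * (b * b.den) :=
    ⟨b.num.sign, natCast_natAbs_num b⟩
  refine ⟨⟨E₁ * E₂ * E₃ * a.num.natAbs * b.num.natAbs * t₀, ?_⟩,
    ⟨E₂ * E₃ * sa * a.den * b.num.natAbs * t₁, ?_⟩,
    ⟨E₁ * E₃ * a.num.natAbs * sb * b.den * t₂, ?_⟩,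
    ⟨-(E₁ * E₂ * sa * a.den * sb * b.den * t₃), ?_⟩⟩ <;>
    simp only [Int.cast_neg, Int.cast_mul, Int.cast_natCast, Nat.cast_mul, Nat.cast_ofNat]
  · rw [h₀]; ring
  · rw [h₁, hsa]; ring
  · rw [h₂, hsb]; ring
  · rw [h₃, hsa, hsb]; ring

/-- A maximal order is maximal at each ramified prime: it contains a prime-to-`p` multiple of
every element of `p`-integral norm. -/
theorem IsMaxOrder.exists_smul_mem {p : ℕ} [hp : Fact p.Prime] (ha : a ≠ 0) (hb : b ≠ 0)
    (h : RamifiedAt a b p) {O : Subring ℍ[ℚ,a,b]} (hO : IsMaxOrder O) {w : ℍ[ℚ,a,b]}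
    (hw : ‖((redNorm w : ℚ) : ℚ_[p])‖ ≤ 1) : ∃ k : ℕ, ¬ p ∣ k ∧ (k : ℚ) • w ∈ O := by
  have heq := hO.2 _ (isZOrder_ramifiedEnlargement ha hb h hO.1) (le_ramifiedEnlargement h hO.1)
  obtain ⟨E, hE, hEw⟩ := exists_nsmul_mem hO.1 w
  obtain ⟨j, k, hk, rfl⟩ := Nat.exists_eq_pow_mul_and_not_dvd hE p hp.out.ne_one
  refine ⟨k, hk, ?_⟩
  rw [← heq]
  refine ⟨?_, j, ?_⟩
  · rw [redNorm_smul]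
    push_cast
    rw [norm_mul, norm_pow]
    refine mul_le_one₀ (pow_le_one₀ (norm_nonneg _) ?_) (norm_nonneg _) hw
    exact_mod_cast Padic.norm_int_le_one (p := p) k
  · rw [smul_smul]
    exact_mod_cast hEw

theorem IsEichler.exists_smul_mem {p : ℕ} [hp : Fact p.Prime] (ha : a ≠ 0) (hb : b ≠ 0)
    (h : RamifiedAt a b p) {R : Subring ℍ[ℚ,a,b]} (hR : IsEichler R) {w : ℍ[ℚ,a,b]}
    (hw : ‖((redNorm w : ℚ) : ℚ_[p])‖ ≤ 1) : ∃ k : ℕ, ¬ p ∣ k ∧ (k : ℚ) • w ∈ R := by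
  obtain ⟨O₁, O₂, h₁, h₂, rfl⟩ := hR
  obtain ⟨k₁, hk₁, hw₁⟩ := h₁.exists_smul_mem ha hb h hw
  obtain ⟨k₂, hk₂, hw₂⟩ := h₂.exists_smul_mem ha hb h hw
  refine ⟨k₁ * k₂, hp.out.not_dvd_mul hk₁ hk₂, ?_, ?_⟩
  · have e : ((k₁ * k₂ : ℕ) : ℚ) • w = k₂ • ((k₁ : ℚ) • w) := by push_cast; module
    rw [e]
    exact O₁.nsmul_mem hw₁ _
  · have e : ((k₁ * k₂ : ℕ) : ℚ) • w = k₁ • ((k₂ : ℚ) • w) := by push_cast; module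
    rw [e]
    exact O₂.nsmul_mem hw₂ _

theorem IsEichler.bil_int {R : Subring ℍ[ℚ,a,b]} (hR : IsEichler R) {x y : ℍ[ℚ,a,b]}
    (hx : x ∈ R) (hy : y ∈ R) : ∃ k : ℤ, (k : ℚ) = bil x y := by
  obtain ⟨O₁, O₂, h₁, h₂, rfl⟩ := hR
  exact bil_int_of_isZOrder h₁.1 hx.1 hy.1

end

/-! ### Matrix models of quaternion algebras -/

section MatrixModel

variable {K : Type} [Field K] {a b : K}

theorem map_star_eq_adjugate (f : ℍ[K,a,b] →ₐ[K] Matrix (Fin 2) (Fin 2) K)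
    (hf : ∀ x, (f x).trace = redTrace x) (x : ℍ[K,a,b]) : f (star x) = (f x).adjugate := by
  have h1 : star x = redTrace x • 1 - x := by
    ext <;> simp [redTrace_eq]
    ring
  rw [h1, map_sub, map_smul, map_one, ← hf, Matrix.adjugate_fin_two, Matrix.trace_fin_two]
  ext i j
  fin_cases i <;> fin_cases j <;> simp

theorem redNorm_eq_det (f : ℍ[K,a,b] →ₐ[K] Matrix (Fin 2) (Fin 2) K)
    (hf : ∀ x, (f x).trace = redTrace x) (x : ℍ[K,a,b]) : redNorm x = (f x).det := by
  have h := congrArg f (mul_star_eq x)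
  rw [map_mul, map_star_eq_adjugate f hf, Matrix.mul_adjugate, map_smul, map_one] at h
  have := congrFun (congrFun h 0) 0
  simpa using this.symm

theorem bil_eq_entries (f : ℍ[K,a,b] →ₐ[K] Matrix (Fin 2) (Fin 2) K)
    (hf : ∀ x, (f x).trace = redTrace x) (x y : ℍ[K,a,b]) :
    bil x y = f x 0 0 * f y 1 1 + f x 1 1 * f y 0 0 - f x 0 1 * f y 1 0 - f x 1 0 * f y 0 1 := by
  rw [bil, ← hf, map_mul, map_star_eq_adjugate f hf, Matrix.adjugate_fin_two, Matrix.trace_fin_two]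
  simp [Matrix.mul_apply, Fin.sum_univ_two]
  ring

theorem trace_algEquiv [CharZero K] (φ : ℍ[K,a,b] ≃ₐ[K] Matrix (Fin 2) (Fin 2) K) (x : ℍ[K,a,b]) :
    (φ x).trace = redTrace x := by
  by_contra hne
  have h1 := congrArg φ (mul_self_eq x)
  rw [map_mul, map_sub, map_smul, map_smul, map_one] at h1
  set X := φ x with hX
  have h2 : X * X = X.trace • X - X.det • 1 := by
    ext i j
    fin_cases i <;> fin_cases j <;>
      simp [Matrix.mul_apply, Fin.sum_univ_two, Matrix.trace_fin_two, Matrix.det_fin_two] <;> ring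
  have h3 : (X.trace - redTrace x) • X = (X.det - redNorm x) • 1 := by
    rw [sub_smul, sub_smul, sub_eq_sub_iff_sub_eq_sub, ← h2, h1]
  have h4 : X = ((X.trace - redTrace x)⁻¹ * (X.det - redNorm x)) • 1 := by
    rw [mul_smul, ← h3, smul_smul, inv_mul_cancel₀ (sub_ne_zero.2 hne), one_smul]
  set c := (X.trace - redTrace x)⁻¹ * (X.det - redNorm x) with hc
  have h5 : x = c • 1 := by
    apply φ.injective
    rw [map_smul, map_one, ← hX, h4]
  apply hne
  rw [h4, h5, redTrace_eq]
  simp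
  ring

theorem bil_eq_entries' [CharZero K] (φ : ℍ[K,a,b] ≃ₐ[K] Matrix (Fin 2) (Fin 2) K)
    (x y : ℍ[K,a,b]) :
    bil x y = φ x 0 0 * φ y 1 1 + φ x 1 1 * φ y 0 0 - φ x 0 1 * φ y 1 0 - φ x 1 0 * φ y 0 1 :=
  bil_eq_entries (φ : ℍ[K,a,b] →ₐ[K] Matrix (Fin 2) (Fin 2) K) (trace_algEquiv φ) x y

theorem redNorm_eq_det' [CharZero K] (φ : ℍ[K,a,b] ≃ₐ[K] Matrix (Fin 2) (Fin 2) K)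
    (x : ℍ[K,a,b]) : redNorm x = (φ x).det :=
  redNorm_eq_det (φ : ℍ[K,a,b] →ₐ[K] Matrix (Fin 2) (Fin 2) K) (trace_algEquiv φ) x

end MatrixModel

/-! ### The discriminant -/

section Disc

variable {a b : ℚ}

/-- If `B` ramified at infinitely many primes, then `redDisc` would be the empty product; so its
prime divisors are ramified in any case. -/
theorem exists_redDisc_eq_prod (a b : ℚ) :
    (∃ s : Finset Nat.Primes, (∀ p ∈ s, RamifiedAt a b p) ∧ redDisc a b = ∏ p ∈ s, (p : ℕ)) := by
  by_cases hs : {p : Nat.Primes | RamifiedAt a b p}.Finite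
  · exact ⟨hs.toFinset, fun p hp => by simpa using hp,
      finprod_mem_eq_finite_toFinset_prod (fun p : Nat.Primes => (p : ℕ)) hs⟩
  · refine ⟨∅, by simp, ?_⟩
    rw [Finset.prod_empty]
    refine finprod_mem_eq_one_of_infinite (f := fun p : Nat.Primes => (p : ℕ))
      (s := {p : Nat.Primes | RamifiedAt a b p}) ?_
    rwa [Set.inter_eq_left.2]
    intro p _
    exact p.2.ne_one

theorem ramifiedAt_of_dvd_redDisc {p : Nat.Primes} (h : (p : ℕ) ∣ redDisc a b) :
    RamifiedAt a b p := by
  obtain ⟨s, hs, hd⟩ := exists_redDisc_eq_prod a b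
  rw [hd, p.2.prime.dvd_finsetProd_iff] at h
  obtain ⟨q, hq, hpq⟩ := h
  have : p = q := Subtype.ext ((Nat.prime_dvd_prime_iff_eq p.2 q.2).1 hpq)
  exact this ▸ hs q hq

theorem squarefree_redDisc (a b : ℚ) : Squarefree (redDisc a b) := by
  obtain ⟨s, -, hd⟩ := exists_redDisc_eq_prod a b
  rw [hd]
  refine Finset.squarefree_prod_of_pairwise_isCoprime ?_ (fun p _ => p.2.prime.squarefree)
  intro p _ q _ hpq
  exact Nat.coprime_iff_isRelPrime.1 ((Nat.coprime_primes p.2 q.2).2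
    (fun h => hpq (Subtype.ext h)))

end Disc

/-! ### The lattice `R(ℓ)` -/

section Lattice

theorem norm_natCast_of_squarefree {p : ℕ} [hp : Fact p.Prime] {N : ℕ} (hN : Squarefree N)
    (h : p ∣ N) : ‖(N : ℚ_[p])‖ = (p : ℝ)⁻¹ := by
  obtain ⟨M, rfl⟩ := h
  have hM : ¬ p ∣ M := by
    rintro ⟨k, rfl⟩
    exact hp.out.not_isUnit (hN p ⟨k, by ring⟩)
  have h1 : ‖(M : ℚ_[p])‖ = 1 :=
    Padic.norm_natCast_eq_one_iff.2 ((Nat.Prime.coprime_iff_not_dvd hp.out).2 hM)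
  rw [Nat.cast_mul, norm_mul, h1, mul_one, Padic.norm_p]

theorem padic_norm_sub_le {p : ℕ} [Fact p.Prime] (x y : ℚ_[p]) : ‖x - y‖ ≤ max ‖x‖ ‖y‖ := by
  rw [sub_eq_add_neg, ← norm_neg y]
  exact Padic.nonarchimedean _ _

theorem norm_natCast_le_one {p : ℕ} [Fact p.Prime] (N : ℕ) : ‖(N : ℚ_[p])‖ ≤ 1 := by
  exact_mod_cast Padic.norm_int_le_one (p := p) N

variable {a b : ℚ} {R : Subring ℍ[ℚ,a,b]} {N ℓ : ℕ}

theorem norm_bil_le_one_of_localOrder {p : ℕ} [Fact p.Prime] (hR : IsEichler R)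
    {x y : QuatExt a b ℚ_[p]} (hx : x ∈ localOrder R p) (hy : y ∈ localOrder R p) :
    ‖bil x y‖ ≤ 1 := by
  have hs : ∀ (c : ℤ_[p]) (z : QuatExt a b ℚ_[p]), c • z = (c : ℚ_[p]) • z := fun _ _ => rfl
  induction hx using Submodule.span_induction with
  | mem x hx =>
    obtain ⟨x, hx, rfl⟩ := hx
    induction hy using Submodule.span_induction with
    | mem y hy =>
      obtain ⟨y, hy, rfl⟩ := hy
      rw [bil_toExt]
      exact norm_intCast_rat_le_one (hR.bil_int hx hy)
    | zero => simp [bil_eq]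
    | add y z _ _ hy hz =>
      rw [bil_add_right]
      exact (Padic.nonarchimedean _ _).trans (max_le hy hz)
    | smul c y _ hy =>
      rw [hs, bil_smul_right, norm_mul]
      exact mul_le_one₀ c.2 (norm_nonneg _) hy
  | zero => simp [bil_eq]
  | add y z _ _ hy hz =>
    rw [bil_add_left]
    exact (Padic.nonarchimedean _ _).trans (max_le hy hz)
  | smul c y _ hy =>
    rw [hs, bil_smul_left, norm_mul]
    exact mul_le_one₀ c.2 (norm_nonneg _) hy

/-- At a ramified prime, `R_p` is the valuation ring of `B_p`, so that elements of the dual lattice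
have norm in `p⁻¹ ℤ_p`. For `p = 2` some powers of `2` are lost. -/
theorem norm_redNorm_le_of_localDual {p : ℕ} [hp : Fact p.Prime] (ha : a ≠ 0) (hb : b ≠ 0)
    (hR : IsEichler R) (h : RamifiedAt a b p) {x : ℍ[ℚ,a,b]}
    (hx : toExt ℚ_[p] x ∈ localDual R p) : ‖((4 * p * redNorm x : ℚ) : ℚ_[p])‖ ≤ 1 := by
  by_contra hcon
  have h0 : redNorm x ≠ 0 := by
    intro h0
    rw [h0] at hcon
    simp at hcon
  have hp0 : (p : ℚ) ≠ 0 := by exact_mod_cast hp.out.ne_zero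
  have hp1 : (1 : ℝ) < p := by exact_mod_cast hp.out.one_lt
  have hbig : (p : ℝ) ≤ ‖((4 * p * redNorm x : ℚ) : ℚ_[p])‖ := by
    by_contra hlt
    have := (Padic.norm_le_pow_iff_norm_lt_pow_add_one
      ((4 * p * redNorm x : ℚ) : ℚ_[p]) 0).2 (by simpa using not_le.1 hlt)
    exact hcon (by simpa using this)
  -- a multiple `w` of `x` of integral norm, with `tr (x w̄) = 1 / p`
  set w : ℍ[ℚ,a,b] := (1 / (2 * p * redNorm x)) • x with hw
  have hwn : ‖((redNorm w : ℚ) : ℚ_[p])‖ ≤ 1 := by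
    have e : redNorm w = (p * (4 * p * redNorm x))⁻¹ := by
      rw [hw, redNorm_smul]; field_simp; ring
    rw [e]
    push_cast at hbig ⊢
    rw [norm_inv, norm_mul, Padic.norm_p]
    apply inv_le_one_of_one_le₀
    rw [inv_mul_eq_div, one_le_div (by linarith)]
    exact hbig
  obtain ⟨k, hk, hkw⟩ := hR.exists_smul_mem ha hb h hwn
  have h1 : ‖bil (toExt ℚ_[p] x) (toExt ℚ_[p] ((k : ℚ) • w))‖ ≤ 1 :=
    hx _ (Submodule.subset_span ⟨_, hkw, rfl⟩)
  have e : bil x ((k : ℚ) • w) = k / p := by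
    rw [hw, bil_smul_right, bil_smul_right, bil_self]; field_simp
  rw [bil_toExt, e] at h1
  push_cast at h1
  have h2 : ‖(k : ℚ_[p])‖ = 1 :=
    Padic.norm_natCast_eq_one_iff.2 ((Nat.Prime.coprime_iff_not_dvd hp.out).2 hk)
  rw [norm_div, h2, Padic.norm_p, one_div, inv_inv] at h1
  linarith

theorem localDual_add {p : ℕ} [Fact p.Prime] {x y : QuatExt a b ℚ_[p]}
    (hx : x ∈ localDual R p) (hy : y ∈ localDual R p) : x + y ∈ localDual R p := by
  intro z hz
  have e : redTrace ((x + y) * star z) = redTrace (x * star z) + redTrace (y * star z) :=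
    bil_add_left x y z
  rw [e]
  exact (Padic.nonarchimedean _ _).trans (max_le (hx z hz) (hy z hz))

/-- At a prime dividing the level, an element of the dual lattice has integral entries, except
for the upper right one, which lies in `N⁻¹ ℤ_p`. -/
theorem entries_of_localDual {p : ℕ} [Fact p.Prime]
    (φ : QuatExt a b ℚ_[p] ≃ₐ[ℚ_[p]] Matrix (Fin 2) (Fin 2) ℚ_[p])
    (hφ : ∀ x, x ∈ localOrder R p ↔
      ‖φ x 0 0‖ ≤ 1 ∧ ‖φ x 0 1‖ ≤ 1 ∧ ‖φ x 1 0‖ ≤ ‖(N : ℚ_[p])‖ ∧ ‖φ x 1 1‖ ≤ 1)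
    {x : QuatExt a b ℚ_[p]} (hx : x ∈ localDual R p) :
    ‖φ x 0 0‖ ≤ 1 ∧ ‖φ x 1 1‖ ≤ 1 ∧ ‖φ x 1 0‖ ≤ 1 ∧ ‖(N : ℚ_[p]) * φ x 0 1‖ ≤ 1 := by
  have key : ∀ M : Matrix (Fin 2) (Fin 2) ℚ_[p], (‖M 0 0‖ ≤ 1 ∧ ‖M 0 1‖ ≤ 1 ∧
      ‖M 1 0‖ ≤ ‖(N : ℚ_[p])‖ ∧ ‖M 1 1‖ ≤ 1) →
      ‖φ x 0 0 * M 1 1 + φ x 1 1 * M 0 0 - φ x 0 1 * M 1 0 - φ x 1 0 * M 0 1‖ ≤ 1 := by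
    intro M hM
    have h1 := hx (φ.symm M) ((hφ _).2 (by simpa using hM))
    have h2 := bil_eq_entries' φ x (φ.symm M)
    rw [AlgEquiv.apply_symm_apply] at h2
    rw [← h2]
    exact h1
  refine ⟨?_, ?_, ?_, ?_⟩
  · simpa using key !![0, 0; 0, 1] (by simp)
  · simpa using key !![1, 0; 0, 0] (by simp)
  · simpa using key !![0, 1; 0, 0] (by simp)
  · simpa [mul_comm] using key !![0, 0; N, 0] (by simp)

/-- The trace form takes values in `(4 ℓ)⁻¹ ℤ` on `R(ℓ)`. -/
theorem bil_int_of_partialDual (ha : a ≠ 0) (hb : b ≠ 0) (hR : IsEichler R) (hN : HasLevel R N)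
    (hsq : Squarefree N) (hℓ : ℓ ∣ redDisc a b * N) {x y : ℍ[ℚ,a,b]}
    (hx : x ∈ partialDual R ℓ) (hy : y ∈ partialDual R ℓ) :
    ∃ k : ℤ, (k : ℚ) = 4 * ℓ * bil x y := by
  apply exists_intCast_of_padic
  intro p
  have h4ℓ : ‖(4 * ℓ : ℚ_[p])‖ ≤ 1 := by exact_mod_cast norm_natCast_le_one (p := p) (4 * ℓ)
  by_cases hpℓ : (p : ℕ) ∣ ℓ
  · have hxd := (hx p).1 hpℓ
    have hyd := (hy p).1 hpℓ
    by_cases hpd : (p : ℕ) ∣ redDisc a b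
    · have hram := ramifiedAt_of_dvd_redDisc hpd
      have h1 := norm_redNorm_le_of_localDual ha hb hR hram hxd
      have h2 := norm_redNorm_le_of_localDual ha hb hR hram hyd
      have h3 := norm_redNorm_le_of_localDual ha hb hR hram (x := x + y)
        (by rw [toExt_add]; exact localDual_add hxd hyd)
      obtain ⟨k, hk⟩ := hpℓ
      have e : 4 * ℓ * bil x y = k * (4 * p * redNorm (x + y) - 4 * p * redNorm x -
          4 * p * redNorm y) := by
        rw [redNorm_add, hk]; push_cast; ring
      rw [e, Rat.cast_mul, Rat.cast_sub, Rat.cast_sub, norm_mul]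
      refine mul_le_one₀ (by exact_mod_cast norm_natCast_le_one (p := p) k) (norm_nonneg _) ?_
      exact (padic_norm_sub_le _ _).trans
        (max_le ((padic_norm_sub_le _ _).trans (max_le h3 h1)) h2)
    · obtain ⟨φ, hφ⟩ := hN.2.2 p hpd
      have hpN : (p : ℕ) ∣ N := by
        have := hpℓ.trans hℓ
        exact (p.2.dvd_mul.1 this).resolve_left hpd
      obtain ⟨x1, x2, x3, x4⟩ := entries_of_localDual φ hφ hxd
      obtain ⟨y1, y2, y3, y4⟩ := entries_of_localDual φ hφ hyd
      have hNb : ‖(N : ℚ_[p]) * bil (toExt ℚ_[p] x) (toExt ℚ_[p] y)‖ ≤ 1 := by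
        rw [bil_eq_entries' φ]
        set X := φ (toExt ℚ_[p] x)
        set Y := φ (toExt ℚ_[p] y)
        have e : (N : ℚ_[p]) * (X 0 0 * Y 1 1 + X 1 1 * Y 0 0 - X 0 1 * Y 1 0 - X 1 0 * Y 0 1) =
            N * (X 0 0 * Y 1 1) + N * (X 1 1 * Y 0 0) - N * X 0 1 * Y 1 0 -
              X 1 0 * (N * Y 0 1) := by ring
        rw [e]
        have hN1 := norm_natCast_le_one (p := p) N
        have hm : ∀ {u v : ℚ_[p]}, ‖u‖ ≤ 1 → ‖v‖ ≤ 1 → ‖u * v‖ ≤ 1 := fun hu hv => by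
          rw [norm_mul]; exact mul_le_one₀ hu (norm_nonneg _) hv
        refine (padic_norm_sub_le _ _).trans (max_le ((padic_norm_sub_le _ _).trans
          (max_le ((Padic.nonarchimedean _ _).trans (max_le (hm hN1 (hm x1 y2))
            (hm hN1 (hm x2 y1)))) (hm x4 y3))) (hm x3 y4))
      have hℓN : ‖(ℓ : ℚ_[p])‖ ≤ ‖(N : ℚ_[p])‖ := by
        rw [norm_natCast_of_squarefree hsq hpN]
        obtain ⟨k, rfl⟩ := hpℓ
        rw [Nat.cast_mul, norm_mul, Padic.norm_p]
        exact mul_le_of_le_one_right (by positivity) (norm_natCast_le_one k)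
      rw [bil_toExt, norm_mul] at hNb
      have h4 : ‖(4 : ℚ_[p])‖ ≤ 1 := by exact_mod_cast norm_natCast_le_one (p := p) 4
      push_cast
      rw [norm_mul, norm_mul, mul_assoc]
      refine mul_le_one₀ h4 (by positivity) (le_trans ?_ hNb)
      gcongr
  · have h1 := norm_bil_le_one_of_localOrder hR ((hx p).2 hpℓ) ((hy p).2 hpℓ)
    rw [bil_toExt] at h1
    push_cast
    rw [norm_mul]
    exact mul_le_one₀ h4ℓ (norm_nonneg _) h1

/-- For elements of trace zero and norm `n` in `R(ℓ)`, the commutator has norm divisible by the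
primes that divide `d_B N` but not `ℓ`. -/
theorem norm_bil_sq_sub_lt_one (hR : IsEichler R) (hN : HasLevel R N)
    {p : Nat.Primes} (hp : (p : ℕ) ∣ redDisc a b * N) (hp2 : (p : ℕ) ≠ 2)
    (hpℓ : ¬ (p : ℕ) ∣ ℓ) {x y : ℍ[ℚ,a,b]} {n : ℚ}
    (hx : x ∈ partialDual R ℓ) (hy : y ∈ partialDual R ℓ) (hxt : redTrace x = 0)
    (hyt : redTrace y = 0) (hxn : redNorm x = n) (hyn : redNorm y = n) :
    ‖((bil x y ^ 2 - 4 * n ^ 2 : ℚ) : ℚ_[p])‖ < 1 := by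
  have hxO := (hx p).2 hpℓ
  have hyO := (hy p).2 hpℓ
  have hxt' : redTrace (toExt ℚ_[p] x) = 0 := by rw [redTrace_toExt, hxt, Rat.cast_zero]
  have hyt' : redTrace (toExt ℚ_[p] y) = 0 := by rw [redTrace_toExt, hyt, Rat.cast_zero]
  have hxn' : redNorm (toExt ℚ_[p] x) = n := by rw [redNorm_toExt, hxn]
  have hyn' : redNorm (toExt ℚ_[p] y) = n := by rw [redNorm_toExt, hyn]
  push_cast
  rw [← bil_toExt (K := ℚ_[p])]
  by_cases hpd : (p : ℕ) ∣ redDisc a b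
  · have h2 : ‖(2 : ℚ_[p])‖ = 1 := by
      exact_mod_cast Padic.norm_natCast_eq_one_iff (p := p).2
        ((Nat.coprime_primes p.2 Nat.prime_two).2 hp2)
    have hn : ‖(n : ℚ_[p])‖ ≤ 1 := by
      have := norm_bil_le_one_of_localOrder hR hxO hxO
      rwa [bil_self, hxn', norm_mul, h2, one_mul] at this
    exact (ramifiedAt_of_dvd_redDisc hpd).norm_bil_sq_sub_lt_one hp2 hxt' hyt' hxn' hyn' hn
      (norm_bil_le_one_of_localOrder hR hxO hyO)
  · obtain ⟨φ, hφ⟩ := hN.2.2 p hpd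
    have hpN : (p : ℕ) ∣ N := (p.2.dvd_mul.1 hp).resolve_left hpd
    have hN1 : ‖(N : ℚ_[p])‖ < 1 := Padic.norm_natCast_lt_one_iff.2 hpN
    obtain ⟨x1, x2, x3, x4⟩ := (hφ _).1 hxO
    obtain ⟨y1, y2, y3, y4⟩ := (hφ _).1 hyO
    have hb := bil_eq_entries' φ (toExt ℚ_[p] x) (toExt ℚ_[p] y)
    have hnx := redNorm_eq_det' φ (toExt ℚ_[p] x)
    have hny := redNorm_eq_det' φ (toExt ℚ_[p] y)
    have htx := trace_algEquiv φ (toExt ℚ_[p] x)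
    have hty := trace_algEquiv φ (toExt ℚ_[p] y)
    rw [hxn', Matrix.det_fin_two] at hnx
    rw [hyn', Matrix.det_fin_two] at hny
    rw [hxt', Matrix.trace_fin_two] at htx
    rw [hyt', Matrix.trace_fin_two] at hty
    set X := φ (toExt ℚ_[p] x)
    set Y := φ (toExt ℚ_[p] y)
    have hX : X 1 1 = -X 0 0 := by linear_combination htx
    have hY : Y 1 1 = -Y 0 0 := by linear_combination hty
    -- modulo `p` the lower left entries vanish
    set E : ℚ_[p] := X 0 1 * Y 1 0 + X 1 0 * Y 0 1 with hE
    have e : bil (toExt ℚ_[p] x) (toExt ℚ_[p] y) ^ 2 - 4 * (n : ℚ_[p]) ^ 2 =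
        Y 1 0 * (4 * X 0 0 * Y 0 0 * X 0 1 + X 0 1 * E - 4 * X 0 0 ^ 2 * Y 0 1 -
          4 * (X 0 1 * X 1 0) * Y 0 1) +
        X 1 0 * (4 * X 0 0 * Y 0 0 * Y 0 1 + Y 0 1 * E - 4 * Y 0 0 ^ 2 * X 0 1) := by
      have h1 : (n : ℚ_[p]) ^ 2 =
          (X 0 0 * X 1 1 - X 0 1 * X 1 0) * (Y 0 0 * Y 1 1 - Y 0 1 * Y 1 0) := by
        rw [← hnx, ← hny, sq]
      rw [h1, hb, hX, hY, hE]
      ring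
    rw [e]
    have hm : ∀ {u v : ℚ_[p]}, ‖u‖ ≤ 1 → ‖v‖ ≤ 1 → ‖u * v‖ ≤ 1 := fun hu hv => by
      rw [norm_mul]; exact mul_le_one₀ hu (norm_nonneg _) hv
    have hs : ∀ {u v : ℚ_[p]}, ‖u‖ ≤ 1 → ‖v‖ ≤ 1 → ‖u - v‖ ≤ 1 := fun hu hv =>
      (padic_norm_sub_le _ _).trans (max_le hu hv)
    have ha : ∀ {u v : ℚ_[p]}, ‖u‖ ≤ 1 → ‖v‖ ≤ 1 → ‖u + v‖ ≤ 1 := fun hu hv =>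
      (Padic.nonarchimedean _ _).trans (max_le hu hv)
    have h4 : ‖(4 : ℚ_[p])‖ ≤ 1 := by exact_mod_cast norm_natCast_le_one (p := p) 4
    have x3' := x3.trans hN1.le
    have y3' := y3.trans hN1.le
    have hE1 : ‖E‖ ≤ 1 := ha (hm x2 y3') (hm x3' y2)
    have hsq : ∀ {u : ℚ_[p]}, ‖u‖ ≤ 1 → ‖u ^ 2‖ ≤ 1 := fun hu => by
      rw [norm_pow]; exact pow_le_one₀ (norm_nonneg _) hu
    refine lt_of_le_of_lt (Padic.nonarchimedean _ _) (max_lt ?_ ?_)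
    · rw [norm_mul]
      refine lt_of_le_of_lt (mul_le_of_le_one_right (norm_nonneg _) ?_) (y3.trans_lt hN1)
      exact hs (hs (ha (hm (hm (hm h4 x1) y1) x2) (hm x2 hE1)) (hm (hm h4 (hsq x1)) y2))
        (hm (hm h4 (hm x2 x3')) y2)
    · rw [norm_mul]
      refine lt_of_le_of_lt (mul_le_of_le_one_right (norm_nonneg _) ?_) (x3.trans_lt hN1)
      exact hs (ha (hm (hm (hm h4 x1) y1) y2) (hm y2 hE1)) (hm (hm h4 (hsq y1)) x2)

/-- The congruence `tr (x ȳ)² ≡ 4 n²`, after clearing denominators. -/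
theorem dvd_bil_sub_mul_add (hR : IsEichler R) (hN : HasLevel R N)
    (hsq : Squarefree N) (hℓ : ℓ ∣ redDisc a b * N) {x y : ℍ[ℚ,a,b]} {n : ℚ} {k z : ℤ}
    (hx : x ∈ partialDual R ℓ) (hy : y ∈ partialDual R ℓ) (hxt : redTrace x = 0)
    (hyt : redTrace y = 0) (hxn : redNorm x = n) (hyn : redNorm y = n)
    (hk : (k : ℚ) = 4 * ℓ * bil x y) (hz : (z : ℚ) = ℓ * n) :
    ((redDisc a b * N / ℓ : ℕ) : ℤ) ∣ (4 * k - 32 * z) * (4 * k + 32 * z) := by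
  set D := redDisc a b * N with hD
  have hDsq : Squarefree D := Nat.squarefree_mul_iff.2 ⟨hN.2.1.symm, squarefree_redDisc a b, hsq⟩
  have hqsq : Squarefree (D / ℓ) := hDsq.squarefree_of_dvd (Nat.div_dvd_of_dvd hℓ)
  rw [Int.natCast_dvd, ← Nat.prod_primeFactors_of_squarefree hqsq]
  refine Finset.prod_primes_dvd _ (fun p hp => (Nat.prime_of_mem_primeFactors hp).prime) ?_
  intro p hp
  have hpp := Nat.prime_of_mem_primeFactors hp
  have hpD := Nat.dvd_of_mem_primeFactors hp
  rw [← Int.natCast_dvd]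
  rcases eq_or_ne p 2 with rfl | hp2
  · exact Dvd.dvd.mul_right ⟨2 * k - 16 * z, by push_cast; ring⟩ _
  · have hpℓ : ¬ p ∣ ℓ := by
      intro h
      have h1 : p * p ∣ D := by
        have := mul_dvd_mul h hpD
        rwa [Nat.mul_div_cancel' hℓ] at this
      exact hpp.not_isUnit (hDsq p h1)
    have : Fact p.Prime := ⟨hpp⟩
    have key := norm_bil_sq_sub_lt_one (p := ⟨p, hpp⟩) hR hN
      (hpD.trans (Nat.div_dvd_of_dvd hℓ)) hp2 hpℓ hx hy hxt hyt hxn hyn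
    have key' : ‖((bil x y ^ 2 - 4 * n ^ 2 : ℚ) : ℚ_[p])‖ < 1 := key
    have e : (((4 * k - 32 * z) * (4 * k + 32 * z) : ℤ) : ℚ_[p]) =
        ((256 * ℓ ^ 2 : ℕ) : ℚ_[p]) * ((bil x y ^ 2 - 4 * n ^ 2 : ℚ) : ℚ_[p]) := by
      have : (((4 * k - 32 * z) * (4 * k + 32 * z) : ℤ) : ℚ) =
          ((256 * ℓ ^ 2 : ℕ) : ℚ) * (bil x y ^ 2 - 4 * n ^ 2) := by
        push_cast
        rw [hk, hz]
        ring
      exact_mod_cast congrArg (Rat.cast : ℚ → ℚ_[p]) this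
    rw [← Padic.norm_intCast_lt_one_iff (p := p), e, norm_mul]
    exact lt_of_le_of_lt (mul_le_of_le_one_left (norm_nonneg _) (norm_natCast_le_one _)) key'

end Lattice

/-! ### Geometry of the region `Ω(δ,T)` -/

section Frame

variable {a b : ℚ} {i j : QuatExt a b ℝ}

theorem IsFrame.trace_i (h : IsFrame i j) : redTrace i = 0 ∧ redNorm i = 1 := by
  have h1 := h.i_sq.symm.trans (mul_self_eq i)
  have h2 : redTrace i = 0 := by
    by_contra hne
    have h3 : i = ((redTrace i)⁻¹ * (redNorm i - 1)) • (1 : QuatExt a b ℝ) := by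
      have : redTrace i • i = (redNorm i - 1) • (1 : QuatExt a b ℝ) := by
        rw [sub_smul, one_smul, sub_eq_add_neg, h1]; abel
      rw [mul_smul, ← this, smul_smul, inv_mul_cancel₀ hne, one_smul]
    set c := (redTrace i)⁻¹ * (redNorm i - 1)
    have h4 := congrArg QuaternionAlgebra.re h.i_sq
    rw [h3] at h4
    simp at h4
    nlinarith
  refine ⟨h2, ?_⟩
  have := congrArg QuaternionAlgebra.re h1
  rw [h2] at this
  simp at this
  linarith

theorem IsFrame.trace_j (h : IsFrame i j) {σ : ℝ} (hσ : σ ≠ 0)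
    (hj : j * j = σ • (1 : QuatExt a b ℝ)) :
    redTrace j = 0 ∧ redNorm j = -σ := by
  have h1 := hj.symm.trans (mul_self_eq j)
  have h2 : redTrace j = 0 := by
    by_contra hne
    have h3 : j = ((redTrace j)⁻¹ * (redNorm j + σ)) • (1 : QuatExt a b ℝ) := by
      have : redTrace j • j = (redNorm j + σ) • (1 : QuatExt a b ℝ) := by
        rw [add_smul, h1]; abel
      rw [mul_smul, ← this, smul_smul, inv_mul_cancel₀ hne, one_smul]
    set c := (redTrace j)⁻¹ * (redNorm j + σ)
    have h4 := h.anticomm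
    rw [h3] at h4 hj
    have h5 : (2 * c) • i = 0 := by
      have : c • i = -(c • i) := by simpa using h4
      rw [two_mul, add_smul]
      nth_rw 1 [this]
      abel
    have hi : i ≠ 0 := by
      rintro rfl
      have := congrArg QuaternionAlgebra.re h.i_sq
      simp at this
    have hc : c = 0 := by
      rcases smul_eq_zero.1 h5 with h6 | h6
      · linarith
      · exact absurd h6 hi
    rw [hc] at hj
    have := congrArg QuaternionAlgebra.re hj
    simp at this
    exact hσ this.symm
  refine ⟨h2, ?_⟩
  have := congrArg QuaternionAlgebra.re h1
  rw [h2] at this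
  simp at this
  linarith

/-- In a frame the reduced norm is a diagonal form. -/
theorem IsFrame.exists_diagonal (h : IsFrame i j) : ∃ σ : ℝ, (σ = 1 ∨ σ = -1) ∧
    (∀ t u v d : ℝ, redTrace (t • i + u • j + v • (i * j) + d • (1 : QuatExt a b ℝ)) = 2 * d) ∧
    ∀ t u v d t' u' v' d' : ℝ,
      bil (t • i + u • j + v • (i * j) + d • (1 : QuatExt a b ℝ))
        (t' • i + u' • j + v' • (i * j) + d' • (1 : QuatExt a b ℝ)) =
      2 * (t * t' + d * d' - σ * (u * u' + v * v')) := by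
  obtain ⟨σ, hσ, hj⟩ : ∃ σ : ℝ, (σ = 1 ∨ σ = -1) ∧ j * j = σ • (1 : QuatExt a b ℝ) := by
    rcases h.j_sq with h1 | h1
    · exact ⟨1, Or.inl rfl, by rw [h1, one_smul]⟩
    · exact ⟨-1, Or.inr rfl, by rw [h1, neg_smul, one_smul]⟩
  have hσ0 : σ ≠ 0 := by rcases hσ with rfl | rfl <;> norm_num
  obtain ⟨hi1, hi2⟩ := h.trace_i
  obtain ⟨hj1, hj2⟩ := h.trace_j hσ0 hj
  have hij : redTrace (i * j) = 0 := by
    have h1 := congrArg redTrace h.anticomm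
    rw [redTrace_neg, redTrace_mul_comm j i] at h1
    linarith
  have hstar : ∀ z : QuatExt a b ℝ, redTrace z = 0 → star z = -z := by
    intro z hz
    have : star z = redTrace z • (1 : QuatExt a b ℝ) - z := by
      ext <;> simp [redTrace_eq]
      ring
    rw [this, hz]
    simp
  have hone : redTrace (1 : QuatExt a b ℝ) = 2 := by simp [redTrace_eq]
  have b1 : ∀ z : QuatExt a b ℝ, bil z 1 = redTrace z := fun z => by simp [bil]
  have bij : bil i j = 0 := by
    rw [bil, hstar j hj1, mul_neg, redTrace_neg, hij, neg_zero]
  have biij : bil i (i * j) = 0 := by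
    rw [bil, hstar _ hij, mul_neg, redTrace_neg, ← mul_assoc, h.i_sq, neg_one_mul, redTrace_neg,
      hj1]
    simp
  have bjij : bil j (i * j) = 0 := by
    rw [bil, hstar _ hij, mul_neg, redTrace_neg, redTrace_mul_comm, mul_assoc, hj, mul_smul_comm,
      redTrace_smul, mul_one, hi1]
    simp
  have bii : bil i i = 2 := by rw [bil_self, hi2, mul_one]
  have bjj : bil j j = 2 * -σ := by rw [bil_self, hj2]
  have bkk : bil (i * j) (i * j) = 2 * -σ := by rw [bil_self, redNorm_mul, hi2, hj2, one_mul]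
  refine ⟨σ, hσ, ?_, ?_⟩
  · intro t u v d
    simp only [redTrace_add, redTrace_smul, hi1, hj1, hij, hone]
    ring
  · intro t u v d t' u' v' d'
    simp only [bil_add_left, bil_add_right, bil_smul_left, bil_smul_right, bii, bjj, bkk, bij,
      redTrace_add, redTrace_smul, hone, biij, bjij, b1, hi1, hj1, hij, bil_comm j i,
      bil_comm (i * j) i, bil_comm (i * j) j,
      bil_comm 1 i, bil_comm 1 j, bil_comm 1 (i * j)]
    ring

/-- Elements of trace zero and norm `n` in `Ω(δ,T)` are within `O(δ T²)` of each other, up to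
sign, in terms of the reduced norm of their difference. -/
theorem IsFrame.bil_bounds (h : IsFrame i j) {δ T : ℝ}
    {x y : QuatExt a b ℝ} {n : ℝ} (hx : x ∈ Omega i j δ T) (hy : y ∈ Omega i j δ T)
    (hxt : redTrace x = 0) (hyt : redTrace y = 0) (hxn : redNorm x = n) (hyn : redNorm y = n) :
    |n| ≤ T ^ 2 ∧ |bil x y| ≤ 2 * T ^ 2 ∧
      (|bil x y - 2 * n| ≤ 5 * (δ * T ^ 2) ∨ |bil x y + 2 * n| ≤ 5 * (δ * T ^ 2)) := by
  obtain ⟨σ, hσ, htr, hbil⟩ := h.exists_diagonal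
  obtain ⟨t, u, v, d, rfl, h1, h2⟩ := hx
  obtain ⟨t', u', v', d', rfl, h3, h4⟩ := hy
  rw [htr] at hxt hyt
  have hd : d = 0 := by linarith
  have hd' : d' = 0 := by linarith
  have hn : n = t ^ 2 - σ * (u ^ 2 + v ^ 2) := by
    have := hbil t u v d t u v d
    rw [bil_self, hxn, hd] at this
    linarith
  have hn' : n = t' ^ 2 - σ * (u' ^ 2 + v' ^ 2) := by
    have := hbil t' u' v' d' t' u' v' d'
    rw [bil_self, hyn, hd'] at this
    linarith
  rw [hbil, hd, hd']
  rw [hd] at h1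
  rw [hd'] at h3
  have hr : |u ^ 2 + v ^ 2 - (u' ^ 2 + v' ^ 2)| ≤ δ * T ^ 2 := by
    rw [abs_le]; constructor <;> linarith [sq_nonneg u, sq_nonneg v, sq_nonneg u', sq_nonneg v']
  have hσabs : |σ| = 1 := by rcases hσ with rfl | rfl <;> simp
  have hprod : |(t - t') * (t + t')| ≤ δ * T ^ 2 := by
    have e : (t - t') * (t + t') = σ * (u ^ 2 + v ^ 2 - (u' ^ 2 + v' ^ 2)) := by
      linear_combination hn' - hn
    rw [e, abs_mul, hσabs, one_mul]
    exact hr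
  have hminus : (u - u') ^ 2 + (v - v') ^ 2 ≤ 4 * (δ * T ^ 2) := by
    linarith [sq_nonneg (u + u'), sq_nonneg (v + v')]
  have hplus : (u + u') ^ 2 + (v + v') ^ 2 ≤ 4 * (δ * T ^ 2) := by
    linarith [sq_nonneg (u - u'), sq_nonneg (v - v')]
  have hm0 : 0 ≤ (u - u') ^ 2 + (v - v') ^ 2 := by positivity
  have hp0 : 0 ≤ (u + u') ^ 2 + (v + v') ^ 2 := by positivity
  refine ⟨?_, ?_, ?_⟩
  · rw [hn, abs_le]
    rcases hσ with rfl | rfl <;> constructor <;>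
      linarith [sq_nonneg u, sq_nonneg v, sq_nonneg t]
  · rw [abs_le]
    rcases hσ with rfl | rfl <;> constructor <;>
      linarith [sq_nonneg (u - u'), sq_nonneg (v - v'), sq_nonneg (t - t'), sq_nonneg (u + u'),
        sq_nonneg (v + v'), sq_nonneg (t + t')]
  · rcases le_total |t - t'| |t + t'| with hle | hle
    · left
      have hsq : (t - t') ^ 2 ≤ δ * T ^ 2 := by
        rw [← sq_abs, sq]
        calc _ ≤ |t - t'| * |t + t'| := by gcongr
          _ ≤ _ := by rwa [← abs_mul]
      have e : 2 * (t * t' + 0 * 0 - σ * (u * u' + v * v')) - 2 * n =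
          -(t - t') ^ 2 + σ * ((u - u') ^ 2 + (v - v') ^ 2) := by
        linear_combination (-1) * hn - hn'
      rw [e, abs_le]
      rcases hσ with rfl | rfl <;> constructor <;> linarith [sq_nonneg (t - t')]
    · right
      have hsq : (t + t') ^ 2 ≤ δ * T ^ 2 := by
        rw [← sq_abs, sq]
        calc _ ≤ |t - t'| * |t + t'| := by gcongr
          _ ≤ _ := by rwa [← abs_mul]
      have e : 2 * (t * t' + 0 * 0 - σ * (u * u' + v * v')) + 2 * n =
          (t + t') ^ 2 - σ * ((u + u') ^ 2 + (v + v') ^ 2) := by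
        linear_combination hn + hn'
      rw [e, abs_le]
      rcases hσ with rfl | rfl <;> constructor <;> linarith [sq_nonneg (t + t')]

end Frame

/-! ### Counting by the inner product with a fixed element -/

section Count

variable {a b : ℚ}

/-- The elements of `B` whose conjugates by `g` make up `typeIISet`. -/
def latticeSet (R : Subring ℍ[ℚ,a,b]) (ℓ : ℕ) (i j : QuatExt a b ℝ)
    (g : (QuatExt a b ℝ)ˣ) (δ T : ℝ) (n : ℚ) : Set ℍ[ℚ,a,b] :=
  {γ | γ ∈ partialDual R ℓ ∧ redTrace γ = 0 ∧ redNorm γ = n ∧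
    (↑g⁻¹ : QuatExt a b ℝ) * toExt ℝ γ * (g : QuatExt a b ℝ) ∈ Omega i j δ T}

theorem ncard_typeIISet_le {R : Subring ℍ[ℚ,a,b]} {ℓ : ℕ} {i j : QuatExt a b ℝ}
    {g : (QuatExt a b ℝ)ˣ} {δ T : ℝ} {n : ℚ} (h : (latticeSet R ℓ i j g δ T n).Finite) :
    (typeIISet R ℓ i j g δ T n).Finite ∧
      (typeIISet R ℓ i j g δ T n).ncard ≤ (latticeSet R ℓ i j g δ T n).ncard := by
  have hsub : typeIISet R ℓ i j g δ T n ⊆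
      (fun γ => (↑g⁻¹ : QuatExt a b ℝ) * toExt ℝ γ * (g : QuatExt a b ℝ)) ''
        latticeSet R ℓ i j g δ T n := by
    rintro x ⟨⟨γ, hγ, hγt, rfl⟩, hΩ, hn⟩
    refine ⟨γ, ⟨hγ, hγt, ?_, hΩ⟩, rfl⟩
    rw [redNorm_conj, redNorm_toExt] at hn
    exact_mod_cast hn
  exact ⟨(h.image _).subset hsub,
    (Set.ncard_le_ncard hsub (h.image _)).trans (Set.ncard_image_le h)⟩

theorem latticeSet_bounds {R : Subring ℍ[ℚ,a,b]} {ℓ : ℕ} {i j : QuatExt a b ℝ} (h : IsFrame i j)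
    {g : (QuatExt a b ℝ)ˣ} {δ T : ℝ} {n : ℚ} {x y : ℍ[ℚ,a,b]}
    (hx : x ∈ latticeSet R ℓ i j g δ T n) (hy : y ∈ latticeSet R ℓ i j g δ T n) :
    |(n : ℝ)| ≤ T ^ 2 ∧ |((bil x y : ℚ) : ℝ)| ≤ 2 * T ^ 2 ∧
      (|((bil x y : ℚ) : ℝ) - 2 * n| ≤ 5 * (δ * T ^ 2) ∨
        |((bil x y : ℚ) : ℝ) + 2 * n| ≤ 5 * (δ * T ^ 2)) := by
  obtain ⟨-, hxt, hxn, hxΩ⟩ := hx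
  obtain ⟨-, hyt, hyn, hyΩ⟩ := hy
  have := h.bil_bounds hxΩ hyΩ (by rw [redTrace_conj, redTrace_toExt, hxt, Rat.cast_zero])
    (by rw [redTrace_conj, redTrace_toExt, hyt, Rat.cast_zero])
    (n := n) (by rw [redNorm_conj, redNorm_toExt, hxn]) (by rw [redNorm_conj, redNorm_toExt, hyn])
  rwa [bil_conj, bil_toExt] at this

/-- The integers `M` within `L` of `±A` that satisfy `q ∣ (M - A) (M + A)`. -/
theorem ncard_dvd_sub_mul_add_le {q : ℕ} (hq : Squarefree q) (A : ℤ) {L : ℝ} (hL : 0 ≤ L) :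
    {M : ℤ | (|(M : ℝ) - A| ≤ L ∨ |(M : ℝ) + A| ≤ L) ∧ (q : ℤ) ∣ (M - A) * (M + A)}.Finite ∧
    ({M : ℤ | (|(M : ℝ) - A| ≤ L ∨ |(M : ℝ) + A| ≤ L) ∧
        (q : ℤ) ∣ (M - A) * (M + A)}.ncard : ℝ) ≤
      2 * (q.divisors.card * (2 * L / q + 1)) := by
  obtain ⟨f1, c1⟩ := ncard_dvd_mul_add_le hq (2 * A) hL
  obtain ⟨f2, c2⟩ := ncard_dvd_mul_add_le hq (-(2 * A)) hL
  set K1 := {k : ℤ | |(k : ℝ)| ≤ L ∧ (q : ℤ) ∣ k * (k + 2 * A)}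
  set K2 := {k : ℤ | |(k : ℝ)| ≤ L ∧ (q : ℤ) ∣ k * (k + -(2 * A))}
  set S := {M : ℤ | (|(M : ℝ) - A| ≤ L ∨ |(M : ℝ) + A| ≤ L) ∧ (q : ℤ) ∣ (M - A) * (M + A)}
  have hsub : S ⊆ (fun k => k + A) '' K1 ∪ (fun k => k - A) '' K2 := by
    rintro M ⟨hM | hM, hd⟩
    · refine Or.inl ⟨M - A, ⟨by push_cast; exact hM, ?_⟩, by ring⟩
      convert hd using 1
      ring
    · refine Or.inr ⟨M + A, ⟨by push_cast; exact hM, ?_⟩, by ring⟩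
      convert hd using 1
      ring
  have hfin := (f1.image (fun k => k + A)).union (f2.image (fun k => k - A))
  refine ⟨hfin.subset hsub, ?_⟩
  have : S.ncard ≤ K1.ncard + K2.ncard :=
    (Set.ncard_le_ncard hsub hfin).trans ((Set.ncard_union_le _ _).trans
      (add_le_add (Set.ncard_image_le f1) (Set.ncard_image_le f2)))
  calc (S.ncard : ℝ) ≤ K1.ncard + K2.ncard := by exact_mod_cast this
    _ ≤ _ := by linarith

/-- The elements `y` that span with `x` a plane on which the norm form is nondegenerate: by the
congruence for `tr (x ȳ)` the latter takes few values, and each of them is taken rarely. -/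
theorem exists_ncard_nondegenerate_le {ε : ℝ} (hε : 0 < ε) :
    ∃ C : ℝ, 1 ≤ C ∧ ∀ (a b : ℚ), a ≠ 0 → b ≠ 0 →
      ∀ (R : Subring ℍ[ℚ,a,b]) (N : ℕ), IsEichler R → HasLevel R N → Squarefree N →
      ∀ ℓ : ℕ, ℓ ∣ redDisc a b * N → ∀ i j : QuatExt a b ℝ, IsFrame i j →
      ∀ (g : (QuatExt a b ℝ)ˣ) (δ T : ℝ), 0 < δ → 0 < T →
      ∀ n : ℚ, (∃ m : ℤ, n = (m : ℚ) / (ℓ : ℚ)) → n ≠ 0 → ∀ x ∈ latticeSet R ℓ i j g δ T n,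
        {y ∈ latticeSet R ℓ i j g δ T n | 4 * n ^ 2 - bil x y ^ 2 ≠ 0}.Finite ∧
        ({y ∈ latticeSet R ℓ i j g δ T n | 4 * n ^ 2 - bil x y ^ 2 ≠ 0}.ncard : ℝ) ≤
          C * ((redDisc a b : ℝ) * (N : ℝ) * (1 + T)) ^ ε *
            (1 + (ℓ : ℝ) ^ 2 / ((redDisc a b : ℝ) * (N : ℝ)) * δ * T ^ 2) := by
  obtain ⟨C₁, hC₁, hdiv⟩ := exists_card_divisors_le (ε := ε / 2) (by positivity)
  obtain ⟨C₂, hC₂, hplane⟩ := exists_ncard_plane_le (ε := ε / 2) (by positivity)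
  refine ⟨320 * C₁ * C₂, by nlinarith, ?_⟩
  intro a b ha hb R N hR hN hsq ℓ hℓ i j hij g δ T hδ hT n hn hn0 x hx
  set D : ℕ := redDisc a b * N with hD
  have hDsq : Squarefree D := Nat.squarefree_mul_iff.2 ⟨hN.2.1.symm, squarefree_redDisc a b, hsq⟩
  have hD0 : D ≠ 0 := hDsq.ne_zero
  have hD1 : (1 : ℝ) ≤ D := by exact_mod_cast Nat.one_le_iff_ne_zero.2 hD0
  have hDr : (redDisc a b : ℝ) * (N : ℝ) = D := by rw [hD]; push_cast; rfl
  rw [hDr]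
  set W : ℝ := D * (1 + T) with hW
  have hWD : (D : ℝ) ≤ W := by rw [hW]; nlinarith
  have hW1 : 1 ≤ W := hD1.trans hWD
  have hTW : T ≤ W := by rw [hW]; nlinarith
  have hTW2 : T ^ 2 ≤ W ^ 2 := by gcongr
  have hℓ0 : ℓ ≠ 0 := ne_zero_of_dvd_ne_zero hD0 hℓ
  have hℓD : (ℓ : ℝ) ≤ D := by exact_mod_cast Nat.le_of_dvd (Nat.pos_of_ne_zero hD0) hℓ
  obtain ⟨q, hq⟩ := hℓ
  have hqdiv : D / ℓ = q := by
    rw [hq, Nat.mul_div_cancel_left _ (Nat.pos_of_ne_zero hℓ0)]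
  have hq0 : q ≠ 0 := by rintro rfl; simp at hq; exact hD0 hq
  have hqsq : Squarefree q := hDsq.squarefree_of_dvd (hq ▸ Dvd.intro_left _ rfl)
  have hqD : (q : ℝ) ≤ D := by
    exact_mod_cast Nat.le_of_dvd (Nat.pos_of_ne_zero hD0) (hq ▸ Dvd.intro_left _ rfl)
  obtain ⟨z, hz⟩ := hn
  have hz' : (z : ℚ) = ℓ * n := by rw [hz]; field_simp
  set L : ℝ := 80 * ℓ * (δ * T ^ 2) with hL
  have hL0 : 0 ≤ L := by positivity
  obtain ⟨hfin, hcard⟩ := ncard_dvd_sub_mul_add_le hqsq (32 * z) hL0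
  set 𝓜 := {M : ℤ | (|(M : ℝ) - (32 * z : ℤ)| ≤ L ∨ |(M : ℝ) + (32 * z : ℤ)| ≤ L) ∧
    (q : ℤ) ∣ (M - 32 * z) * (M + 32 * z)} with hM
  set S := {y ∈ latticeSet R ℓ i j g δ T n | 4 * n ^ 2 - bil x y ^ 2 ≠ 0} with hS
  have hℓ' : ℓ ∣ redDisc a b * N := ⟨q, hq⟩
  have hbil : ∀ u ∈ latticeSet R ℓ i j g δ T n, ∀ v ∈ latticeSet R ℓ i j g δ T n,
      ∃ k : ℤ, (k : ℚ) = 4 * ℓ * bil u v := fun u hu v hv =>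
    bil_int_of_partialDual ha hb hR hN hsq hℓ' hu.1 hv.1
  have hfloor : ∀ y ∈ latticeSet R ℓ i j g δ T n,
      ((⌊16 * ℓ * bil x y⌋ : ℤ) : ℚ) = 16 * ℓ * bil x y := by
    intro y hy
    obtain ⟨k, hk⟩ := hbil x hx y hy
    have : 16 * ℓ * bil x y = ((4 * k : ℤ) : ℚ) := by push_cast; rw [hk]; ring
    rw [this, Int.floor_intCast]
  have hmem : ∀ y ∈ S, ⌊16 * ℓ * bil x y⌋ ∈ hfin.toFinset := by
    rintro y ⟨hy, -⟩
    rw [Set.Finite.mem_toFinset]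
    obtain ⟨k, hk⟩ := hbil x hx y hy
    have e : ⌊16 * ℓ * bil x y⌋ = 4 * k := by
      have : 16 * ℓ * bil x y = ((4 * k : ℤ) : ℚ) := by push_cast; rw [hk]; ring
      rw [this, Int.floor_intCast]
    rw [e]
    constructor
    · have hkr : (k : ℝ) = 4 * ℓ * ((bil x y : ℚ) : ℝ) := by
        exact_mod_cast congrArg (Rat.cast : ℚ → ℝ) hk
      have hzr : (z : ℝ) = ℓ * n := by exact_mod_cast congrArg (Rat.cast : ℚ → ℝ) hz'
      push_cast
      rw [hkr, hzr]
      rcases (latticeSet_bounds hij hx hy).2.2 with h1 | h1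
      · left
        rw [show 4 * (4 * ℓ * ((bil x y : ℚ) : ℝ)) - 32 * (ℓ * (n : ℝ)) =
          (16 * ℓ) * (((bil x y : ℚ) : ℝ) - 2 * n) by ring, abs_mul, abs_of_nonneg (by positivity)]
        calc _ ≤ 16 * (ℓ : ℝ) * (5 * (δ * T ^ 2)) := by gcongr
          _ = L := by rw [hL]; ring
      · right
        rw [show 4 * (4 * ℓ * ((bil x y : ℚ) : ℝ)) + 32 * (ℓ * (n : ℝ)) =
          (16 * ℓ) * (((bil x y : ℚ) : ℝ) + 2 * n) by ring, abs_mul, abs_of_nonneg (by positivity)]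
        calc _ ≤ 16 * (ℓ : ℝ) * (5 * (δ * T ^ 2)) := by gcongr
          _ = L := by rw [hL]; ring
    · have := dvd_bil_sub_mul_add hR hN hsq hℓ' hx.1 hy.1 hx.2.1 hy.2.1 hx.2.2.1 hy.2.2.1 hk hz'
      rwa [← hD, hqdiv] at this
  obtain ⟨hSfin, hScard⟩ := ncard_le_card_mul S (fun y => ⌊16 * ℓ * bil x y⌋) hfin.toFinset hmem
    (c := C₂ * W ^ (ε / 2)) (by
      intro M _
      rcases {y ∈ S | ⌊16 * ℓ * bil x y⌋ = M}.eq_empty_or_nonempty with h | ⟨y₁, hy₁, hy₁M⟩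
      · rw [h]
        simp only [Set.finite_empty, Set.ncard_empty, Nat.cast_zero, true_and]
        positivity
      have hb1 := latticeSet_bounds hij hx hy₁.1
      refine hplane a b _ x n (bil x y₁) (16 * ℓ) W hW1 (by positivity) ?_ hx.2.1 hx.2.2.1 ?_ ?_
        ?_ ?_ (hb1.1.trans hTW2) (hb1.2.1.trans (by gcongr)) ?_ hn0 hy₁.2
      · push_cast
        have := hℓD.trans hWD
        gcongr
      · rintro y ⟨⟨hy, -⟩, hyM⟩
        refine ⟨hy.2.1, hy.2.2.1, ?_⟩
        have e : 16 * (ℓ : ℚ) * bil x y = 16 * ℓ * bil x y₁ := by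
          rw [← hfloor y hy, ← hfloor y₁ hy₁.1, hyM, hy₁M]
        exact mul_left_cancel₀ (by positivity) e
      · exact ⟨16 * z, by push_cast; rw [hz']; ring⟩
      · obtain ⟨k, hk⟩ := hbil x hx y₁ hy₁.1
        exact ⟨4 * k, by push_cast; rw [hk]; ring⟩
      · rintro u ⟨⟨hu, -⟩, -⟩ v ⟨⟨hv, -⟩, -⟩
        obtain ⟨k, hk⟩ := hbil u hu v hv
        exact ⟨4 * k, by push_cast; rw [hk]; ring⟩
      · rintro u ⟨⟨hu, -⟩, -⟩ v ⟨⟨hv, -⟩, -⟩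
        exact (latticeSet_bounds hij hu hv).2.1.trans (by gcongr))
  refine ⟨hSfin, hScard.trans ?_⟩
  rw [← Set.ncard_eq_toFinset_card _ hfin]
  have hdq : (q.divisors.card : ℝ) ≤ C₁ * W ^ (ε / 2) :=
    (hdiv q hq0).trans (by gcongr; exact hqD.trans hWD)
  have hLq : 2 * L / q = 160 * ((ℓ : ℝ) ^ 2 / D * δ * T ^ 2) := by
    have : (D : ℝ) = ℓ * q := by exact_mod_cast hq
    have h1 : (q : ℝ) ≠ 0 := by exact_mod_cast hq0
    have h2 : (ℓ : ℝ) ≠ 0 := by exact_mod_cast hℓ0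
    rw [this, hL]
    field_simp
    ring
  set V : ℝ := (ℓ : ℝ) ^ 2 / D * δ * T ^ 2 with hV
  have hV0 : 0 ≤ V := by positivity
  calc (𝓜.ncard : ℝ) * (C₂ * W ^ (ε / 2))
      ≤ 2 * (q.divisors.card * (2 * L / q + 1)) * (C₂ * W ^ (ε / 2)) := by gcongr
    _ ≤ 2 * (C₁ * W ^ (ε / 2) * (160 * (1 + V))) * (C₂ * W ^ (ε / 2)) := by
        gcongr
        rw [hLq]
        linarith
    _ = 320 * C₁ * C₂ * (W ^ (ε / 2) * W ^ (ε / 2)) * (1 + V) := by ring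
    _ = _ := by
        rw [← Real.rpow_add (by linarith)]
        congr 3
        ring

end Count

/-! ### The division algebra case -/

section NonSplit

variable {a b : ℚ}

/-- If `b = c² - a d²`, then `i ↦ (0, a; 1, 0)`, `j ↦ (c, -a d; d, -c)` identifies `B` with the
algebra of matrices. -/
theorem isSplit_of_eq_norm (ha : a ≠ 0) (hb : b ≠ 0) {c d : ℚ} (h : b = c ^ 2 - a * d ^ 2) :
    IsSplit a b := by
  set f : ℍ[ℚ,a,b] →ₐ[ℚ] Matrix (Fin 2) (Fin 2) ℚ := QuaternionAlgebra.lift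
    { i := !![0, a; 1, 0]
      j := !![c, -(a * d); d, -c]
      k := !![a * d, -(a * c); c, -(a * d)]
      i_mul_i := by
        ext r s
        fin_cases r <;> fin_cases s <;> simp [Matrix.mul_apply, Fin.sum_univ_two]
      j_mul_j := by
        ext r s
        fin_cases r <;> fin_cases s <;> simp [Matrix.mul_apply, Fin.sum_univ_two, h] <;> ring
      i_mul_j := by
        ext r s
        fin_cases r <;> fin_cases s <;> simp [Matrix.mul_apply, Fin.sum_univ_two]
      j_mul_i := by
        ext r s
        fin_cases r <;> fin_cases s <;> simp [Matrix.mul_apply, Fin.sum_univ_two] <;> ring }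
    with hf
  have hinj : Function.Injective f := by
    rw [injective_iff_map_eq_zero]
    intro x hx
    have e00 := congrFun (congrFun hx 0) 0
    have e01 := congrFun (congrFun hx 0) 1
    have e10 := congrFun (congrFun hx 1) 0
    have e11 := congrFun (congrFun hx 1) 1
    simp [hf, QuaternionAlgebra.Basis.lift, Matrix.algebraMap_matrix_apply] at e00 e01 e10 e11
    have h01 : x.imI - x.imJ * d - x.imK * c = 0 := by
      apply mul_left_cancel₀ ha
      linear_combination e01
    have hA : x.imJ * c + x.imK * (a * d) = 0 := by linear_combination (e00 - e11) / 2
    have hB : x.imJ * d + x.imK * c = 0 := by linear_combination (e10 - h01) / 2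
    have hJ : x.imJ = 0 := by
      apply mul_left_cancel₀ hb
      linear_combination c * hA - a * d * hB + x.imJ * h
    have hK : x.imK = 0 := by
      apply mul_left_cancel₀ hb
      linear_combination c * hB - d * hA + x.imK * h
    have hR : x.re = 0 := by linear_combination (e00 + e11) / 2
    have hI : x.imI = 0 := by linear_combination (e10 + h01) / 2
    exact QuaternionAlgebra.ext hR hI hJ hK
  have hfin : Module.finrank ℚ ℍ[ℚ,a,b] = Module.finrank ℚ (Matrix (Fin 2) (Fin 2) ℚ) := by
    rw [QuaternionAlgebra.finrank_eq_four, Module.finrank_matrix]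
    simp
  have hsurj : Function.Surjective f :=
    (LinearMap.injective_iff_surjective_of_finrank_eq_finrank (f := f.toLinearMap) hfin).1 hinj
  exact ⟨AlgEquiv.ofBijective f ⟨hinj, hsurj⟩⟩

theorem isSplit_of_redNorm_eq_zero (ha : a ≠ 0) (hb : b ≠ 0) {z : ℍ[ℚ,a,b]} (hz : z ≠ 0)
    (h : redNorm z = 0) : IsSplit a b := by
  rw [redNorm_eq] at h
  by_cases hden : z.imJ ^ 2 - a * z.imK ^ 2 = 0
  · have hnum : z.re ^ 2 - a * z.imI ^ 2 = 0 := by linear_combination h + b * hden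
    obtain ⟨s, hs⟩ : ∃ s : ℚ, a = s ^ 2 := by
      by_cases hK : z.imK = 0
      · have hJ : z.imJ = 0 := by simpa [hK] using hden
        have hI : z.imI ≠ 0 := by
          intro hI
          have hR : z.re = 0 := by simpa [hI] using hnum
          exact hz (QuaternionAlgebra.ext hR hI hJ hK)
        refine ⟨z.re / z.imI, ?_⟩
        field_simp
        linear_combination -hnum
      · refine ⟨z.imJ / z.imK, ?_⟩
        field_simp
        linear_combination -hden
    have hs0 : s ≠ 0 := by rintro rfl; simp at hs; exact ha hs
    -- `b = (c - s d) (c + s d)` with `c - s d = 1`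
    refine isSplit_of_eq_norm ha hb (c := (b + 1) / 2) (d := (b - 1) / (2 * s)) ?_
    rw [hs]
    field_simp
    ring
  · -- `b` is the quotient of the norms of `re + imI √a` and `imJ + imK √a`
    refine isSplit_of_eq_norm ha hb
      (c := (z.re * z.imJ - a * z.imI * z.imK) / (z.imJ ^ 2 - a * z.imK ^ 2))
      (d := (z.imI * z.imJ - z.re * z.imK) / (z.imJ ^ 2 - a * z.imK ^ 2)) ?_
    rw [div_pow, div_pow, mul_div_assoc', ← sub_div, eq_div_iff (pow_ne_zero 2 hden)]
    linear_combination (-(z.imJ ^ 2 - a * z.imK ^ 2)) * h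

/-- In a division algebra the plane spanned by `x` and `y` is degenerate only if `y = ± x`. -/
theorem exists_ncard_latticeSet_le_of_not_isSplit {ε : ℝ} (hε : 0 < ε) :
    ∃ C : ℝ, 1 ≤ C ∧ ∀ (a b : ℚ), a ≠ 0 → b ≠ 0 →
      ∀ (R : Subring ℍ[ℚ,a,b]) (N : ℕ), IsEichler R → HasLevel R N → Squarefree N →
      ∀ ℓ : ℕ, ℓ ∣ redDisc a b * N → ∀ i j : QuatExt a b ℝ, IsFrame i j →
      ∀ (g : (QuatExt a b ℝ)ˣ) (δ T : ℝ), 0 < δ → 0 < T →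
      ∀ n : ℚ, (∃ m : ℤ, n = (m : ℚ) / (ℓ : ℚ)) → ¬ IsSplit a b →
        (latticeSet R ℓ i j g δ T n).Finite ∧
        ((latticeSet R ℓ i j g δ T n).ncard : ℝ) ≤
          C * ((redDisc a b : ℝ) * (N : ℝ) * (1 + T)) ^ ε *
            (1 + (ℓ : ℝ) ^ 2 / ((redDisc a b : ℝ) * (N : ℝ)) * δ * T ^ 2) := by
  obtain ⟨C, hC, hmain⟩ := exists_ncard_nondegenerate_le hε
  refine ⟨C + 2, by linarith, ?_⟩
  intro a b ha hb R N hR hN hsq ℓ hℓ i j hij g δ T hδ hT n hn hns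
  have haniso : ∀ z : ℍ[ℚ,a,b], redNorm z = 0 → z = 0 := fun z hz => by
    by_contra hz0
    exact hns (isSplit_of_redNorm_eq_zero ha hb hz0 hz)
  have hd0 : redDisc a b ≠ 0 := (squarefree_redDisc a b).ne_zero
  have hN0 : N ≠ 0 := hN.1.ne'
  have hD1 : (1 : ℝ) ≤ (redDisc a b : ℝ) * N := by
    exact_mod_cast Nat.one_le_iff_ne_zero.2 (mul_ne_zero hd0 hN0)
  have hW : (1 : ℝ) ≤ ((redDisc a b : ℝ) * (N : ℝ) * (1 + T)) ^ ε := by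
    apply Real.one_le_rpow _ hε.le
    nlinarith
  set W := ((redDisc a b : ℝ) * (N : ℝ) * (1 + T)) ^ ε
  have hV : 0 ≤ (ℓ : ℝ) ^ 2 / ((redDisc a b : ℝ) * (N : ℝ)) * δ * T ^ 2 := by positivity
  set V := (ℓ : ℝ) ^ 2 / ((redDisc a b : ℝ) * (N : ℝ)) * δ * T ^ 2
  have hWV : 1 ≤ W * (1 + V) := by nlinarith
  set S := latticeSet R ℓ i j g δ T n with hS
  rcases S.eq_empty_or_nonempty with h | ⟨x, hx⟩
  · rw [h]
    simp only [Set.finite_empty, Set.ncard_empty, Nat.cast_zero, true_and]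
    positivity
  rcases eq_or_ne n 0 with hn0 | hn0
  · have hsub : S ⊆ {0} := fun y hy => haniso y (hy.2.2.1.trans hn0)
    refine ⟨(Set.finite_singleton _).subset hsub, ?_⟩
    have h1 : (S.ncard : ℝ) ≤ 1 := by
      exact_mod_cast (Set.ncard_le_ncard hsub).trans (Set.ncard_singleton _).le
    nlinarith
  · obtain ⟨hfin, hcard⟩ := hmain a b ha hb R N hR hN hsq ℓ hℓ i j hij g δ T hδ hT n hn hn0 x hx
    rw [← hS] at hfin hcard
    set S' := {y ∈ S | 4 * n ^ 2 - bil x y ^ 2 ≠ 0}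
    have hsub : S ⊆ S' ∪ {x, -x} := by
      intro y hy
      by_cases h : 4 * n ^ 2 - bil x y ^ 2 = 0
      · right
        have h2 : (bil x y - 2 * n) * (bil x y + 2 * n) = 0 := by linear_combination -h
        rcases mul_eq_zero.1 h2 with h3 | h3
        · left
          have : redNorm (x - y) = 0 := by
            rw [redNorm_sub, hx.2.2.1, hy.2.2.1]; linear_combination -h3
          exact (sub_eq_zero.1 (haniso _ this)).symm
        · right
          have : redNorm (x + y) = 0 := by
            rw [redNorm_add, hx.2.2.1, hy.2.2.1]; linear_combination h3
          exact eq_neg_of_add_eq_zero_right (haniso _ this)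
      · exact Or.inl ⟨hy, h⟩
    have hfin2 : (S' ∪ {x, -x}).Finite := hfin.union (Set.toFinite _)
    refine ⟨hfin2.subset hsub, ?_⟩
    have h1 : S.ncard ≤ S'.ncard + 2 :=
      (Set.ncard_le_ncard hsub hfin2).trans ((Set.ncard_union_le _ _).trans
        (Nat.add_le_add_left ((Set.ncard_insert_le _ _).trans
          (by rw [Set.ncard_singleton])) _))
    calc (S.ncard : ℝ) ≤ S'.ncard + 2 := by exact_mod_cast h1
      _ ≤ C * W * (1 + V) + 2 * (W * (1 + V)) := by linarith
      _ = _ := by ring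

end NonSplit

/-! ### Heights and nilpotent matrices -/

section Height

/-- The real matrices underlying `standardOrder N`. -/
def realOrder (N : ℕ) : Set (Matrix (Fin 2) (Fin 2) ℝ) :=
  {M | ∃ x y z w : ℤ, M = !![(x : ℝ), (y : ℝ); (N : ℝ) * (z : ℝ), (w : ℝ)]}

theorem IsAtkinLehner.normalizes {N : ℕ} {γ : GL (Fin 2) ℝ} (h : IsAtkinLehner N γ) :
    (∀ X ∈ realOrder N, ∃ Y ∈ realOrder N,
      (γ : Matrix (Fin 2) (Fin 2) ℝ) * X = Y * (γ : Matrix (Fin 2) (Fin 2) ℝ)) ∧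
    ∀ X ∈ realOrder N, ∃ Y ∈ realOrder N,
      X * (γ : Matrix (Fin 2) (Fin 2) ℝ) = (γ : Matrix (Fin 2) (Fin 2) ℝ) * Y := by
  obtain ⟨Q, M, hQ, rfl, -, x, y, z, w, hγ, hdet⟩ := h
  rw [hγ, Matrix.det_fin_two_of] at hdet
  have hQ0 : (Q : ℝ) ≠ 0 := by exact_mod_cast hQ.ne'
  have hd : (Q : ℝ) * x * w - M * z * y = 1 := by
    apply mul_left_cancel₀ hQ0
    push_cast at hdet
    linear_combination hdet
  rw [hγ]
  push_cast
  -- both conjugates are computed with `(Q w, -y; -N z, Q x) / Q`, the inverse of `γ`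
  constructor
  · rintro X ⟨s, t, u, v, rfl⟩
    refine ⟨_, ⟨(Q * x * s + y * (Q * M) * u) * w - (Q * x * t + y * v) * (M * z),
      -(x * y * s) - y ^ 2 * M * u + Q * x ^ 2 * t + x * y * v,
      z * s * w + Q * w ^ 2 * u - M * z ^ 2 * t - w * v * z,
      -(M * z * s * y) - w * (Q * M) * u * y + Q * M * z * t * x + Q * w * v * x, rfl⟩, ?_⟩
    ext r c
    fin_cases r <;> fin_cases c <;> simp [Matrix.mul_apply, Fin.sum_univ_two]
    · linear_combination (-(Q * x * s + y * Q * M * u : ℝ)) * hd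
    · linear_combination (-(Q * x * t + y * v : ℝ)) * hd
    · linear_combination (-(Q * M * (z * s + Q * w * u) : ℝ)) * hd
    · linear_combination (-(Q * M * z * t + Q * w * v : ℝ)) * hd
  · rintro X ⟨s, t, u, v, rfl⟩
    refine ⟨_, ⟨w * (s * Q * x + t * Q * M * z) - y * (u * M * Q * x + v * M * z),
      w * (s * y + t * Q * w) - y * (u * M * y + v * w),
      -z * (s * x + t * M * z) + x * (u * Q * x + v * z),
      -M * z * (s * y + t * Q * w) + x * (u * Q * M * y + v * Q * w), rfl⟩, ?_⟩
    ext r c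
    fin_cases r <;> fin_cases c <;> simp [Matrix.mul_apply, Fin.sum_univ_two]
    · linear_combination (-(s * Q * x + t * Q * M * z : ℝ)) * hd
    · linear_combination (-(s * y + t * Q * w : ℝ)) * hd
    · linear_combination (-(Q * M * (u * Q * x + v * z) : ℝ)) * hd
    · linear_combination (-(u * Q * M * y + v * Q * w : ℝ)) * hd

/-- The elements of `Γ₀(N)` are Atkin--Lehner operators, for the divisor `1`. -/
theorem isAtkinLehner_of_mem_Gamma0 {N : ℕ} {γ : GL (Fin 2) ℝ}
    (h : γ ∈ (CongruenceSubgroup.Gamma0 N).map (Matrix.SpecialLinearGroup.mapGL ℝ)) :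
    IsAtkinLehner N γ := by
  obtain ⟨A, hA, rfl⟩ := h
  have h10 : ((A 1 0 : ℤ) : ZMod N) = 0 := CongruenceSubgroup.Gamma0_mem.1 hA
  obtain ⟨z, hz⟩ := (ZMod.intCast_zmod_eq_zero_iff_dvd _ N).1 h10
  refine ⟨1, N, one_pos, (one_mul N).symm, Nat.coprime_one_left N, A 0 0, A 0 1, z, A 1 1, ?_, ?_⟩
  · ext r c
    fin_cases r <;> fin_cases c <;> simp [hz]
  · have h1 := A.det_coe
    rw [Matrix.det_fin_two] at h1
    rw [Matrix.det_fin_two]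
    simp
    exact_mod_cast h1

/-- `A₀(N)` normalizes the standard order of level `N`. -/
theorem normalizes_of_mem_atkinLehnerGroup {N : ℕ} {γ : GL (Fin 2) ℝ}
    (h : γ ∈ atkinLehnerGroup N) :
    (∀ X ∈ realOrder N, ∃ Y ∈ realOrder N,
      (γ : Matrix (Fin 2) (Fin 2) ℝ) * X = Y * (γ : Matrix (Fin 2) (Fin 2) ℝ)) ∧
    ∀ X ∈ realOrder N, ∃ Y ∈ realOrder N,
      X * (γ : Matrix (Fin 2) (Fin 2) ℝ) = (γ : Matrix (Fin 2) (Fin 2) ℝ) * Y := by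
  induction h using Subgroup.closure_induction with
  | mem x hx =>
    rcases hx with hx | hx
    · exact (isAtkinLehner_of_mem_Gamma0 hx).normalizes
    · exact IsAtkinLehner.normalizes hx
  | one => exact ⟨fun X hX => ⟨X, hX, by simp⟩, fun X hX => ⟨X, hX, by simp⟩⟩
  | mul x y _ _ hx hy =>
    constructor
    · intro X hX
      obtain ⟨Y, hY, e⟩ := hy.1 X hX
      obtain ⟨Z, hZ, e'⟩ := hx.1 Y hY
      exact ⟨Z, hZ, by rw [Units.val_mul, mul_assoc, e, ← mul_assoc, e', mul_assoc]⟩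
    · intro X hX
      obtain ⟨Y, hY, e⟩ := hx.2 X hX
      obtain ⟨Z, hZ, e'⟩ := hy.2 Y hY
      exact ⟨Z, hZ, by rw [Units.val_mul, ← mul_assoc, e, mul_assoc, e', mul_assoc]⟩
  | inv x _ hx =>
    constructor
    · intro X hX
      obtain ⟨Y, hY, e⟩ := hx.2 X hX
      refine ⟨Y, hY, ?_⟩
      rw [Units.inv_mul_eq_iff_eq_mul, ← mul_assoc, ← e, mul_assoc, Units.mul_inv, mul_one]
    · intro X hX
      obtain ⟨Y, hY, e⟩ := hx.1 X hX
      refine ⟨Y, hY, ?_⟩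
      rw [Units.eq_inv_mul_iff_mul_eq, ← mul_assoc, e, mul_assoc, Units.mul_inv, mul_one]

/-- The imaginary parts `Im (γ z)`, `γ ∈ A₀(N)`, are bounded, so that their supremum is
meaningful. -/
theorem bddAbove_height {N : ℕ} (hN : 0 < N) (z : UpperHalfPlane) :
    BddAbove (Set.range fun γ : atkinLehnerGroup N => ((γ : GL (Fin 2) ℝ) • z).im) := by
  refine ⟨z.im + 1 / z.im, ?_⟩
  rintro _ ⟨⟨γ, hγ⟩, rfl⟩
  have hz := z.im_pos
  have hN1 : (1 : ℝ) ≤ N := by exact_mod_cast hN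
  simp only
  rw [UpperHalfPlane.im_smul_eq_div_normSq]
  have hdet : (γ : Matrix (Fin 2) (Fin 2) ℝ).det ≠ 0 := γ.det.ne_zero
  have hdetv : γ.det.val = (γ : Matrix (Fin 2) (Fin 2) ℝ).det := rfl
  rw [hdetv]
  obtain ⟨h1, -⟩ := normalizes_of_mem_atkinLehnerGroup hγ
  obtain ⟨_, ⟨s, t, u, v, rfl⟩, e⟩ := h1 !![0, 1; 0, 0] ⟨0, 1, 0, 0, by simp⟩
  obtain ⟨_, ⟨s', t', u', v', rfl⟩, e'⟩ := h1 !![0, 0; (N : ℝ), 0] ⟨0, 0, 1, 0, by simp⟩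
  have e0 := congrFun (congrFun e 1) 0
  have e1 := congrFun (congrFun e 1) 1
  have e0' := congrFun (congrFun e' 1) 0
  have e1' := congrFun (congrFun e' 1) 1
  simp [Matrix.mul_apply, Fin.sum_univ_two] at e0 e1 e0' e1'
  rw [Matrix.det_fin_two] at hdet ⊢
  set A := (γ : Matrix (Fin 2) (Fin 2) ℝ) 0 0
  set B := (γ : Matrix (Fin 2) (Fin 2) ℝ) 0 1
  set c := (γ : Matrix (Fin 2) (Fin 2) ℝ) 1 0 with hc
  set d := (γ : Matrix (Fin 2) (Fin 2) ℝ) 1 1 with hd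
  set Δ := A * d - B * c
  have hcc : c ^ 2 = -(N * u) * Δ := by linear_combination c * e1 - d * e0
  have hdd : d ^ 2 = u' * Δ := by
    have : (N : ℝ) * d ^ 2 = N * (u' * Δ) := by linear_combination d * e0' - c * e1'
    exact mul_left_cancel₀ (by positivity) this
  have hnorm : Complex.normSq (UpperHalfPlane.denom γ z) =
      (c * z.re + d) ^ 2 + (c * z.im) ^ 2 := by
    rw [UpperHalfPlane.denom, Complex.normSq_apply]
    simp [← hc, ← hd]
    ring
  rw [hnorm]
  have hΔ : 0 < |Δ| := abs_pos.2 hdet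
  by_cases hc0 : c = 0
  · have hu' : u' ≠ 0 := by
      rintro rfl
      have : d = 0 := by simpa using hdd
      exact hdet (by simp [Δ, hc0, this])
    have hu1 : (1 : ℝ) ≤ |(u' : ℝ)| := by exact_mod_cast Int.one_le_abs hu'
    have h2 : |Δ| ≤ d ^ 2 := by
      rw [← abs_of_nonneg (sq_nonneg d), hdd, abs_mul]
      nlinarith
    have hd2 : 0 < d ^ 2 := hΔ.trans_le h2
    have h3 : |Δ| * z.im / ((c * z.re + d) ^ 2 + (c * z.im) ^ 2) ≤ z.im := by
      rw [hc0, zero_mul, zero_mul, zero_add, div_le_iff₀ (by positivity)]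
      nlinarith
    linarith [one_div_pos.2 hz]
  · have hu : u ≠ 0 := by
      rintro rfl
      have : c = 0 := by simpa using hcc
      exact hc0 this
    have hu1 : (1 : ℝ) ≤ |(u : ℝ)| := by exact_mod_cast Int.one_le_abs hu
    have h2 : |Δ| ≤ c ^ 2 := by
      rw [← abs_of_nonneg (sq_nonneg c), hcc, abs_mul, abs_neg, abs_mul, Nat.abs_cast]
      nlinarith [mul_le_mul hN1 hu1 zero_le_one (by linarith)]
    have h3 : |Δ| * z.im / ((c * z.re + d) ^ 2 + (c * z.im) ^ 2) ≤ 1 / z.im := by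
      rw [div_le_div_iff₀ (by positivity) hz]
      nlinarith [sq_nonneg (c * z.re + d), mul_pos hz hz]
    linarith

theorem height_pos {N : ℕ} (hN : 0 < N) (z : UpperHalfPlane) : 0 < height N z := by
  have h1 : ((1 : GL (Fin 2) ℝ) • z).im ≤ height N z := le_ciSup (bddAbove_height hN z) 1
  rw [one_smul] at h1
  exact z.im_pos.trans_le h1

/-- The cusp `p / q` is sent to `∞` by an Atkin--Lehner operator: this bounds the distance of `w`
from the cusp in terms of the height of `w`. -/
theorem im_le_mul_height {N : ℕ} (hN : Squarefree N) {p q : ℤ} (hpq : IsCoprime p q)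
    (w : UpperHalfPlane) :
    ∃ Q M : ℕ, 0 < Q ∧ N = Q * M ∧ IsCoprime (Q : ℤ) q ∧
      w.im ≤ Q * Complex.normSq (q * w - p) * height N w := by
  set M : ℕ := Int.gcd q N with hM
  have hN0 : N ≠ 0 := hN.ne_zero
  have hMN : M ∣ N := by
    have := Int.gcd_dvd_right q (N : ℤ)
    exact_mod_cast this
  obtain ⟨Q, hQ⟩ := hMN
  rw [mul_comm] at hQ
  obtain ⟨z, hz⟩ : (M : ℤ) ∣ q := Int.gcd_dvd_left q N
  have hQ0 : 0 < Q := Nat.pos_of_ne_zero (by rintro rfl; simp at hQ; exact hN0 hQ)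
  have hM0 : 0 < M := Nat.pos_of_ne_zero (by intro h; rw [h] at hQ; simp at hQ; exact hN0 hQ)
  have hQM : Q.Coprime M := Nat.coprime_of_squarefree_mul (hQ ▸ hN)
  have hQq : IsCoprime (Q : ℤ) q := by
    rw [Int.isCoprime_iff_gcd_eq_one]
    have h1 : Int.gcd (Q : ℤ) q ∣ Q := by exact_mod_cast Int.gcd_dvd_left (Q : ℤ) q
    have h2 : Int.gcd (Q : ℤ) q ∣ M := by
      have h3 : ((Int.gcd (Q : ℤ) q : ℕ) : ℤ) ∣ N :=
        (Int.natCast_dvd_natCast.2 h1).trans (by rw [hQ]; push_cast; exact Dvd.intro _ rfl)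
      rw [hM]
      have := Int.dvd_coe_gcd (Int.gcd_dvd_right (Q : ℤ) q) h3
      exact_mod_cast this
    exact Nat.eq_one_of_dvd_coprimes hQM h1 h2
  have hcop : IsCoprime ((Q : ℤ) * p) q := hQq.mul_left hpq
  obtain ⟨x, y, hxy⟩ := hcop
  refine ⟨Q, M, hQ0, hQ, hQq, ?_⟩
  have hQr : (0 : ℝ) < Q := by exact_mod_cast hQ0
  have hxyr : (x : ℝ) * (Q * p) + y * q = 1 := by exact_mod_cast hxy
  have hqr : (q : ℝ) = M * z := by exact_mod_cast hz
  have hNr : (N : ℝ) = Q * M := by exact_mod_cast hQ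
  set m : Matrix (Fin 2) (Fin 2) ℝ := !![(Q : ℝ) * ((-x : ℤ) : ℝ), ((-y : ℤ) : ℝ);
    (N : ℝ) * (z : ℝ), (Q : ℝ) * ((-p : ℤ) : ℝ)] with hm
  have hdet : m.det = Q := by
    rw [hm, Matrix.det_fin_two_of, hNr]
    push_cast
    rw [hqr] at hxyr
    linear_combination (Q : ℝ) * hxyr
  set γ : GL (Fin 2) ℝ := Matrix.GeneralLinearGroup.mkOfDetNeZero m (by rw [hdet]; exact hQr.ne')
    with hγ
  have hγm : (γ : Matrix (Fin 2) (Fin 2) ℝ) = m := rfl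
  have hmem : γ ∈ atkinLehnerGroup N := Subgroup.subset_closure
    (Or.inr ⟨Q, M, hQ0, hQ, hQM, -x, -y, z, -p, by rw [hγm], by rw [hγm, hdet]⟩)
  have hle : (γ • w).im ≤ height N w :=
    le_ciSup (bddAbove_height (Nat.pos_of_ne_zero hN0) w) ⟨γ, hmem⟩
  rw [UpperHalfPlane.im_smul_eq_div_normSq] at hle
  have hd : γ.det.val = Q := hdet
  have hden : UpperHalfPlane.denom γ w = Q * (q * w - p) := by
    rw [UpperHalfPlane.denom, hγm, hm]
    have : (N : ℂ) * z = Q * q := by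
      have : (N : ℝ) * z = Q * q := by rw [hNr, hqr]; ring
      exact_mod_cast this
    simp [this]
    ring
  have hne : UpperHalfPlane.denom γ w ≠ 0 := UpperHalfPlane.denom_ne_zero γ w
  have hpos := Complex.normSq_pos.2 hne
  rw [hd, abs_of_pos hQr, div_le_iff₀ hpos, hden, Complex.normSq_mul, Complex.normSq_natCast] at hle
  have : (Q : ℝ) * w.im ≤ Q * (Q * Complex.normSq (q * w - p) * height N w) := by
    linarith
  exact le_of_mul_le_mul_left this hQr

/-- A nonzero nilpotent rational matrix is `lam • (p, q)ᵗ (q, -p)` with `p`, `q` coprime. -/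
theorem exists_nilpotent_eq {α β κ : ℚ} (h : α ^ 2 + β * κ = 0) (hne : ¬ (β = 0 ∧ κ = 0)) :
    ∃ (p q : ℤ) (lam : ℚ), IsCoprime p q ∧ lam ≠ 0 ∧ α = lam * (p * q) ∧ β = -lam * p ^ 2 ∧
      κ = lam * q ^ 2 := by
  by_cases hκ : κ = 0
  · have hα : α = 0 := by simpa [hκ] using h
    have hβ : β ≠ 0 := fun hβ => hne ⟨hβ, hκ⟩
    exact ⟨1, 0, -β, isCoprime_one_left, neg_ne_zero.2 hβ, by simp [hα], by simp, by simp [hκ]⟩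
  · have hd : ((α / κ).den : ℚ) ≠ 0 := by exact_mod_cast (α / κ).den_ne_zero
    have hr : ((α / κ).num : ℚ) = α / κ * (α / κ).den := by
      rw [eq_comm]; exact Rat.mul_den_eq_num _
    refine ⟨(α / κ).num, (α / κ).den, κ / (α / κ).den ^ 2, ?_, ?_, ?_, ?_, ?_⟩
    · rw [Int.isCoprime_iff_gcd_eq_one]
      exact (α / κ).reduced
    · exact div_ne_zero hκ (pow_ne_zero 2 hd)
    · rw [hr]; push_cast; field_simp
    · rw [hr]; field_simp; linear_combination h
    · push_cast; field_simp

/-- Nilpotent elements of the lattice cannot be small: their conjugates by `G` have size at least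
`1 / (ℓ H)`. -/
theorem one_le_height_mul {N ℓ : ℕ} (hN : Squarefree N) (G : GL (Fin 2) ℝ) {α β κ : ℚ}
    (h : α ^ 2 + β * κ = 0) (hne : ¬ (β = 0 ∧ κ = 0)) (hℓ : ℓ ≠ 0)
    (hβ : ∃ k : ℤ, (k : ℚ) = ℓ * β) (hκ : ∃ k : ℤ, (N : ℚ) * k = ℓ * κ)
    {X : Matrix (Fin 2) (Fin 2) ℝ}
    (hX : (G : Matrix (Fin 2) (Fin 2) ℝ) * X =
      !![(α : ℝ), (β : ℝ); (κ : ℝ), -(α : ℝ)] * (G : Matrix (Fin 2) (Fin 2) ℝ)) :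
    1 ≤ ℓ * height N (G • UpperHalfPlane.I) * |X 1 0 - X 0 1| := by
  obtain ⟨p, q, lam, hpq, hlam, rfl, rfl, rfl⟩ := exists_nilpotent_eq h hne
  obtain ⟨Q, M, hQ, hNQ, hQq, him⟩ := im_le_mul_height hN hpq (G • UpperHalfPlane.I)
  have hH := height_pos (Nat.pos_of_ne_zero hN.ne_zero) (G • UpperHalfPlane.I)
  set H := height N (G • UpperHalfPlane.I)
  -- `μ = ℓ lam` is an integer divisible by `Q`
  obtain ⟨k, hk⟩ := hβ
  obtain ⟨m, hm⟩ := hκ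
  obtain ⟨u, v, huv⟩ := hpq.pow (m := 2) (n := 2)
  have huvq : (u : ℚ) * p ^ 2 + v * q ^ 2 = 1 := by exact_mod_cast huv
  set μ : ℤ := -u * k + v * (N * m) with hμ
  have hμq : (μ : ℚ) = ℓ * lam := by
    rw [hμ]; push_cast; rw [hk, hm]; linear_combination (ℓ * lam) * huvq
  have hμ0 : μ ≠ 0 := by
    intro h0
    rw [h0, Int.cast_zero, eq_comm, mul_eq_zero] at hμq
    rcases hμq with h1 | h1
    · exact hℓ (by exact_mod_cast h1)
    · exact hlam h1
  have hQμ : (Q : ℤ) ∣ μ := by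
    have h1 : μ * q ^ 2 = Q * (M * m) := by
      have : (μ : ℚ) * q ^ 2 = Q * (M * m) := by
        rw [hμq]
        have : (N : ℚ) = Q * M := by exact_mod_cast hNQ
        rw [this] at hm
        linear_combination -hm
      exact_mod_cast this
    exact (hQq.pow_right (n := 2)).dvd_of_dvd_mul_right (Dvd.intro _ h1.symm)
  have hQlam : (Q : ℝ) ≤ ℓ * |(lam : ℝ)| := by
    have h1 : (Q : ℤ) ≤ |μ| := Int.le_of_dvd (abs_pos.2 hμ0) ((dvd_abs _ _).2 hQμ)
    have h2 : (Q : ℝ) ≤ |(μ : ℝ)| := by exact_mod_cast h1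
    have h3 : (μ : ℝ) = ℓ * lam := by exact_mod_cast congrArg (Rat.cast : ℚ → ℝ) hμq
    rwa [h3, abs_mul, Nat.abs_cast] at h2
  set A := (G : Matrix (Fin 2) (Fin 2) ℝ) 0 0 with hA
  set B := (G : Matrix (Fin 2) (Fin 2) ℝ) 0 1 with hB
  set C := (G : Matrix (Fin 2) (Fin 2) ℝ) 1 0 with hC
  set D := (G : Matrix (Fin 2) (Fin 2) ℝ) 1 1 with hD
  have hdet : (G : Matrix (Fin 2) (Fin 2) ℝ).det ≠ 0 := G.det.ne_zero
  have hdetv : G.det.val = (G : Matrix (Fin 2) (Fin 2) ℝ).det := rfl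
  rw [Matrix.det_fin_two] at hdet
  set Δ := A * D - B * C with hΔ
  set P := A * q - C * p
  set S := B * q - D * p
  have e00 := congrFun (congrFun hX 0) 0
  have e01 := congrFun (congrFun hX 0) 1
  have e10 := congrFun (congrFun hX 1) 0
  have e11 := congrFun (congrFun hX 1) 1
  simp [Matrix.mul_apply, Fin.sum_univ_two, ← hA, ← hB, ← hC, ← hD] at e00 e01 e10 e11
  have hXdiff : Δ * (X 1 0 - X 0 1) = lam * (P ^ 2 + S ^ 2) := by
    simp only [hΔ, P, S]
    linear_combination A * e10 - C * e00 - D * e01 + B * e11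
  -- the distance of `G • i` from the cusp `p / q`
  have hnormpos := Complex.normSq_pos.2 (UpperHalfPlane.denom_ne_zero G UpperHalfPlane.I)
  have hIm : (G • UpperHalfPlane.I).im =
      |Δ| / Complex.normSq (UpperHalfPlane.denom G UpperHalfPlane.I) := by
    rw [UpperHalfPlane.im_smul_eq_div_normSq, hdetv, Matrix.det_fin_two]
    simp [hΔ, hA, hB, hC, hD]
  have hdist : Complex.normSq (q * ((G • UpperHalfPlane.I : UpperHalfPlane) : ℂ) - p) =
      (P ^ 2 + S ^ 2) / Complex.normSq (UpperHalfPlane.denom G UpperHalfPlane.I) := by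
    rw [UpperHalfPlane.coe_smul]
    have hconj : ∀ c : ℂ, Complex.normSq (q * UpperHalfPlane.σ G c - p) =
        Complex.normSq (q * c - p) := by
      intro c
      unfold UpperHalfPlane.σ
      split_ifs
      · rfl
      · rw [← Complex.normSq_conj (q * c - p)]
        simp
    rw [hconj]
    have hden := UpperHalfPlane.denom_ne_zero G UpperHalfPlane.I
    have : (q : ℂ) * (UpperHalfPlane.num G UpperHalfPlane.I /
        UpperHalfPlane.denom G UpperHalfPlane.I) - p =
          (P * Complex.I + S) / UpperHalfPlane.denom G UpperHalfPlane.I := by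
      rw [eq_div_iff hden, sub_mul, mul_assoc, div_mul_cancel₀ _ hden, UpperHalfPlane.num,
        UpperHalfPlane.denom]
      simp [P, S, ← hA, ← hB, ← hC, ← hD]
      ring
    rw [this, Complex.normSq_div]
    congr 1
    rw [Complex.normSq_apply]
    simp
    ring
  rw [hIm, hdist, div_le_iff₀ hnormpos] at him
  have him' : |Δ| ≤ Q * (P ^ 2 + S ^ 2) * H := by
    calc |Δ| ≤ _ := him
      _ = _ := by field_simp
  have habs : |Δ| * |X 1 0 - X 0 1| = |(lam : ℝ)| * (P ^ 2 + S ^ 2) := by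
    rw [← abs_mul, hXdiff, abs_mul, abs_of_nonneg (by positivity : 0 ≤ P ^ 2 + S ^ 2)]
  have hΔ0 : 0 < |Δ| := abs_pos.2 hdet
  refine le_of_mul_le_mul_left ?_ hΔ0
  calc |Δ| * 1 ≤ Q * (P ^ 2 + S ^ 2) * H := by rwa [mul_one]
    _ ≤ ℓ * |(lam : ℝ)| * (P ^ 2 + S ^ 2) * H := by gcongr
    _ = |Δ| * (ℓ * H * |X 1 0 - X 0 1|) := by linear_combination (-ℓ * H : ℝ) * habs

end Height

/-! ### The lattice in the split case -/

section Split

variable {a b : ℚ} {e : ℍ[ℚ,a,b] ≃ₐ[ℚ] Matrix (Fin 2) (Fin 2) ℚ}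

/-- A split algebra is unramified everywhere: it contains a nilpotent element. -/
theorem redDisc_eq_one_of_algEquiv (e : ℍ[ℚ,a,b] ≃ₐ[ℚ] Matrix (Fin 2) (Fin 2) ℚ) :
    redDisc a b = 1 := by
  rw [Nat.eq_one_iff_not_exists_prime_dvd]
  intro p hp hpd
  have hram := ramifiedAt_of_dvd_redDisc (p := ⟨p, hp⟩) hpd
  set z := e.symm !![0, 1; 0, 0] with hz
  have hez : e z = !![0, 1; 0, 0] := e.apply_symm_apply _
  have hz0 : z ≠ 0 := by
    intro h
    have := congrFun (congrFun (hez.symm.trans ((congrArg e h).trans (map_zero e))) 0) 1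
    simp at this
  have hzz : z * z = 0 := by
    apply e.injective
    rw [map_mul, hez, map_zero]
    ext r s
    fin_cases r <;> fin_cases s <;> simp [Matrix.mul_apply, Fin.sum_univ_two]
  have : Fact p.Prime := ⟨hp⟩
  have hext0 : toExt ℚ_[p] (0 : ℍ[ℚ,a,b]) = 0 := by ext <;> simp [toExt]
  have hu := hram (toExt ℚ_[p] z) (fun h => hz0 (toExt_injective (h.trans hext0.symm)))
  have h2 : toExt ℚ_[p] z * toExt ℚ_[p] z = 0 := by rw [← toExt_mul, hzz, hext0]
  exact hz0 (toExt_injective ((hu.mul_right_eq_zero.1 h2).trans hext0.symm))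

variable (e) in
/-- The condition on the off-diagonal entries that is satisfied by the elements of `R(ℓ)`. -/
def HasEntries (N ℓ : ℕ) (y : ℍ[ℚ,a,b]) : Prop :=
  (∃ k : ℤ, (k : ℚ) = ℓ * e y 0 1) ∧ ∃ k : ℤ, (N : ℚ) * k = ℓ * e y 1 0

theorem HasEntries.add {N ℓ : ℕ} {x y : ℍ[ℚ,a,b]} (hx : HasEntries e N ℓ x)
    (hy : HasEntries e N ℓ y) : HasEntries e N ℓ (x + y) := by
  obtain ⟨⟨k, hk⟩, m, hm⟩ := hx
  obtain ⟨⟨k', hk'⟩, m', hm'⟩ := hy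
  refine ⟨⟨k + k', ?_⟩, m + m', ?_⟩
  · push_cast
    rw [hk, hk', map_add, Matrix.add_apply]
    ring
  · push_cast
    rw [map_add, Matrix.add_apply]
    linear_combination hm + hm'

theorem HasEntries.sub {N ℓ : ℕ} {x y : ℍ[ℚ,a,b]} (hx : HasEntries e N ℓ x)
    (hy : HasEntries e N ℓ y) : HasEntries e N ℓ (x - y) := by
  obtain ⟨⟨k, hk⟩, m, hm⟩ := hx
  obtain ⟨⟨k', hk'⟩, m', hm'⟩ := hy
  refine ⟨⟨k - k', ?_⟩, m - m', ?_⟩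
  · push_cast
    rw [hk, hk', map_sub, Matrix.sub_apply]
    ring
  · push_cast
    rw [map_sub, Matrix.sub_apply]
    linear_combination hm - hm'

/-- A linear functional `tr (· c̄)` that is integral on `R` and on `N c ∈ R` is integral on `ℓ γ`
for `γ` in `R(ℓ)`. -/
theorem mul_bil_int_of_partialDual {R : Subring ℍ[ℚ,a,b]} {N ℓ : ℕ} (hN : Squarefree N)
    {c : ℍ[ℚ,a,b]} (hc : ∀ r ∈ R, ∃ k : ℤ, (k : ℚ) = bil r c) (hNc : (N : ℚ) • c ∈ R)
    {γ : ℍ[ℚ,a,b]} (hγ : γ ∈ partialDual R ℓ) : ∃ k : ℤ, (k : ℚ) = ℓ * bil γ c := by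
  apply exists_intCast_of_padic
  intro p
  rw [Rat.cast_mul, norm_mul, Rat.cast_natCast]
  by_cases hp : (p : ℕ) ∣ ℓ
  · have h1 := (hγ p).1 hp _ (Submodule.subset_span ⟨_, hNc, rfl⟩)
    change ‖bil _ _‖ ≤ 1 at h1
    rw [bil_toExt, bil_smul_right, Rat.cast_mul, norm_mul, Rat.cast_natCast] at h1
    refine le_trans ?_ h1
    gcongr
    -- `p` divides `ℓ`, and divides `N` at most once
    obtain ⟨m, rfl⟩ := hp
    have h2 : ‖((p * m : ℕ) : ℚ_[p])‖ ≤ ((p : ℕ) : ℝ)⁻¹ := by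
      rw [Nat.cast_mul, norm_mul, Padic.norm_p]
      exact mul_le_of_le_one_right (by positivity) (norm_natCast_le_one m)
    by_cases hpN : (p : ℕ) ∣ N
    · rw [norm_natCast_of_squarefree hN hpN]
      exact h2
    · rw [Padic.norm_natCast_eq_one_iff.2 ((Nat.Prime.coprime_iff_not_dvd p.2).2 hpN)]
      exact norm_natCast_le_one _
  · have h1 : ∀ x ∈ localOrder R p, ‖bil x (toExt ℚ_[p] c)‖ ≤ 1 := by
      intro x hx
      have hs : ∀ (c : ℤ_[p]) (z : QuatExt a b ℚ_[p]), c • z = (c : ℚ_[p]) • z := fun _ _ => rfl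
      induction hx using Submodule.span_induction with
      | mem x hx =>
        obtain ⟨x, hx, rfl⟩ := hx
        rw [bil_toExt]
        exact norm_intCast_rat_le_one (hc x hx)
      | zero => simp [bil_eq]
      | add y z _ _ hy hz =>
        rw [bil_add_left]
        exact (Padic.nonarchimedean _ _).trans (max_le hy hz)
      | smul c y _ hy =>
        rw [hs, bil_smul_left, norm_mul]
        exact mul_le_one₀ c.2 (norm_nonneg _) hy
    have h2 := h1 _ ((hγ p).2 hp)
    rw [bil_toExt] at h2
    exact mul_le_one₀ (norm_natCast_le_one _) (norm_nonneg _) h2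

theorem hasEntries_of_partialDual {R : Subring ℍ[ℚ,a,b]} {N ℓ : ℕ} (hN : Squarefree N)
    (hR : ∀ x, x ∈ R ↔ e x ∈ standardOrder N) {γ : ℍ[ℚ,a,b]} (hγ : γ ∈ partialDual R ℓ) :
    HasEntries e N ℓ γ := by
  have hN0 : (N : ℚ) ≠ 0 := by exact_mod_cast hN.ne_zero
  constructor
  · obtain ⟨k, hk⟩ := mul_bil_int_of_partialDual hN (c := e.symm !![0, 0; 1, 0]) (ℓ := ℓ) (R := R)
      (fun r hr => by
        obtain ⟨x, y, z, w, h⟩ := (hR r).1 hr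
        refine ⟨-y, ?_⟩
        rw [bil_eq_entries' e, h, e.apply_symm_apply]
        simp)
      ((hR _).2 ⟨0, 0, 1, 0, by rw [map_smul, e.apply_symm_apply]; simp⟩) hγ
    refine ⟨-k, ?_⟩
    rw [bil_eq_entries' e, e.apply_symm_apply] at hk
    push_cast
    rw [hk]
    simp
  · obtain ⟨k, hk⟩ := mul_bil_int_of_partialDual hN (c := e.symm !![0, (N : ℚ)⁻¹; 0, 0]) (ℓ := ℓ)
      (R := R) (fun r hr => by
        obtain ⟨x, y, z, w, h⟩ := (hR r).1 hr
        refine ⟨-z, ?_⟩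
        rw [bil_eq_entries' e, h, e.apply_symm_apply]
        simp
        field_simp)
      ((hR _).2 ⟨0, 1, 0, 0, by rw [map_smul, e.apply_symm_apply]; simp [hN0]⟩) hγ
    refine ⟨-k, ?_⟩
    rw [bil_eq_entries' e, e.apply_symm_apply] at hk
    push_cast
    rw [hk]
    simp
    field_simp

/-! ### Real coordinates in the split case -/

theorem trace_realExt (x : QuatExt a b ℝ) : (realExt e x).trace = redTrace x := by
  have hx : x = x.re • 1 + x.imI • toExt ℝ (⟨0, 1, 0, 0⟩ : ℍ[ℚ,a,b]) +
      x.imJ • toExt ℝ (⟨0, 0, 1, 0⟩ : ℍ[ℚ,a,b]) + x.imK • toExt ℝ (⟨0, 0, 0, 1⟩ : ℍ[ℚ,a,b]) := by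
    ext <;> simp [toExt]
  have h0 : ∀ y : ℍ[ℚ,a,b], y.re = 0 → (realExt e (toExt ℝ y)).trace = 0 := by
    intro y hy
    have h1 := trace_algEquiv e y
    rw [redTrace_eq, hy, mul_zero, Matrix.trace_fin_two] at h1
    rw [realExt_toExt, Matrix.trace_fin_two]
    simp
    exact_mod_cast h1
  conv_lhs => rw [hx]
  simp only [map_add, map_smul, map_one, Matrix.trace_add, Matrix.trace_smul, h0]
  simp [redTrace_eq]
  ring

variable (e) in
/-- The matrix of `g⁻¹ y g`. -/
noncomputable def coordMatrix (g : (QuatExt a b ℝ)ˣ) (y : ℍ[ℚ,a,b]) : Matrix (Fin 2) (Fin 2) ℝ :=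
  realExt e ((↑g⁻¹ : QuatExt a b ℝ) * toExt ℝ y * (g : QuatExt a b ℝ))

variable (e) in
/-- The coordinate of `g⁻¹ y g` along the compact torus, up to a factor `-2`. On nilpotent elements
it is comparable to any norm. -/
noncomputable def torusCoord (g : (QuatExt a b ℝ)ˣ) (y : ℍ[ℚ,a,b]) : ℝ :=
  coordMatrix e g y 1 0 - coordMatrix e g y 0 1

variable {g : (QuatExt a b ℝ)ˣ}

theorem coordMatrix_add (x y : ℍ[ℚ,a,b]) :
    coordMatrix e g (x + y) = coordMatrix e g x + coordMatrix e g y := by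
  rw [coordMatrix, toExt_add, mul_add, add_mul, map_add]
  rfl

theorem coordMatrix_sub (x y : ℍ[ℚ,a,b]) :
    coordMatrix e g (x - y) = coordMatrix e g x - coordMatrix e g y := by
  rw [coordMatrix, toExt_sub, mul_sub, sub_mul, map_sub]
  rfl

theorem torusCoord_sub (x y : ℍ[ℚ,a,b]) :
    torusCoord e g (x - y) = torusCoord e g x - torusCoord e g y := by
  simp only [torusCoord, coordMatrix_sub, Matrix.sub_apply]
  ring

theorem coordMatrix_11 {y : ℍ[ℚ,a,b]} (hy : redTrace y = 0) :
    coordMatrix e g y 1 1 = -coordMatrix e g y 0 0 := by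
  have h := trace_realExt (e := e) ((↑g⁻¹ : QuatExt a b ℝ) * toExt ℝ y * (g : QuatExt a b ℝ))
  rw [redTrace_conj, redTrace_toExt, hy, Matrix.trace_fin_two] at h
  simp only [Rat.cast_zero] at h
  exact eq_neg_of_add_eq_zero_right h

theorem bil_eq_coordMatrix {x y : ℍ[ℚ,a,b]} (hx : redTrace x = 0) (hy : redTrace y = 0) :
    ((bil x y : ℚ) : ℝ) = -(2 * (coordMatrix e g x 0 0 * coordMatrix e g y 0 0) +
      coordMatrix e g x 0 1 * coordMatrix e g y 1 0 +
      coordMatrix e g x 1 0 * coordMatrix e g y 0 1) := by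
  rw [← bil_toExt (K := ℝ) x y, ← bil_conj g, bil_eq_entries (realExt e) trace_realExt]
  change coordMatrix e g x 0 0 * coordMatrix e g y 1 1 +
    coordMatrix e g x 1 1 * coordMatrix e g y 0 0 - coordMatrix e g x 0 1 * coordMatrix e g y 1 0 -
    coordMatrix e g x 1 0 * coordMatrix e g y 0 1 = _
  rw [coordMatrix_11 hx, coordMatrix_11 hy]
  ring

theorem redNorm_eq_coordMatrix {x : ℍ[ℚ,a,b]} (hx : redTrace x = 0) :
    ((redNorm x : ℚ) : ℝ) =
      -(coordMatrix e g x 0 0 ^ 2 + coordMatrix e g x 0 1 * coordMatrix e g x 1 0) := by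
  have h := bil_eq_coordMatrix (e := e) (g := g) hx hx
  rw [bil_self] at h
  push_cast at h
  linear_combination h / 2

theorem IsFrame.realExt_j {i j : QuatExt a b ℝ} (h : IsFrame i j)
    (hi : realExt e i = !![0, 1; -1, 0]) :
    ∃ α β : ℝ, α ^ 2 + β ^ 2 = 1 ∧ realExt e j = !![α, β; β, -α] := by
  have h1 := congrArg (realExt e) h.anticomm
  rw [map_neg, map_mul, map_mul, hi] at h1
  have e00 := congrFun (congrFun h1 0) 0
  have e01 := congrFun (congrFun h1 0) 1
  simp [Matrix.mul_apply, Fin.sum_univ_two] at e00 e01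
  have hj : realExt e j = !![realExt e j 0 0, realExt e j 0 1; realExt e j 0 1,
      -realExt e j 0 0] := by
    ext r s
    fin_cases r <;> fin_cases s <;> simp [e00, e01]
  refine ⟨realExt e j 0 0, realExt e j 0 1, ?_, hj⟩
  set α := realExt e j 0 0
  set β := realExt e j 0 1
  rcases h.j_sq with h2 | h2
  · have h3 := congrFun (congrFun (congrArg (realExt e) h2) 0) 0
    rw [map_mul, hj, map_one] at h3
    simp at h3
    linarith
  · have h3 := congrFun (congrFun (congrArg (realExt e) h2) 0) 0
    rw [map_mul, hj, map_neg, map_one] at h3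
    simp at h3
    nlinarith [sq_nonneg α, sq_nonneg β]

theorem coordMatrix_of_mem_latticeSet {R : Subring ℍ[ℚ,a,b]} {ℓ : ℕ} {i j : QuatExt a b ℝ}
    (h : IsFrame i j) (hi : realExt e i = !![0, 1; -1, 0]) {δ T : ℝ} {n : ℚ} {y : ℍ[ℚ,a,b]}
    (hy : y ∈ latticeSet R ℓ i j g δ T n) :
    ∃ t p q : ℝ, coordMatrix e g y = !![p, q + t; q - t, -p] ∧ p ^ 2 + q ^ 2 ≤ δ * T ^ 2 := by
  obtain ⟨-, hyt, -, t, u, v, d, hyΩ, -, huv⟩ := hy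
  obtain ⟨α, β, hαβ, hj⟩ := h.realExt_j hi
  have h1 : coordMatrix e g y = !![u * α + v * β + d, u * β - v * α + t;
      u * β - v * α - t, -(u * α + v * β) + d] := by
    rw [coordMatrix, hyΩ]
    simp only [map_add, map_smul, map_mul, map_one, hi, hj]
    ext r s
    fin_cases r <;> fin_cases s <;> simp <;> ring
  have hd : d = 0 := by
    have h2 := coordMatrix_11 (e := e) (g := g) hyt
    rw [h1] at h2
    simp at h2
    linarith
  refine ⟨t, u * α + v * β, u * β - v * α, by rw [h1, hd]; simp, ?_⟩
  calc (u * α + v * β) ^ 2 + (u * β - v * α) ^ 2 = (u ^ 2 + v ^ 2) * (α ^ 2 + β ^ 2) := by ring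
    _ ≤ δ * T ^ 2 := by rw [hαβ, mul_one]; exact huv

theorem abs_torusCoord_le {z : ℍ[ℚ,a,b]} (hz : redTrace z = 0) (hn : redNorm z = 0) {t p q r : ℝ}
    (hr : 0 ≤ r) (h : coordMatrix e g z = !![p, q + t; q - t, -p]) (hpq : p ^ 2 + q ^ 2 ≤ r ^ 2) :
    |torusCoord e g z| ≤ 2 * r := by
  have h1 := redNorm_eq_coordMatrix (e := e) (g := g) hz
  rw [hn, h] at h1
  simp at h1
  have h2 : torusCoord e g z = -2 * t := by
    rw [torusCoord, h]
    simp
    ring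
  rw [h2, abs_mul, abs_neg, abs_two]
  gcongr
  apply abs_le_of_sq_le_sq _ hr
  linarith

end Split

/-! ### Counting nilpotent elements -/

section Nilpotent

/-- If `k² ∣ N A²` with `N` squarefree, then `k ∣ A`. -/
theorem dvd_of_sq_dvd_squarefree_mul_sq {N : ℕ} (hN : Squarefree N) {k A : ℤ}
    (h : k ^ 2 ∣ N * A ^ 2) : k ∣ A := by
  rcases eq_or_ne k 0 with rfl | hk
  · have : (N : ℤ) * A ^ 2 = 0 := by simpa using h
    rcases mul_eq_zero.1 this with h1 | h1
    · exact absurd (by exact_mod_cast h1) hN.ne_zero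
    · simpa using h1
  obtain ⟨m, k', A', hm, hcop, hk', hA'⟩ := Int.exists_gcd_one' (m := k) (n := A)
    (Int.gcd_pos_of_ne_zero_left _ hk)
  have hm0 : (m : ℤ) ≠ 0 := by exact_mod_cast hm.ne'
  have h1 : k' ^ 2 ∣ N := by
    have h2 : k' ^ 2 ∣ N * A' ^ 2 := by
      rw [hk', hA', mul_pow, mul_pow, ← mul_assoc] at h
      exact Int.dvd_of_mul_dvd_mul_right (pow_ne_zero 2 hm0) h
    exact (IsCoprime.pow (Int.isCoprime_iff_gcd_eq_one.2 hcop)).dvd_of_dvd_mul_right h2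
  have h3 : IsUnit k' := by
    have : Squarefree (N : ℤ) := Int.squarefree_natCast.2 hN
    exact this k' (by rwa [← sq])
  rw [hk', hA']
  exact mul_dvd_mul_right h3.dvd _

/-- Distinct nilpotent matrices `(N A, B; N K, -N A)` with `gcd (B, K) = k` that are not opposite to
each other are not parallel, and their inner product is divisible by `N k²`. -/
theorem sq_le_abs_of_gcd_eq {N : ℕ} (hN : Squarefree N) {A B K A' B' K' : ℤ} {k : ℕ}
    (h : N * A ^ 2 = -(B * K)) (h' : N * A' ^ 2 = -(B' * K')) (hk : Int.gcd B K = k)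
    (hk' : Int.gcd B' K' = k) (hk0 : k ≠ 0) (hsign : B < K ↔ B' < K')
    (hne : ¬ (A = A' ∧ B = B' ∧ K = K')) :
    (k : ℤ) ^ 2 ≤ |2 * N * A * A' + B * K' + K * B'| := by
  have hN0 : (N : ℤ) ≠ 0 := by exact_mod_cast hN.ne_zero
  have hdvd : (k : ℤ) ^ 2 ∣ 2 * N * A * A' + B * K' + K * B' := by
    have hB : (k : ℤ) ∣ B := hk ▸ Int.gcd_dvd_left B K
    have hK : (k : ℤ) ∣ K := hk ▸ Int.gcd_dvd_right B K
    have hB' : (k : ℤ) ∣ B' := hk' ▸ Int.gcd_dvd_left B' K'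
    have hK' : (k : ℤ) ∣ K' := hk' ▸ Int.gcd_dvd_right B' K'
    have hA : (k : ℤ) ∣ A := dvd_of_sq_dvd_squarefree_mul_sq hN (by
      rw [h, sq]; exact (mul_dvd_mul hB hK).neg_right)
    have hA' : (k : ℤ) ∣ A' := dvd_of_sq_dvd_squarefree_mul_sq hN (by
      rw [h', sq]; exact (mul_dvd_mul hB' hK').neg_right)
    rw [sq]
    refine dvd_add (dvd_add ?_ (mul_dvd_mul hB hK')) (mul_dvd_mul hK hB')
    exact mul_dvd_mul (hA.mul_left _) hA'
  refine Int.le_of_dvd (abs_pos.2 fun h0 => hne ?_) ((dvd_abs _ _).2 hdvd)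
  have hpar : B * K' = K * B' := by
    have h1 : (B * K' - K * B') ^ 2 = 0 := by
      linear_combination (B * K' + K * B' - 2 * N * A * A') * h0 + 4 * N * A' ^ 2 * h -
        4 * B * K * h'
    exact sub_eq_zero.1 (pow_eq_zero_iff two_ne_zero |>.1 h1)
  have hBB : B.natAbs = B'.natAbs := by
    have h1 : Int.gcd (B * B') (B * K') = Int.gcd (B' * B) (B' * K) := by
      rw [hpar, mul_comm B B', mul_comm K B']
    rw [Int.gcd_mul_left, Int.gcd_mul_left, hk, hk'] at h1
    exact Nat.eq_of_mul_eq_mul_right (Nat.pos_of_ne_zero hk0) h1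
  have hKK : K.natAbs = K'.natAbs := by
    have h1 : Int.gcd (K * B') (K * K') = Int.gcd (K' * B) (K' * K) := by
      rw [← hpar, mul_comm B K', mul_comm K K']
    rw [Int.gcd_mul_left, Int.gcd_mul_left, hk, hk'] at h1
    exact Nat.eq_of_mul_eq_mul_right (Nat.pos_of_ne_zero hk0) h1
  have hBK : ¬ (B = 0 ∧ K = 0) := by
    rintro ⟨rfl, rfl⟩
    exact hk0 (by rw [← hk]; simp)
  have hnonpos : B * K ≤ 0 := by nlinarith [sq_nonneg A, Int.natCast_nonneg N]
  have hBK' : B = B' ∧ K = K' := by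
    rcases Int.natAbs_eq_natAbs_iff.1 hBB with h1 | h1 <;>
      rcases Int.natAbs_eq_natAbs_iff.1 hKK with h2 | h2
    · exact ⟨h1, h2⟩
    · have h3 : B = 0 ∨ K = 0 := by
        apply mul_eq_zero.1
        rw [h1, h2] at hpar
        rw [h1, h2]
        linarith
      omega
    · have h3 : B = 0 ∨ K = 0 := by
        apply mul_eq_zero.1
        rw [h1, h2] at hpar
        rw [h1, h2]
        linarith
      omega
    · exfalso
      have h3 : B ≠ K := by
        rintro rfl
        have : B = 0 := by nlinarith
        exact hBK ⟨this, this⟩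
      omega
  obtain ⟨rfl, rfl⟩ := hBK'
  refine ⟨?_, rfl, rfl⟩
  have h1 : A ^ 2 = A' ^ 2 := mul_left_cancel₀ hN0 (h.trans h'.symm)
  have h2 : A * (A' - A) = 0 := by
    apply mul_left_cancel₀ (mul_ne_zero two_ne_zero hN0)
    linear_combination h0 - 2 * h
  rcases mul_eq_zero.1 h2 with h3 | h3
  · rw [h3] at h1 ⊢
    exact (pow_eq_zero_iff two_ne_zero |>.1 (h1.symm.trans (by norm_num))).symm
  · linarith

/-- Nilpotent matrices `(α, β; κ, -α)` in a ball, with pairwise inner products bounded below, are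
counted by their slopes `α / κ`. -/
theorem ncard_nilpotent_separated_le {ι : Type*} (F : Set ι) (α β κ : ι → ℝ) {L c : ℝ} (hL : 0 < L)
    (hc : 0 < c) (h0 : ∀ z ∈ F, α z ^ 2 + β z * κ z = 0) (hκ : ∀ z ∈ F, κ z ≠ 0)
    (hle : ∀ z ∈ F, |β z| ≤ |κ z|) (hκL : ∀ z ∈ F, |κ z| ≤ L)
    (hsep : ∀ z ∈ F, ∀ w ∈ F, z ≠ w → c ^ 2 ≤ |2 * (α z * α w) + β z * κ w + κ z * β w|) :
    F.Finite ∧ (F.ncard : ℝ) ≤ 2 * L / c + 1 := by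
  have := ncard_le_of_separated F (fun z => α z / κ z) zero_le_one (div_pos hc hL) ?_ ?_
  · rwa [mul_one, div_div_eq_mul_div] at this
  · intro z hz
    rw [abs_div, div_le_one (abs_pos.2 (hκ z hz))]
    apply sq_le_sq.1
    have h1 : α z ^ 2 = -(β z * κ z) := by linarith [h0 z hz]
    calc α z ^ 2 ≤ |β z| * |κ z| := by rw [h1, ← abs_mul]; exact neg_le_abs _
      _ ≤ |κ z| * |κ z| := mul_le_mul_of_nonneg_right (hle z hz) (abs_nonneg _)
      _ = κ z ^ 2 := by rw [← sq, sq_abs]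
  · intro z hz w hw hzw
    have hz0 := hκ z hz
    have hw0 := hκ w hw
    have hid : 2 * (α z * α w) + β z * κ w + κ z * β w =
        -(κ z * κ w * (α z / κ z - α w / κ w) ^ 2) := by
      have hβz : β z = -(α z ^ 2) / κ z := by
        rw [eq_div_iff hz0]; linarith [h0 z hz]
      have hβw : β w = -(α w ^ 2) / κ w := by
        rw [eq_div_iff hw0]; linarith [h0 w hw]
      rw [hβz, hβw]
      field_simp
      ring
    have h1 := hsep z hz w hw hzw
    rw [hid, abs_neg, abs_mul, abs_mul, abs_of_nonneg (sq_nonneg (α z / κ z - α w / κ w))] at h1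
    rw [div_le_iff₀ hL]
    refine (abs_le_of_sq_le_sq' ?_ (by positivity)).2
    calc c ^ 2 ≤ |κ z| * |κ w| * (α z / κ z - α w / κ w) ^ 2 := h1
      _ ≤ L * L * (α z / κ z - α w / κ w) ^ 2 := by
        gcongr
        · exact hκL z hz
        · exact hκL w hw
      _ = (|α z / κ z - α w / κ w| * L) ^ 2 := by rw [mul_pow, sq_abs]; ring

theorem sum_Icc_inv_sq_le_two (n : ℕ) : ∑ k ∈ Finset.Icc 1 n, ((k : ℝ) ^ 2)⁻¹ ≤ 2 := by
  rcases Nat.eq_zero_or_pos n with rfl | hn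
  · simp
  · have h1 : Finset.Icc 1 n = insert 1 (Finset.Ioc 1 n) := by
      ext k
      simp only [Finset.mem_Icc, Finset.mem_insert, Finset.mem_Ioc]
      omega
    rw [h1, Finset.sum_insert (by simp)]
    have h2 := sum_Ioc_inv_sq_le_sub (α := ℝ) one_ne_zero hn
    have h3 : (0 : ℝ) ≤ (n : ℝ)⁻¹ := by positivity
    simp only [Nat.cast_one, inv_one] at h2
    norm_num
    linarith

variable {a b : ℚ} {e : ℍ[ℚ,a,b] ≃ₐ[ℚ] Matrix (Fin 2) (Fin 2) ℚ}

variable (e) in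
/-- The nilpotent elements of the lattice. -/
def nilpotents (N ℓ : ℕ) : Set ℍ[ℚ,a,b] :=
  {z | redTrace z = 0 ∧ redNorm z = 0 ∧ HasEntries e N ℓ z}

variable {N ℓ : ℕ} {g : (QuatExt a b ℝ)ˣ}

theorem algEquiv_11 {z : ℍ[ℚ,a,b]} (hz : redTrace z = 0) : e z 1 1 = -e z 0 0 := by
  have h := trace_algEquiv e z
  rw [hz, Matrix.trace_fin_two] at h
  exact eq_neg_of_add_eq_zero_right h

theorem algEquiv_nilpotent {z : ℍ[ℚ,a,b]} (hz : redTrace z = 0) (hn : redNorm z = 0) :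
    e z 0 0 ^ 2 + e z 0 1 * e z 1 0 = 0 := by
  have h := redNorm_eq_det' e z
  rw [hn, Matrix.det_fin_two, algEquiv_11 hz] at h
  linear_combination h

theorem one_le_mul_torusCoord (hN : Squarefree N) (hℓ : ℓ ≠ 0) {z : ℍ[ℚ,a,b]}
    (hz : z ∈ nilpotents e N ℓ) (hz0 : z ≠ 0) :
    1 ≤ ℓ * heightOf e N g * |torusCoord e g z| := by
  obtain ⟨hzt, hzn, hβ, hκ⟩ := hz
  have hnil := algEquiv_nilpotent (e := e) hzt hzn
  refine one_le_height_mul hN (Units.map (realExt e).toMonoidHom g) hnil ?_ hℓ hβ hκ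
    (X := coordMatrix e g z) ?_
  · rintro ⟨h1, h2⟩
    have h3 : e z 0 0 = 0 := by simpa [h1] using hnil
    apply hz0
    apply e.injective
    rw [map_zero]
    ext r s
    fin_cases r <;> fin_cases s <;> simp [h1, h2, h3, algEquiv_11 hzt]
  · have h1 : (!![((e z 0 0 : ℚ) : ℝ), ((e z 0 1 : ℚ) : ℝ); ((e z 1 0 : ℚ) : ℝ),
        -((e z 0 0 : ℚ) : ℝ)] : Matrix (Fin 2) (Fin 2) ℝ) = realExt e (toExt ℝ z) := by
      rw [realExt_toExt]
      ext r s
      fin_cases r <;> fin_cases s <;> simp [algEquiv_11 hzt]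
    have h2 : ((Units.map (realExt e).toMonoidHom g : GL (Fin 2) ℝ) :
      Matrix (Fin 2) (Fin 2) ℝ) = realExt e (g : QuatExt a b ℝ) := rfl
    rw [h1, h2, coordMatrix, ← map_mul, ← map_mul, ← mul_assoc, ← mul_assoc, Units.mul_inv, one_mul]

theorem heightOf_pos (hN : 0 < N) : 0 < heightOf e N g := height_pos hN _

/-- Parallel nilpotent elements lie on a line, on which the lattice has gaps at least
`1 / (ℓ H)`. -/
theorem ncard_parallel_nilpotents_le (hN : Squarefree N) (hℓ : ℓ ≠ 0) {S : Set ℍ[ℚ,a,b]} {L : ℝ}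
    (hL : 0 ≤ L) (hS : S ⊆ nilpotents e N ℓ) (hpar : ∀ z ∈ S, ∀ w ∈ S, bil z w = 0)
    (hSL : ∀ z ∈ S, |torusCoord e g z| ≤ L) :
    S.Finite ∧ (S.ncard : ℝ) ≤ 2 * (ℓ * heightOf e N g * L) + 1 := by
  have hH : 0 < (ℓ : ℝ) * heightOf e N g :=
    mul_pos (by exact_mod_cast Nat.pos_of_ne_zero hℓ)
      (heightOf_pos (Nat.pos_of_ne_zero hN.ne_zero))
  have := ncard_le_of_separated S (torusCoord e g) hL (inv_pos.2 hH) hSL ?_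
  · rwa [div_inv_eq_mul, mul_assoc, mul_comm L] at this
  · intro z hz w hw hzw
    rw [← torusCoord_sub, inv_le_iff_one_le_mul₀' hH]
    refine one_le_mul_torusCoord hN hℓ ⟨?_, ?_, (hS hz).2.2.sub (hS hw).2.2⟩ (sub_ne_zero.2 hzw)
    · rw [redTrace_sub, (hS hz).1, (hS hw).1, sub_zero]
    · rw [redNorm_sub, (hS hz).2.1, (hS hw).2.1, hpar z hz w hw]
      norm_num

/-- Integral coordinates of a nilpotent element. As `(ℓ α)² = -N B K` and `N` is squarefree, `N`
divides `ℓ α`. -/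
theorem exists_integral_coords (hN : Squarefree N) {z : ℍ[ℚ,a,b]} (hz : z ∈ nilpotents e N ℓ) :
    ∃ A B K : ℤ, N * A ^ 2 = -(B * K) ∧ (ℓ : ℚ) * e z 0 0 = N * A ∧ (ℓ : ℚ) * e z 0 1 = B ∧
      (ℓ : ℚ) * e z 1 0 = N * K := by
  obtain ⟨hzt, hzn, ⟨B, hB⟩, K, hK⟩ := hz
  have hnil := algEquiv_nilpotent (e := e) hzt hzn
  have hN0 : (N : ℤ) ≠ 0 := by exact_mod_cast hN.ne_zero
  obtain ⟨A, hA⟩ := exists_intCast_eq_of_sq (q := ℓ * e z 0 0) ⟨-(N * (B * K)), by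
    push_cast
    rw [mul_pow]
    linear_combination (-(N * K) : ℚ) * hB - (ℓ * e z 0 1 : ℚ) * hK - (ℓ ^ 2 : ℚ) * hnil⟩
  have hA2 : A ^ 2 = -(N * (B * K)) := by
    have : (A : ℚ) ^ 2 = -(N * (B * K)) := by
      rw [hA, mul_pow]
      linear_combination (N * K : ℚ) * hB + (ℓ * e z 0 1 : ℚ) * hK + (ℓ ^ 2 : ℚ) * hnil
    exact_mod_cast this
  have hNA : (N : ℤ) ∣ A := ((Int.squarefree_natCast.2 hN).dvd_pow_iff_dvd two_ne_zero).1
    ⟨-(B * K), by rw [hA2]; ring⟩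
  obtain ⟨A', rfl⟩ := hNA
  refine ⟨A', B, K, ?_, by rw [← hA]; push_cast; rfl, hB.symm, hK.symm⟩
  apply mul_left_cancel₀ hN0
  linear_combination hA2

theorem coordMatrix_smul (c : ℚ) (y : ℍ[ℚ,a,b]) :
    coordMatrix e g (c • y) = (c : ℝ) • coordMatrix e g y := by
  rw [coordMatrix, toExt_smul, mul_smul_comm, smul_mul_assoc, map_smul]
  rfl

theorem torusCoord_smul (c : ℚ) (y : ℍ[ℚ,a,b]) :
    torusCoord e g (c • y) = c * torusCoord e g y := by
  simp only [torusCoord, coordMatrix_smul, Matrix.smul_apply, smul_eq_mul]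
  ring

end Nilpotent

section NilpotentCount

variable {a b : ℚ} {e : ℍ[ℚ,a,b] ≃ₐ[ℚ] Matrix (Fin 2) (Fin 2) ℚ} {N ℓ : ℕ}
  {g : (QuatExt a b ℝ)ˣ}

theorem sq_le_abs_bil_of_nilpotents (hN : Squarefree N) (hℓ : ℓ ≠ 0) {z w : ℍ[ℚ,a,b]}
    (hz : z ∈ nilpotents e N ℓ) (hw : w ∈ nilpotents e N ℓ) {k : ℕ} (hk : k ≠ 0)
    (hzk : Int.gcd ⌊(ℓ : ℚ) * e z 0 1⌋ ⌊(ℓ : ℚ) * e z 1 0 / N⌋ = k)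
    (hwk : Int.gcd ⌊(ℓ : ℚ) * e w 0 1⌋ ⌊(ℓ : ℚ) * e w 1 0 / N⌋ = k)
    (hs : ⌊(ℓ : ℚ) * e z 0 1⌋ < ⌊(ℓ : ℚ) * e z 1 0 / N⌋ ↔
      ⌊(ℓ : ℚ) * e w 0 1⌋ < ⌊(ℓ : ℚ) * e w 1 0 / N⌋) (hzw : z ≠ w) :
    (k * √N / ℓ) ^ 2 ≤ |((bil z w : ℚ) : ℝ)| := by
  obtain ⟨A, B, K, h, hA, hB, hK⟩ := exists_integral_coords hN hz
  obtain ⟨A', B', K', h', hA', hB', hK'⟩ := exists_integral_coords hN hw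
  have hN0 : (N : ℚ) ≠ 0 := by exact_mod_cast hN.ne_zero
  have hℓ0 : (ℓ : ℚ) ≠ 0 := by exact_mod_cast hℓ
  rw [hB, hK, mul_div_cancel_left₀ _ hN0, Int.floor_intCast, Int.floor_intCast] at hzk hs
  rw [hB', hK', mul_div_cancel_left₀ _ hN0, Int.floor_intCast, Int.floor_intCast] at hwk hs
  have hne : ¬ (A = A' ∧ B = B' ∧ K = K') := by
    rintro ⟨rfl, rfl, rfl⟩
    apply hzw
    apply e.injective
    have h00 := mul_left_cancel₀ hℓ0 (hA.trans hA'.symm)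
    have h01 := mul_left_cancel₀ hℓ0 (hB.trans hB'.symm)
    have h10 := mul_left_cancel₀ hℓ0 (hK.trans hK'.symm)
    ext r s
    fin_cases r <;> fin_cases s <;> simp [h00, h01, h10, algEquiv_11 hz.1, algEquiv_11 hw.1]
  have h1 := sq_le_abs_of_gcd_eq hN h h' hzk hwk hk hs hne
  have hbil : (ℓ : ℚ) ^ 2 * bil z w = -(N * ((2 * N * A * A' + B * K' + K * B' : ℤ) : ℚ)) := by
    rw [bil_eq_entries' e, algEquiv_11 hz.1, algEquiv_11 hw.1]
    push_cast
    linear_combination (-2 * (ℓ * e w 0 0) : ℚ) * hA - (2 * (N * A) : ℚ) * hA' -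
      (ℓ * e w 1 0 : ℚ) * hB - (B : ℚ) * hK' - (ℓ * e w 0 1 : ℚ) * hK - (N * K : ℚ) * hB'
  have hbilr : (ℓ : ℝ) ^ 2 * |((bil z w : ℚ) : ℝ)| =
      N * |((2 * N * A * A' + B * K' + K * B' : ℤ) : ℝ)| := by
    have h2 := congrArg (fun q : ℚ => |(q : ℝ)|) hbil
    simp only [Rat.cast_mul, Rat.cast_pow, Rat.cast_natCast, Rat.cast_neg, Rat.cast_intCast,
      abs_neg, abs_mul, abs_pow, Nat.abs_cast] at h2
    exact h2
  have h1r : (k : ℝ) ^ 2 ≤ |((2 * N * A * A' + B * K' + K * B' : ℤ) : ℝ)| := by exact_mod_cast h1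
  have hℓr : (0 : ℝ) < (ℓ : ℝ) ^ 2 := by positivity
  rw [div_pow, mul_pow, Real.sq_sqrt (by positivity), div_le_iff₀ hℓr, mul_comm |_|, hbilr,
    mul_comm]
  gcongr

/-- The content `k` of a nilpotent element is bounded by its size, since the quotient by `k` is
still in the lattice. -/
theorem gcd_pos_and_le_of_nilpotents (hN : Squarefree N) (hℓ : ℓ ≠ 0) {z : ℍ[ℚ,a,b]}
    (hz : z ∈ nilpotents e N ℓ) (hz0 : z ≠ 0) :
    0 < Int.gcd ⌊(ℓ : ℚ) * e z 0 1⌋ ⌊(ℓ : ℚ) * e z 1 0 / N⌋ ∧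
      ((Int.gcd ⌊(ℓ : ℚ) * e z 0 1⌋ ⌊(ℓ : ℚ) * e z 1 0 / N⌋ : ℕ) : ℝ) ≤
        ℓ * heightOf e N g * |torusCoord e g z| := by
  obtain ⟨A, B, K, h, hA, hB, hK⟩ := exists_integral_coords hN hz
  have hN0 : (N : ℚ) ≠ 0 := by exact_mod_cast hN.ne_zero
  have hℓ0 : (ℓ : ℚ) ≠ 0 := by exact_mod_cast hℓ
  rw [hB, hK, mul_div_cancel_left₀ _ hN0, Int.floor_intCast, Int.floor_intCast]
  have hpos : 0 < Int.gcd B K := by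
    rw [Nat.pos_iff_ne_zero]
    intro h0
    obtain ⟨rfl, rfl⟩ := Int.gcd_eq_zero_iff.1 h0
    have h1 : e z 0 1 = 0 := by simpa [hℓ] using hB
    have h2 : e z 1 0 = 0 := by simpa [hℓ] using hK
    have h3 : e z 0 0 = 0 := by
      have h4 := algEquiv_nilpotent (e := e) hz.1 hz.2.1
      rw [h1, h2] at h4
      simpa using h4
    apply hz0
    apply e.injective
    rw [map_zero]
    ext r s
    fin_cases r <;> fin_cases s <;> simp [h1, h2, h3, algEquiv_11 hz.1]
  refine ⟨hpos, ?_⟩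
  set k := Int.gcd B K with hk
  have hk0 : (k : ℚ) ≠ 0 := by exact_mod_cast hpos.ne'
  obtain ⟨B', hB'⟩ : (k : ℤ) ∣ B := Int.gcd_dvd_left B K
  obtain ⟨K', hK'⟩ : (k : ℤ) ∣ K := Int.gcd_dvd_right B K
  have hmem : (k : ℚ)⁻¹ • z ∈ nilpotents e N ℓ := by
    refine ⟨by rw [redTrace_smul, hz.1, mul_zero], by rw [redNorm_smul, hz.2.1, mul_zero],
      ⟨B', ?_⟩, K', ?_⟩
    · rw [map_smul, Matrix.smul_apply, smul_eq_mul, mul_left_comm, hB, hB']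
      push_cast
      field_simp
    · rw [map_smul, Matrix.smul_apply, smul_eq_mul, mul_left_comm, hK, hK']
      push_cast
      field_simp
  have h1 := one_le_mul_torusCoord (g := g) hN hℓ hmem (smul_ne_zero (inv_ne_zero hk0) hz0)
  have hkr : (0 : ℝ) < k := by exact_mod_cast hpos
  rw [torusCoord_smul, abs_mul] at h1
  push_cast at h1
  rw [abs_of_pos (inv_pos.2 hkr), mul_left_comm, inv_mul_eq_div, one_le_div hkr] at h1
  exact h1

/-- The count of nilpotent elements: they are grouped by content, and elements with the same
content that are not parallel have separated slopes. -/
theorem ncard_nilpotents_le (hN : Squarefree N) (hℓ : ℓ ≠ 0) {L : ℝ} (hL : 0 < L) :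
    {z ∈ nilpotents e N ℓ | |torusCoord e g z| ≤ L}.Finite ∧
    ({z ∈ nilpotents e N ℓ | |torusCoord e g z| ≤ L}.ncard : ℝ) ≤
      1 + 8 * (ℓ * heightOf e N g * L) + 8 * ((ℓ : ℝ) ^ 2 * L ^ 2 / N) := by
  set S := {z ∈ nilpotents e N ℓ | |torusCoord e g z| ≤ L} with hS
  have hNr : (0 : ℝ) < N := by exact_mod_cast Nat.pos_of_ne_zero hN.ne_zero
  have hℓr : (0 : ℝ) < ℓ := by exact_mod_cast Nat.pos_of_ne_zero hℓ
  have hH : 0 < heightOf e N g := heightOf_pos (Nat.pos_of_ne_zero hN.ne_zero)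
  set x : ℝ := ℓ * heightOf e N g * L with hx
  have hx0 : 0 ≤ x := by positivity
  set F : ℍ[ℚ,a,b] → ℕ × Bool × Bool := fun z =>
    (Int.gcd ⌊(ℓ : ℚ) * e z 0 1⌋ ⌊(ℓ : ℚ) * e z 1 0 / N⌋,
      decide (⌊(ℓ : ℚ) * e z 0 1⌋ < ⌊(ℓ : ℚ) * e z 1 0 / N⌋),
      decide (|coordMatrix e g z 0 1| ≤ |coordMatrix e g z 1 0|)) with hF
  have hprod : ∀ z ∈ nilpotents e N ℓ, coordMatrix e g z 0 0 ^ 2 +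
      coordMatrix e g z 0 1 * coordMatrix e g z 1 0 = 0 := by
    intro z hz
    have h1 := redNorm_eq_coordMatrix (e := e) (g := g) hz.1
    rw [hz.2.1, Rat.cast_zero] at h1
    linarith
  have hbound : ∀ z ∈ nilpotents e N ℓ, |coordMatrix e g z 1 0| ≤ |torusCoord e g z| ∧
      |coordMatrix e g z 0 1| ≤ |torusCoord e g z| := by
    intro z hz
    have h1 := hprod z hz
    have h2 : coordMatrix e g z 0 1 * coordMatrix e g z 1 0 ≤ 0 := by
      linarith [sq_nonneg (coordMatrix e g z 0 0)]
    constructor <;> apply sq_le_sq.1 <;> rw [torusCoord] <;>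
      nlinarith [sq_nonneg (coordMatrix e g z 0 1), sq_nonneg (coordMatrix e g z 1 0)]
  have hne : ∀ z ∈ nilpotents e N ℓ, z ≠ 0 →
      ¬ (coordMatrix e g z 0 1 = 0 ∧ coordMatrix e g z 1 0 = 0) := by
    rintro z hz hz0 ⟨h1, h2⟩
    have h3 := one_le_mul_torusCoord (g := g) hN hℓ hz hz0
    rw [torusCoord, h1, h2] at h3
    norm_num at h3
  obtain ⟨hfin, hcard⟩ := ncard_le_sum_fibers (S \ {0}) F
    (Finset.Icc 1 ⌊x⌋₊ ×ˢ Finset.univ) (fun z hz => by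
      obtain ⟨⟨hz, hzL⟩, hz0⟩ := hz
      obtain ⟨h1, h2⟩ := gcd_pos_and_le_of_nilpotents (g := g) hN hℓ hz hz0
      simp only [hF, Finset.mem_product, Finset.mem_Icc, Finset.mem_univ, and_true]
      refine ⟨h1, Nat.le_floor (h2.trans ?_)⟩
      rw [hx]
      gcongr)
    (fun κ => 2 * L / (κ.1 * √N / ℓ) + 1) (by
      rintro ⟨k, s, ch⟩ hmem
      simp only [Finset.mem_product, Finset.mem_Icc, Finset.mem_univ, and_true] at hmem
      have hk0 : k ≠ 0 := by omega
      have hkr : (0 : ℝ) < k := by exact_mod_cast Nat.pos_of_ne_zero hk0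
      have hc : (0 : ℝ) < k * √N / ℓ := by positivity
      set Φ := {z ∈ S \ {0} | F z = (k, s, ch)} with hΦ
      have hsep : ∀ z ∈ Φ, ∀ w ∈ Φ, z ≠ w → (k * √N / ℓ) ^ 2 ≤ |((bil z w : ℚ) : ℝ)| := by
        rintro z ⟨⟨⟨hz, -⟩, -⟩, hzF⟩ w ⟨⟨⟨hw, -⟩, -⟩, hwF⟩ hzw
        simp only [hF, Prod.mk.injEq] at hzF hwF
        refine sq_le_abs_bil_of_nilpotents hN hℓ hz hw hk0 hzF.1 hwF.1 ?_ hzw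
        rw [← decide_eq_decide]
        exact hzF.2.1.trans hwF.2.1.symm
      cases ch with
      | true =>
        have hle : ∀ z ∈ Φ, |coordMatrix e g z 0 1| ≤ |coordMatrix e g z 1 0| := by
          rintro z ⟨-, hzF⟩
          simp only [hF, Prod.mk.injEq] at hzF
          exact of_decide_eq_true hzF.2.2
        refine ncard_nilpotent_separated_le Φ (fun z => coordMatrix e g z 0 0)
          (fun z => coordMatrix e g z 0 1) (fun z => coordMatrix e g z 1 0) hL hc
          (fun z hz => hprod z hz.1.1.1) ?_ hle
          (fun z hz => (hbound z hz.1.1.1).1.trans hz.1.1.2) ?_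
        · intro z hz h0
          refine hne z hz.1.1.1 hz.1.2 ⟨?_, h0⟩
          have := hle z hz
          rw [h0, abs_zero] at this
          exact abs_nonpos_iff.1 this
        · intro z hz w hw hzw
          have h1 := hsep z hz w hw hzw
          rwa [bil_eq_coordMatrix (e := e) (g := g) hz.1.1.1.1 hw.1.1.1.1, abs_neg] at h1
      | false =>
        have hle : ∀ z ∈ Φ, |coordMatrix e g z 1 0| ≤ |coordMatrix e g z 0 1| := by
          rintro z ⟨-, hzF⟩
          simp only [hF, Prod.mk.injEq] at hzF
          exact (not_le.1 (of_decide_eq_false hzF.2.2)).le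
        refine ncard_nilpotent_separated_le Φ (fun z => coordMatrix e g z 0 0)
          (fun z => coordMatrix e g z 1 0) (fun z => coordMatrix e g z 0 1) hL hc
          (fun z hz => by simpa only [mul_comm] using hprod z hz.1.1.1) ?_ hle
          (fun z hz => (hbound z hz.1.1.1).2.trans hz.1.1.2) ?_
        · intro z hz h0
          refine hne z hz.1.1.1 hz.1.2 ⟨h0, ?_⟩
          have := hle z hz
          rw [h0, abs_zero] at this
          exact abs_nonpos_iff.1 this
        · intro z hz w hw hzw
          have h1 := hsep z hz w hw hzw
          rw [bil_eq_coordMatrix (e := e) (g := g) hz.1.1.1.1 hw.1.1.1.1, abs_neg] at h1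
          convert h1 using 2
          ring)
  have hSfin : S.Finite := (hfin.union (Set.finite_singleton 0)).subset (by
    intro z hz
    by_cases h : z = 0
    · exact Or.inr h
    · exact Or.inl ⟨hz, h⟩)
  refine ⟨hSfin, ?_⟩
  have h1 : (S.ncard : ℝ) ≤ (S \ {0}).ncard + 1 := by
    have h2 := Set.ncard_le_ncard_sdiff_add_ncard S {0}
    rw [Set.ncard_singleton] at h2
    exact_mod_cast h2
  -- `2 a / k ≤ a ^ 2 / k ^ 2 + 1` spares a logarithm
  have hterm : ∀ k ∈ Finset.Icc 1 ⌊x⌋₊, 2 * L / (k * √N / ℓ) + 1 ≤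
      (ℓ : ℝ) ^ 2 * L ^ 2 / N * ((k : ℝ) ^ 2)⁻¹ + 2 := by
    intro k hk
    have hkr : (0 : ℝ) < k := by exact_mod_cast (Finset.mem_Icc.1 hk).1
    have hsN : 0 < √(N : ℝ) := Real.sqrt_pos.2 hNr
    set u := ℓ * L / (k * √N) with hu
    have h3 : 2 * L / (k * √N / ℓ) = 2 * u := by rw [hu]; field_simp
    have h4 : (ℓ : ℝ) ^ 2 * L ^ 2 / N * ((k : ℝ) ^ 2)⁻¹ = u ^ 2 := by
      rw [hu, div_pow, mul_pow, mul_pow, Real.sq_sqrt hNr.le]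
      field_simp
    rw [h3, h4]
    linarith [sq_nonneg (u - 1)]
  have hsum : ∑ κ ∈ Finset.Icc 1 ⌊x⌋₊ ×ˢ (Finset.univ : Finset (Bool × Bool)),
      (2 * L / (κ.1 * √N / ℓ) + 1) ≤ 8 * x + 8 * ((ℓ : ℝ) ^ 2 * L ^ 2 / N) := by
    rw [Finset.sum_product]
    simp only [Finset.sum_const, Finset.card_univ, Fintype.card_prod, Fintype.card_bool,
      nsmul_eq_mul]
    rw [← Finset.mul_sum]
    have h5 : ∑ k ∈ Finset.Icc 1 ⌊x⌋₊, (2 * L / (k * √N / ℓ) + 1) ≤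
        (ℓ : ℝ) ^ 2 * L ^ 2 / N * 2 + 2 * x := by
      refine (Finset.sum_le_sum hterm).trans ?_
      rw [Finset.sum_add_distrib, ← Finset.mul_sum]
      apply add_le_add
      · gcongr
        exact sum_Icc_inv_sq_le_two _
      · simp only [Finset.sum_const, Nat.card_Icc, Nat.add_sub_cancel, nsmul_eq_mul]
        linarith [Nat.floor_le hx0]
    push_cast
    linarith
  linarith

end NilpotentCount

/-! ### The split case -/

section SplitCount

variable {a b : ℚ}

/-- Elements of the plane orthogonal to an anisotropic element are linearly dependent. -/
theorem triple_eq_zero_of_orthogonal {x u v w : ℍ[ℚ,a,b]} (hx : redTrace x = 0)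
    (hu : redTrace u = 0) (hv : redTrace v = 0) (hw : redTrace w = 0) (hxn : redNorm x ≠ 0)
    (hun : redNorm u = 0) (hxu : bil x u = 0) (hxv : bil x v = 0) (hxw : bil x w = 0)
    (huv : bil u v ≠ 0) : redTrace (u * v * w) = 0 := by
  have h1 := congrArg (bil x) (triple_expansion hu hv hw)
  have h2 := congrArg (bil x) (triple_expansion hu hv hx)
  simp only [bil_add_right, bil_sub_right, bil_smul_right, hxu, hxv, hxw, hun, mul_zero, zero_add,
    zero_sub,    bil_self, bil_comm u x, bil_comm v x, zero_mul, sub_zero] at h1 h2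
  have h3 : bil x (u * v) - bil x (v * u) ≠ 0 := by
    intro h0
    rw [h0, mul_zero] at h2
    have h4 : bil u v ^ 2 * redNorm x = 0 := by linear_combination -h2 / 2
    rcases mul_eq_zero.1 h4 with h5 | h5
    · exact huv (pow_eq_zero_iff two_ne_zero |>.1 h5)
    · exact hxn h5
  rcases mul_eq_zero.1 (neg_eq_zero.1 h1.symm) with h4 | h4
  · exact h4
  · exact absurd h4 h3

/-- Of three isotropic elements of the plane orthogonal to an anisotropic element, two are parallel:
the plane contains at most two isotropic lines. -/
theorem bil_mul_bil_eq_zero_of_orthogonal {x u v w : ℍ[ℚ,a,b]} (hx : redTrace x = 0)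
    (hu : redTrace u = 0) (hv : redTrace v = 0) (hw : redTrace w = 0) (hxn : redNorm x ≠ 0)
    (hun : redNorm u = 0) (hvn : redNorm v = 0) (hwn : redNorm w = 0) (hxu : bil x u = 0)
    (hxv : bil x v = 0) (hxw : bil x w = 0) (huv : bil u v ≠ 0) : bil u w * bil v w = 0 := by
  have h1 := gram_det hu hv hw
  rw [triple_eq_zero_of_orthogonal hx hu hv hw hxn hun hxu hxv hxw huv, hun, hvn, hwn] at h1
  apply mul_left_cancel₀ huv
  linear_combination -h1

variable {e : ℍ[ℚ,a,b] ≃ₐ[ℚ] Matrix (Fin 2) (Fin 2) ℚ} {N ℓ : ℕ} {g : (QuatExt a b ℝ)ˣ}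

theorem ncard_orthogonal_nilpotents_le (hN : Squarefree N) (hℓ : ℓ ≠ 0) {L : ℝ} (hL : 0 ≤ L)
    {x : ℍ[ℚ,a,b]} (hx : redTrace x = 0) (hxn : redNorm x ≠ 0) :
    {z ∈ nilpotents e N ℓ | bil x z = 0 ∧ |torusCoord e g z| ≤ L}.Finite ∧
    ({z ∈ nilpotents e N ℓ | bil x z = 0 ∧ |torusCoord e g z| ≤ L}.ncard : ℝ) ≤
      2 * (2 * (ℓ * heightOf e N g * L) + 1) := by
  set Z := {z ∈ nilpotents e N ℓ | bil x z = 0 ∧ |torusCoord e g z| ≤ L} with hZ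
  have hH : 0 < heightOf e N g := heightOf_pos (Nat.pos_of_ne_zero hN.ne_zero)
  have hB : 0 ≤ 2 * (ℓ * heightOf e N g * L) + 1 := by positivity
  have hsplit : ∀ U V : Set ℍ[ℚ,a,b], Z ⊆ U ∪ V → U ⊆ Z → V ⊆ Z →
      (∀ z ∈ U, ∀ w ∈ U, bil z w = 0) → (∀ z ∈ V, ∀ w ∈ V, bil z w = 0) →
      Z.Finite ∧ (Z.ncard : ℝ) ≤ 2 * (2 * (ℓ * heightOf e N g * L) + 1) := by
    intro U V hUV hU hV hUp hVp
    obtain ⟨f1, c1⟩ := ncard_parallel_nilpotents_le (g := g) hN hℓ hL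
      (fun z hz => (hU hz).1) hUp (fun z hz => (hU hz).2.2)
    obtain ⟨f2, c2⟩ := ncard_parallel_nilpotents_le (g := g) hN hℓ hL
      (fun z hz => (hV hz).1) hVp (fun z hz => (hV hz).2.2)
    refine ⟨(f1.union f2).subset hUV, ?_⟩
    have h1 : (Z.ncard : ℝ) ≤ U.ncard + V.ncard := by
      exact_mod_cast (Set.ncard_le_ncard hUV (f1.union f2)).trans (Set.ncard_union_le _ _)
    linarith
  by_cases hpar : ∀ z ∈ Z, ∀ w ∈ Z, bil z w = 0
  · exact hsplit Z Z Set.subset_union_left subset_rfl subset_rfl hpar hpar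
  push Not at hpar
  obtain ⟨u, hu, v, hv, huv⟩ := hpar
  have htriple : ∀ p ∈ Z, ∀ q ∈ Z, ∀ r ∈ Z, bil p q ≠ 0 → bil p r * bil q r = 0 :=
    fun p hp q hq r hr hpq =>
    bil_mul_bil_eq_zero_of_orthogonal hx hp.1.1 hq.1.1 hr.1.1 hxn hp.1.2.1 hq.1.2.1 hr.1.2.1
      hp.2.1 hq.2.1 hr.2.1 hpq
  have hzero : ∀ z ∈ Z, bil z u = 0 → bil z v = 0 → z = 0 := by
    intro z hz h1 h2
    refine eq_of_bil_eq hu.1.1 hv.1.1 hz.1.1 (by simp [redTrace_eq]) ?_ ?_ ?_ ?_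
    · rw [hu.1.2.1, mul_zero, zero_mul, zero_sub, neg_ne_zero]
      exact pow_ne_zero 2 huv
    · rw [bil_comm, h1]
      simp [bil_eq]
    · rw [bil_comm, h2]
      simp [bil_eq]
    · rw [triple_eq_zero_of_orthogonal hx hu.1.1 hv.1.1 hz.1.1 hxn hu.1.2.1 hu.2.1 hv.2.1 hz.2.1
        huv]
      simp [redTrace_eq]
  refine hsplit {z ∈ Z | bil z v ≠ 0} {z ∈ Z | bil z v = 0} (fun z hz => ?_) (fun z hz => hz.1)
    (fun z hz => hz.1) ?_ ?_
  · by_cases h : bil z v = 0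
    · exact Or.inr ⟨hz, h⟩
    · exact Or.inl ⟨hz, h⟩
  · rintro z ⟨hz, hzv⟩ w ⟨hw, hwv⟩
    by_contra hzw
    exact mul_ne_zero hzv hwv (htriple z hz w hw v hv hzw)
  · rintro z ⟨hz, hzv⟩ w ⟨hw, hwv⟩
    by_cases hzu : bil z u = 0
    · rw [hzero z hz hzu hzv]
      simp [bil_eq]
    by_cases hwu : bil w u = 0
    · rw [hzero w hw hwu hwv]
      simp [bil_eq]
    by_contra hzw
    exact mul_ne_zero hzu hwu (htriple z hz w hw u hu hzw)

end SplitCount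

section SplitBound

/-- In the split case, the elements `y` for which the plane spanned by `x` and `y` is degenerate
differ from `± x` by nilpotent elements orthogonal to `x`. -/
theorem exists_ncard_latticeSet_le_of_algEquiv {ε : ℝ} (hε : 0 < ε) :
    ∃ C : ℝ, 1 ≤ C ∧ ∀ (a b : ℚ), a ≠ 0 → b ≠ 0 →
      ∀ (R : Subring ℍ[ℚ,a,b]) (N : ℕ), IsEichler R → HasLevel R N → Squarefree N →
      ∀ ℓ : ℕ, ℓ ∣ redDisc a b * N → ∀ i j : QuatExt a b ℝ, IsFrame i j →
      ∀ (g : (QuatExt a b ℝ)ˣ) (δ T : ℝ), 0 < δ → 0 < T →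
      ∀ n : ℚ, (∃ m : ℤ, n = (m : ℚ) / (ℓ : ℚ)) →
      ∀ e : ℍ[ℚ,a,b] ≃ₐ[ℚ] Matrix (Fin 2) (Fin 2) ℚ,
        (∀ x, x ∈ R ↔ e x ∈ standardOrder N) → realExt e i = !![0, 1; -1, 0] →
        (latticeSet R ℓ i j g δ T n).Finite ∧
        ((latticeSet R ℓ i j g δ T n).ncard : ℝ) ≤
          C * ((redDisc a b : ℝ) * (N : ℝ) * (1 + T)) ^ ε *
            (1 + (ℓ : ℝ) * √δ * heightOf e N g * T +
              (ℓ : ℝ) ^ 2 / ((redDisc a b : ℝ) * (N : ℝ)) * δ * T ^ 2) := by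
  obtain ⟨C, hC, hmain⟩ := exists_ncard_nondegenerate_le hε
  refine ⟨C + 32, by linarith, ?_⟩
  intro a b ha hb R N hR hN hsq ℓ hℓ i j hij g δ T hδ hT n hn e he hi
  have hN0 : N ≠ 0 := hN.1.ne'
  have hdisc : redDisc a b = 1 := redDisc_eq_one_of_algEquiv e
  have hℓ0 : ℓ ≠ 0 := ne_zero_of_dvd_ne_zero (by rw [hdisc, one_mul]; exact hN0) hℓ
  have hN1 : (1 : ℝ) ≤ N := by exact_mod_cast hN.1
  have hD1 : (1 : ℝ) ≤ (redDisc a b : ℝ) * N := by rw [hdisc]; simpa using hN1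
  have hW : (1 : ℝ) ≤ ((redDisc a b : ℝ) * (N : ℝ) * (1 + T)) ^ ε := by
    apply Real.one_le_rpow _ hε.le
    nlinarith
  set r : ℝ := √δ * T with hr
  have hr0 : 0 < r := mul_pos (Real.sqrt_pos.2 hδ) hT
  have hr2 : δ * T ^ 2 = r ^ 2 := by rw [hr, mul_pow, Real.sq_sqrt hδ.le]
  have hH : 0 < heightOf e N g := heightOf_pos hN.1
  set V := (ℓ : ℝ) ^ 2 / ((redDisc a b : ℝ) * (N : ℝ)) * δ * T ^ 2 with hV
  have hVr : V = (ℓ : ℝ) ^ 2 * r ^ 2 / N := by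
    rw [hV, hdisc, ← hr2]
    push_cast
    ring
  have hV0 : 0 ≤ V := by rw [hVr]; positivity
  set h : ℝ := (ℓ : ℝ) * √δ * heightOf e N g * T with hh
  have hhr : h = ℓ * heightOf e N g * r := by rw [hh, hr]; ring
  have hh0 : 0 ≤ h := by rw [hhr]; positivity
  set W := ((redDisc a b : ℝ) * (N : ℝ) * (1 + T)) ^ ε
  have hWV : 1 + h + V ≤ W * (1 + h + V) := le_mul_of_one_le_left (by positivity) hW
  set S := latticeSet R ℓ i j g δ T n with hS
  have hentries : ∀ y ∈ S, HasEntries e N ℓ y := fun y hy => hasEntries_of_partialDual hsq he hy.1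
  have hmain0 : 0 ≤ C * (W * (1 + h + V)) := mul_nonneg (by linarith) (by positivity)
  rcases eq_or_ne n 0 with hn0 | hn0
  · obtain ⟨hfin, hcard⟩ := ncard_nilpotents_le (e := e) (g := g) hsq hℓ0 (L := 2 * r)
      (by positivity)
    have hsub : S ⊆ {z ∈ nilpotents e N ℓ | |torusCoord e g z| ≤ 2 * r} := by
      intro y hy
      obtain ⟨t, p, q, hc, hpq⟩ := coordMatrix_of_mem_latticeSet (g := g) hij hi hy
      have hyn := hy.2.2.1.trans hn0
      exact ⟨⟨hy.2.1, hyn, hentries y hy⟩,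
        abs_torusCoord_le hy.2.1 hyn hr0.le hc (hr2 ▸ hpq)⟩
    refine ⟨hfin.subset hsub, ?_⟩
    have h1 : (S.ncard : ℝ) ≤ 1 + 16 * h + 32 * V := by
      calc (S.ncard : ℝ) ≤ _ := by exact_mod_cast Set.ncard_le_ncard hsub hfin
        _ ≤ _ := hcard
        _ = _ := by rw [hhr, hVr]; ring
    calc (S.ncard : ℝ) ≤ 32 * (1 + h + V) := by linarith
      _ ≤ C * (W * (1 + h + V)) + 32 * (W * (1 + h + V)) := by linarith
      _ = _ := by ring
  rcases S.eq_empty_or_nonempty with hemp | ⟨x, hx⟩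
  · rw [hemp]
    simp only [Set.finite_empty, Set.ncard_empty, Nat.cast_zero, true_and]
    positivity
  obtain ⟨hfin, hcard⟩ := hmain a b ha hb R N hR hN hsq ℓ hℓ i j hij g δ T hδ hT n hn hn0 x hx
  rw [← hS] at hfin hcard
  set S' := {y ∈ S | 4 * n ^ 2 - bil x y ^ 2 ≠ 0}
  obtain ⟨hZfin, hZcard⟩ := ncard_orthogonal_nilpotents_le (e := e) (g := g) hsq hℓ0
    (L := 2 * (2 * r)) (by positivity) hx.2.1 (by rw [hx.2.2.1]; exact hn0)
  set Z := {z ∈ nilpotents e N ℓ | bil x z = 0 ∧ |torusCoord e g z| ≤ 2 * (2 * r)}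
  obtain ⟨t, p, q, hc, hpq⟩ := coordMatrix_of_mem_latticeSet (g := g) hij hi hx
  have hsub : S ⊆ S' ∪ ((fun z => x + z) '' Z ∪ (fun z => z - x) '' Z) := by
    intro y hy
    by_cases h0 : 4 * n ^ 2 - bil x y ^ 2 = 0
    · right
      obtain ⟨t', p', q', hc', hpq'⟩ := coordMatrix_of_mem_latticeSet (g := g) hij hi hy
      rw [hr2] at hpq hpq'
      have h2 : (bil x y - 2 * n) * (bil x y + 2 * n) = 0 := by linear_combination -h0
      rcases mul_eq_zero.1 h2 with h3 | h3
      · left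
        have htr : redTrace (y - x) = 0 := by rw [redTrace_sub, hy.2.1, hx.2.1, sub_zero]
        have hnm : redNorm (y - x) = 0 := by
          rw [redNorm_sub, hy.2.2.1, hx.2.2.1, bil_comm]; linear_combination -h3
        refine ⟨y - x, ⟨⟨htr, hnm, (hentries y hy).sub (hentries x hx)⟩, ?_, ?_⟩, by simp⟩
        · rw [bil_sub_right, bil_self, hx.2.2.1]; exact h3
        · refine abs_torusCoord_le htr hnm (t := t' - t) (p := p' - p) (q := q' - q)
            (by positivity) ?_ ?_
          · rw [coordMatrix_sub, hc, hc']
            ext u v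
            fin_cases u <;> fin_cases v <;> simp <;> ring
          · nlinarith [sq_nonneg (p + p'), sq_nonneg (q + q')]
      · right
        have htr : redTrace (y + x) = 0 := by rw [redTrace_add, hy.2.1, hx.2.1, add_zero]
        have hnm : redNorm (y + x) = 0 := by
          rw [redNorm_add, hy.2.2.1, hx.2.2.1, bil_comm]; linear_combination h3
        refine ⟨y + x, ⟨⟨htr, hnm, (hentries y hy).add (hentries x hx)⟩, ?_, ?_⟩, by simp⟩
        · rw [bil_add_right, bil_self, hx.2.2.1]; exact h3
        · refine abs_torusCoord_le htr hnm (t := t' + t) (p := p' + p) (q := q' + q)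
            (by positivity) ?_ ?_
          · rw [coordMatrix_add, hc, hc']
            ext u v
            fin_cases u <;> fin_cases v <;> simp <;> ring
          · nlinarith [sq_nonneg (p - p'), sq_nonneg (q - q')]
    · exact Or.inl ⟨hy, h0⟩
  have hfin2 := hfin.union ((hZfin.image (fun z => x + z)).union (hZfin.image (fun z => z - x)))
  refine ⟨hfin2.subset hsub, ?_⟩
  have h1 : S.ncard ≤ S'.ncard + (Z.ncard + Z.ncard) :=
    (Set.ncard_le_ncard hsub hfin2).trans ((Set.ncard_union_le _ _).trans
      (Nat.add_le_add_left ((Set.ncard_union_le _ _).trans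
        (Nat.add_le_add (Set.ncard_image_le hZfin) (Set.ncard_image_le hZfin))) _))
  have hCW : C * W * (1 + V) ≤ C * (W * (1 + h + V)) := by
    rw [mul_assoc]
    have : 0 ≤ C * W := mul_nonneg (by linarith) (by linarith)
    nlinarith [mul_nonneg this hh0]
  calc (S.ncard : ℝ) ≤ S'.ncard + (Z.ncard + Z.ncard) := by exact_mod_cast h1
    _ ≤ C * W * (1 + V) + 2 * (2 * (2 * (ℓ * heightOf e N g * (2 * (2 * r))) + 1)) := by linarith
    _ = C * W * (1 + V) + (32 * h + 4) := by rw [hhr]; ring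
    _ ≤ C * (W * (1 + h + V)) + 32 * (W * (1 + h + V)) := by linarith
    _ = _ := by ring

end SplitBound

end TypeII

theorem mainTheorem9 (ε : ℝ) (hε : 0 < ε) :
    ∃ C : ℝ, 0 < C ∧
      ∀ (a b : ℚ), a ≠ 0 → b ≠ 0 →
      ∀ (R : Subring ℍ[ℚ,a,b]) (N : ℕ), TypeII.IsEichler R → TypeII.HasLevel R N → Squarefree N →
      ∀ ℓ : ℕ, ℓ ∣ TypeII.redDisc a b * N →
      ∀ i j : TypeII.QuatExt a b ℝ, TypeII.IsFrame i j →
      ∀ (g : (TypeII.QuatExt a b ℝ)ˣ) (δ T : ℝ), 0 < δ → δ ≤ 1 → 0 < T →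
      ∀ n : ℚ, (∃ m : ℤ, n = (m : ℚ) / (ℓ : ℚ)) →
        (¬ TypeII.IsSplit a b →
          (TypeII.typeIISet R ℓ i j g δ T n).Finite ∧
          ((TypeII.typeIISet R ℓ i j g δ T n).ncard : ℝ) ≤
            C * ((TypeII.redDisc a b : ℝ) * (N : ℝ) * (1 + T)) ^ ε *
              (1 + (ℓ : ℝ) ^ 2 / ((TypeII.redDisc a b : ℝ) * (N : ℝ)) * δ * T ^ 2)) ∧
        (∀ e : ℍ[ℚ,a,b] ≃ₐ[ℚ] Matrix (Fin 2) (Fin 2) ℚ,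
          (∀ x, x ∈ R ↔ e x ∈ TypeII.standardOrder N) →
          TypeII.realExt e i = !![0, 1; -1, 0] →
          (TypeII.typeIISet R ℓ i j g δ T n).Finite ∧
          ((TypeII.typeIISet R ℓ i j g δ T n).ncard : ℝ) ≤
            C * ((TypeII.redDisc a b : ℝ) * (N : ℝ) * (1 + T)) ^ ε *
              (1 + (ℓ : ℝ) * δ ^ (1 / 2 : ℝ) * TypeII.heightOf e N g * T +
                (ℓ : ℝ) ^ 2 / ((TypeII.redDisc a b : ℝ) * (N : ℝ)) * δ * T ^ 2)) := by
  obtain ⟨C₁, hC₁, h₁⟩ := TypeII.exists_ncard_latticeSet_le_of_not_isSplit hε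
  obtain ⟨C₂, hC₂, h₂⟩ := TypeII.exists_ncard_latticeSet_le_of_algEquiv hε
  refine ⟨max C₁ C₂, by positivity, ?_⟩
  intro a b ha hb R N hR hN hsq ℓ hℓ i j hij g δ T hδ _ hT n hn
  constructor
  · intro hns
    obtain ⟨hfin, hcard⟩ := h₁ a b ha hb R N hR hN hsq ℓ hℓ i j hij g δ T hδ hT n hn hns
    obtain ⟨hfin', hle⟩ := TypeII.ncard_typeIISet_le hfin
    refine ⟨hfin', (Nat.cast_le.2 hle).trans (hcard.trans ?_)⟩
    gcongr
    exact le_max_left _ _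
  · intro e he hi
    obtain ⟨hfin, hcard⟩ := h₂ a b ha hb R N hR hN hsq ℓ hℓ i j hij g δ T hδ hT n hn e he hi
    obtain ⟨hfin', hle⟩ := TypeII.ncard_typeIISet_le hfin
    have hH : 0 < TypeII.heightOf e N g := TypeII.heightOf_pos hN.1
    rw [← Real.sqrt_eq_rpow]
    refine ⟨hfin', (Nat.cast_le.2 hle).trans (hcard.trans ?_)⟩
    gcongr
    exact le_max_right _ _
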